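/- **Normal o-graphs.** A normal o-graph is an oriented virtual link diagram up to planar isotopy and the Reidemeister-type moves involving virtual crossings; no component is a circle without real crossings. It represents a branched standard polyhedron $P$ (true vertices = real crossings; $1$-cells = edges joining real crossings, canonically oriented). The boundaries of the $2$-cells are encoded by three parallel lines along each edge, numbered $1,2,3$ from left to right along the orientation of the edge; the boundary orientation of the $2$-cells agrees with that of the edge on lines $1,2$ and is opposite on line $3$. Write $o_l,u_l$ (resp. $o^l,u^l$) for line $l$ on the incoming (resp. outgoing) over- and under-edge of a crossing. The lines are joined in the pairs $$o_2o^2,\quad u_1u^1,\quad o_1u^2,\quad u_3o^3,\quad u_2o_3,\quad o^1u^3\qquad\text{(positive crossing)},$$ $$o_2o^2,\quad u_1u^1,\quad u_2o^1,\quad o_3u^3,\quad o_1u_3,\quad u^2o^3\qquad\text{(negative crossing)}.$$ The last two pairs in each row, where two incoming or two outgoing lines meet, are the corners with a solid dot. **Framed integral normal o-graphs.** An integral normal o-graph is a normal o-graph with an integer weight on each edge, i.e. a cochain $x\in C^1(P;\mathbb Z)$ (when an edge is subdivided its weight is the sum of the weights of its parts). The rotation number along a path in the boundary of a $2$-cell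 is the sum of $\pm x(e)$ over the traversed edges ($+$ if $e$ is traversed along its orientation, $-$ otherwise) and of $-\frac12$ for each solid dot passed. We call $(P,x)$ *framed* if $\delta x=c_P$, where $c_P=-\sum_i(1-\frac{n_i}{2})\hat\Delta_i$ is the Euler cochain and $n_i$ is the number of solid dots on $\partial\Delta_i$; equivalently, the rotation number along the boundary of each $2$-cell is $-1$. **Integral H-move.** At a real crossing, add $1$ to the weights of the two incoming edges and $-1$ to those of the two outgoing edges. **Integral pure sliding moves.** Let a left and a right vertical segment of edges (possibly of the same edge) lie on the boundary of a common $2$-cell $\Delta$ between them, so that the boundary of $\Delta$ goes down the left segment, then along a path from its bottom to the bottom of the right segment, then up the right segment. Let $p$ be the rotation number along that path. The move replaces the two segments by two segments that cross twice, at real crossings of opposite signs (as in a Reidemeister II move), where * (I) both segments go up, $\Delta$ is on line $3$ of the left and line $2$ of the right segment, the left one passes over; * (II) both go up, $\Delta$ is on line $3$ of the left and line $1$ of the right segment, the left one passes under; * (III) the left one goes down and the right one up, $\Delta$ is on line $1$ of the left and line $2$ of the right segment, the left one passes over; * (IV) the left one goes up and the right one down, $\Delta$ is on line $3$ of both, the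 left one passes over. If the segments have weights $k$ (left) and $l$ (right), then after the move the three parts (bottom, middle, top) of the left segment have weights $0,0,k$ and those of the right segment have weights $a,m,l-a-m$, where $(a,m)=(-p-\frac12,0)$ for I and II, $(a,m)=(-p-1,1)$ for III, $(a,m)=(p+1,-1)$ for IV. (Up to H-moves at the two new crossings these are the only weights for which the new diagram is framed and all weights outside are unchanged.) **Integral MP moves.** Each of the 16 moves replaces a tangle with two real crossings and three open strands $e,s_1,s_2$ by one with three real crossings $0,1,2$. Tangles are given by Gauss codes: $iO$ and $iU$ mean passing over and under crossing $i$. Before the move the strands are $e=(0b,1b')$, $s_1=(0\bar b)$, $s_2=(1\bar b')$, where $b,b'\in\{O,U\}$ and $\bar O=U$, $\bar U=O$; in the table we list $bb'$ and the signs of the crossings $0,1$. After the move we list the signs of $0,1,2$ and the three strands. | move | before | after: signs | $e$ | $s_1$ | $s_2$ | |---|---|---|---|---|---| | A1 | OO, ++ | ++− | 1O | 0O 1U 2O | 0U 2U | | A2 | OO, +− | ++− | 0O | 2O 0U 1O | 1U 2U | | A3 | OO, −− | +−− | 1O | 0U 2U | 0O 1U 2O | | A4 | OO, +− | +−− | 2O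 | 0U 1U | 1O 2U 0O | | B1 | UU, −− | +−− | 2U | 1U 2O 0U | 1O 0O | | B2 | UU, −+ | +−− | 1U | 0U 1O 2U | 2O 0O | | B3 | UU, ++ | ++− | 0U | 2O 1O | 2U 0O 1U | | B4 | UU, −+ | ++− | 1U | 2O 0O | 0U 1O 2U | | C1 | UO, −+ | ++− | 1O 2U | 0O 2O | 0U 1U | | C2 | UO, −− | −−− | 0O 2U | 1O 2O | 0U 1U | | C3 | UO, ++ | ++− | 0O 1U | 1O 2O | 2U 0U | | C4 | UO, +− | ++− | 2O 0U | 0O 1O | 2U 1U | | D1 | OU, −+ | +−− | 0U 1O | 1U 2U | 0O 2O | | D2 | OU, ++ | +++ | 0U 2O | 1U 2U | 0O 1O | | D3 | OU, −− | +−− | 1U 2O | 2U 0U | 0O 1O | | D4 | OU, +− | +−− | 2U 0O | 1U 0U | 1O 2O | All weights in the two tangles are $0$, except that after the cyclic moves the last inner edge of $s_1$ and the outgoing open edge of $s_1$ have weights $-1,+1$ (A2, A4, B2, B4) or $+1,-1$ (C3, D3). Weights that come to lie on the same edge are added. The weights inside the two tangles may also be changed by H-moves at the crossings of the tangles. The *primary*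 integral MP move is D2 with all weights in the two tangles equal to $0$. **Theorem.** If an integral normal o-graph $\Gamma'$ is obtained from a framed integral normal o-graph $\Gamma$ by one of the 16 integral MP moves, then $\Gamma'$ is obtained from $\Gamma$ by a finite sequence of primary integral MP moves, integral pure sliding moves I--IV, integral H-moves and inverses of such moves, through framed integral normal o-graphs. -/

import Mathlib

/-!
# Integral normal o-graphs and their moves

A normal o-graph is an oriented virtual link diagram up to planar isotopy and the Reidemeister type
moves which involve virtual crossings. Up to these moves a diagram is determined by its crossings
(real crossings carry a sign, and each crossing has two strands) together with the way in which the
outgoing ends at the crossings are joined by edges to the incoming ends.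

At a crossing `v` the two strands are `(v, true)` and `(v, false)`. If `v` is a real crossing,
`(v, true)` is the over-strand and `(v, false)` is the under-strand. The same pair denotes the
incoming end, the outgoing end, and the edge which starts at the outgoing end.
-/

/-- An oriented virtual link diagram with an integer weight on each edge.
`kind v` is `1` or `-1` for a positive or negative real crossing and `0` for a virtual crossing.
`next s` is the incoming end at which the edge starting at the outgoing end `s` arrives. -/
structure VDiagram : Type 1 where
  V : Type
  [fin : Finite V]
  kind : V → SignType
  next : V × Bool ≃ V × Bool
  weight : V × Bool → ℤ

namespace VDiagram

/-! ### Diagrams up to isomorphism and virtual moves -/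

/-- Isomorphism of weighted diagrams. -/
def Iso (D D' : VDiagram) : Prop :=
  ∃ φ : D.V ≃ D'.V,
    (∀ v, D'.kind (φ v) = D.kind v) ∧
    (∀ v b, D'.next (φ v, b) = (φ (D.next (v, b)).1, (D.next (v, b)).2)) ∧
    (∀ v b, D'.weight (φ v, b) = D.weight (v, b))

/-- The connections of the disjoint union of `D` and one more crossing, whose two strands are closed
up to two separate loops. It only serves to define `insertVirtual`. -/
def addLoops (D : VDiagram) : (D.V ⊕ Unit) × Bool ≃ (D.V ⊕ Unit) × Bool :=
  (Equiv.sumProdDistrib D.V Unit Bool).trans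
    ((Equiv.sumCongr D.next (Equiv.refl _)).trans (Equiv.sumProdDistrib D.V Unit Bool).symm)

open Classical in
/-- Insert a new virtual crossing `Sum.inr ()`: first its strand `true` is inserted into the edge
`s₁`, then its strand `false` is inserted into an edge `s₂` of the resulting diagram
(which may be a part of the same edge, before or after the strand `true`).
The weight of an edge that gets divided is divided arbitrarily, the parts having the same sum. -/
noncomputable def insertVirtual (D : VDiagram) (s₁ : D.V × Bool) (s₂ : (D.V ⊕ Unit) × Bool)
    (u₁ u₂ : ℤ) : VDiagram :=
  haveI := D.fin
  let q₁ : (D.V ⊕ Unit) × Bool := (Sum.inr (), true)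
  let q₂ : (D.V ⊕ Unit) × Bool := (Sum.inr (), false)
  let t₁ : (D.V ⊕ Unit) × Bool := (Sum.inl s₁.1, s₁.2)
  let w₀ : (D.V ⊕ Unit) × Bool → ℤ := fun s => Sum.elim (fun v => D.weight (v, s.2)) (fun _ => 0) s.1
  let w₁ := Function.update (Function.update w₀ t₁ (w₀ t₁ - u₁)) q₁ u₁
  { V := D.V ⊕ Unit
    kind := Sum.elim D.kind (fun _ => 0)
    next := (Equiv.swap s₂ q₂).trans ((Equiv.swap t₁ q₁).trans D.addLoops)
    weight := Function.update (Function.update w₁ s₂ (w₁ s₂ - u₂)) q₂ u₂ }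

/-- The relation generating the equivalence of diagrams: isomorphism, and insertion of a virtual
crossing. -/
inductive Equivalent : VDiagram → VDiagram → Prop
  | iso {D D' : VDiagram} (h : Iso D D') : Equivalent D D'
  | insert (D : VDiagram) (s₁ : D.V × Bool) (s₂ : (D.V ⊕ Unit) × Bool) (u₁ u₂ : ℤ)
      (h : s₂ ≠ (Sum.inr (), false)) : Equivalent D (D.insertVirtual s₁ s₂ u₁ u₂)

/-- No component of the link diagram is a circle without real crossings, so that the singular set
of the associated polyhedron is a union of true vertices and open edges. -/
def NoFreeCircle (D : VDiagram) : Prop :=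
  ∀ s : D.V × Bool, ∃ n : ℕ, D.kind ((D.next)^[n] s).1 ≠ 0

/-! ### Circuits: the boundaries of the `2`-cells

Along an edge of the diagram run three parallel lines, numbered `0, 1, 2` from left to right when one
looks along the edge (the first, second and third line). They are the parts of the boundaries of
`2`-cells that are attached to the edge. The boundary orientation of the `2`-cells agrees with
the orientation of the edge on lines `0` and `1`, and is opposite to it on line `2`. -/

/-- A line along an edge. -/
abbrev Germ (D : VDiagram) : Type := (D.V × Bool) × Fin 3

/-- How the lines are connected at a crossing. If one follows the boundary orientation and arrives at
the crossing on line `l` of strand `b`, then one leaves it on line `(corner ε b l).2` of strand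
`(corner ε b l).1`. Here lines `0, 1` are followed from incoming ends to outgoing ends, and
line `2` is followed from outgoing ends to incoming ends. -/
def corner : SignType → Bool → Fin 3 → Bool × Fin 3
  | .zero, b, l => (b, l)
  | .pos, true, 0 => (false, 1)
  | .pos, true, 1 => (true, 1)
  | .pos, true, 2 => (false, 2)
  | .pos, false, 0 => (false, 0)
  | .pos, false, 1 => (true, 2)
  | .pos, false, 2 => (true, 0)
  | .neg, true, 0 => (false, 2)
  | .neg, true, 1 => (true, 1)
  | .neg, true, 2 => (false, 1)
  | .neg, false, 0 => (false, 0)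
  | .neg, false, 1 => (true, 0)
  | .neg, false, 2 => (true, 2)

/-- The next line on the boundary of a `2`-cell, following the boundary orientation. -/
def succ (D : VDiagram) (g : D.Germ) : D.Germ :=
  let p : D.V × Bool := if g.2 = 2 then g.1 else D.next g.1
  let c := corner (D.kind p.1) p.2 g.2
  (if c.2 = 2 then D.next.symm (p.1, c.1) else (p.1, c.1), c.2)

/-- The contribution of an edge to the rotation number along the boundary of a `2`-cell, which is also
its contribution to the coboundary of the weight: the weight of the edge, up to orientation. -/
def along (D : VDiagram) (g : D.Germ) : ℤ := if g.2 = 2 then -D.weight g.1 else D.weight g.1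

/-- There is a solid dot at the corner at the end of the line `g`: the boundary of the
`2`-cell changes there from following the orientation of the edges to opposing it, or back. -/
def Dot (D : VDiagram) (g : D.Germ) : Prop := ¬ (g.2 = 2 ↔ (D.succ g).2 = 2)

open Classical in
/-- The contribution to the rotation number of the corner at the end of the line `g`. -/
noncomputable def turn (D : VDiagram) (g : D.Germ) : ℚ := if D.Dot g then -1 / 2 else 0

/-- The value of `δ x` on the `2`-cell with `g` on its boundary, where `x` is the weight. -/
noncomputable def coboundary (D : VDiagram) (g : D.Germ) : ℤ :=
  ∑ i ∈ Finset.range (Function.minimalPeriod D.succ g), D.along (D.succ^[i] g)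

open Classical in
/-- The number of solid dots on the boundary of the `2`-cell with `g` on its boundary. -/
noncomputable def dots (D : VDiagram) (g : D.Germ) : ℕ :=
  ((Finset.range (Function.minimalPeriod D.succ g)).filter fun i => D.Dot (D.succ^[i] g)).card

/-- The value of the Euler cochain on the `2`-cell with `g` on its boundary. -/
noncomputable def euler (D : VDiagram) (g : D.Germ) : ℚ := -(1 - (D.dots g : ℚ) / 2)

/-- The weight `x` satisfies `δ x = c_P`, with `c_P` the Euler cochain. -/
def Framed (D : VDiagram) : Prop := ∀ g : D.Germ, (D.coboundary g : ℚ) = D.euler g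

/-! ### The H-move -/

/-- Add the coboundary of the `0`-cochain `f` to the weight. -/
def gauge (D : VDiagram) (f : D.V → ℤ) : VDiagram :=
  { D with weight := fun s => D.weight s + f (D.next s).1 - f s.1 }

open Classical in
/-- The integral H-move at a real crossing: the weights of the two incoming edges are increased by one,
and the weights of the two outgoing edges are decreased by one. -/
def HMove (D D' : VDiagram) : Prop :=
  ∃ v : D.V, D.kind v ≠ 0 ∧ D' = D.gauge (fun u => if u = v then 1 else 0)

end VDiagram

/-! ### Pure sliding moves -/

/-- The four types of pure sliding moves. -/
inductive SlideType
  | I | II | III | IV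

namespace SlideType

/-- Is the left edge directed upwards in the picture of the move? -/
def leftUp : SlideType → Bool
  | I => true | II => true | III => false | IV => true

/-- Is the right edge directed upwards in the picture of the move? -/
def rightUp : SlideType → Bool
  | I => true | II => true | III => true | IV => false

/-- Does the left edge pass over the right edge after the move? -/
def leftOver : SlideType → Bool
  | I => true | II => false | III => true | IV => true

/-- The line on the left edge that belongs to the `2`-cell between the edges. -/
def leftLine : SlideType → Fin 3
  | I => 2 | II => 2 | III => 0 | IV => 2

/-- The line on the right edge that belongs to the `2`-cell between the edges. -/
def rightLine : SlideType → Fin 3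
  | I => 1 | II => 0 | III => 1 | IV => 2

/-- The sign of the lower one of the two new crossings. The upper one has the opposite sign. -/
def bottomSign : SlideType → SignType
  | I => 1 | II => -1 | III => -1 | IV => -1

/-- The new weight on the part of the right edge below the new crossings, in terms of the
rotation number `p`. -/
def lowWeight : SlideType → ℚ → ℚ
  | I, p => -p - 1 / 2
  | II, p => -p - 1 / 2
  | III, p => -p - 1
  | IV, p => p + 1

/-- The new weight on the part of the right edge between the new crossings. -/
def midWeight : SlideType → ℚ
  | I => 0 | II => 0 | III => 1 | IV => -1

end SlideType

namespace VDiagram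

/-- For a strand `b` passing vertically through `B` (below) and `T` (above), upwards if `up` is true
and downwards otherwise: the part of the strand below `B`. -/
def lowEdge (D : VDiagram) (B : D.V) (b up : Bool) : D.V × Bool :=
  if up then D.next.symm (B, b) else (B, b)

/-- The part of the strand between `B` and `T`. -/
def midEdge (D : VDiagram) (B T : D.V) (b up : Bool) : D.V × Bool :=
  if up then (B, b) else (T, b)

/-- The part of the strand above `T`. -/
def highEdge (D : VDiagram) (T : D.V) (b up : Bool) : D.V × Bool :=
  if up then (T, b) else D.next.symm (T, b)

/-- The strand `b` passes through the crossings `B` and `T` consecutively. -/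
def Passes (D : VDiagram) (B T : D.V) (b up : Bool) : Prop :=
  D.next (D.midEdge B T b up) = if up then (T, b) else (B, b)

open Classical in
/-- The integral pure sliding move of type `t`. Before the move the left edge and the right edge
cross each other twice at virtual crossings `B` and `T`, that is, not at all; after the move the
two crossings are real. The condition for the move is that, along the boundary of a `2`-cell,
the prescribed line of the left edge is connected to the prescribed line of the right edge
in such a way that the bottom ends of the edges are joined.
The weights of the two edges before the move are placed outside of the parts below `T` that
are shown in the picture, and `p` is the rotation number from the bottom of the left edge
to the bottom of the right edge along the boundary of the `2`-cell. -/
def Slide (t : SlideType) (D D' : VDiagram) : Prop :=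
  ∃ (B T : D.V) (n : ℕ) (p : ℚ) (w : D.V × Bool → ℤ),
    let b₁ : Bool := t.leftOver
    let b₂ : Bool := !t.leftOver
    let low₁ := D.lowEdge B b₁ t.leftUp
    let low₂ := D.lowEdge B b₂ t.rightUp
    let mid₁ := D.midEdge B T b₁ t.leftUp
    let mid₂ := D.midEdge B T b₂ t.rightUp
    let high₂ := D.highEdge T b₂ t.rightUp
    let g₁ : D.Germ := (low₁, t.leftLine)
    let g₂ : D.Germ := (low₂, t.rightLine)
    B ≠ T ∧ D.kind B = 0 ∧ D.kind T = 0 ∧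
    D.Passes B T b₁ t.leftUp ∧ D.Passes B T b₂ t.rightUp ∧
    D.weight low₁ = 0 ∧ D.weight mid₁ = 0 ∧ D.weight low₂ = 0 ∧ D.weight mid₂ = 0 ∧
    n < Function.minimalPeriod D.succ g₁ ∧ D.succ^[n] g₁ = g₂ ∧
    p = ∑ i ∈ Finset.range n, ((D.along (D.succ^[i] g₁) : ℚ) + D.turn (D.succ^[i] g₁)) ∧
    (∀ s, (w s : ℚ) = D.weight s + (if s = low₂ then t.lowWeight p else 0)
      + (if s = mid₂ then t.midWeight else 0)
      - (if s = high₂ then t.lowWeight p + t.midWeight else 0)) ∧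
    D' = { D with
      kind := Function.update (Function.update D.kind B t.bottomSign) T (-t.bottomSign)
      weight := w }

end VDiagram

/-! ### Matveev-Piergallini moves -/

/-- A tangle with `n` real crossings and three open strands, given by its Gauss code. Strand `j`
enters from outside, passes through `first j` and then through the list `rest j`, and leaves;
each entry `(v, b)` means passing through the crossing `v` over (`b = true`) or
under (`b = false`). `wt (v, b)` is the weight of the edge, or open edge, following this passage;
the open edges at the beginning of the strands have weight zero. -/
structure OTangle (n : ℕ) where
  sign : Fin n → SignType
  first : Fin 3 → Fin n × Bool
  rest : Fin 3 → List (Fin n × Bool)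
  wt : Fin n × Bool → ℤ := fun _ => 0

/-- The last crossing passage of strand `j`. -/
def OTangle.last {n : ℕ} (T : OTangle n) (j : Fin 3) : Fin n × Bool :=
  (T.rest j).getLastD (T.first j)

/-- What remains of a weighted diagram outside of a tangle with three strands. `link` joins the
outgoing ends (of outside crossings and of the three strands of the tangle) to the incoming ends. -/
structure Outside where
  W : Type
  [fin : Finite W]
  kind : W → SignType
  link : (W × Bool) ⊕ Fin 3 ≃ (W × Bool) ⊕ Fin 3
  weight : (W × Bool) ⊕ Fin 3 → ℤ

/-- `D` is obtained by gluing the tangle `T` to the outside `O`, where weights that come to lie on the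
same edge are added; `φ` identifies the crossings. -/
structure IsClosure {n : ℕ} (T : OTangle n) (O : Outside) (D : VDiagram)
    (φ : Fin n ⊕ O.W ≃ D.V) : Prop where
  kind_in : ∀ i, D.kind (φ (Sum.inl i)) = T.sign i
  kind_out : ∀ x, D.kind (φ (Sum.inr x)) = O.kind x
  next_in : ∀ j p q, [p, q] <:+: T.first j :: T.rest j →
    D.next (φ (Sum.inl p.1), p.2) = (φ (Sum.inl q.1), q.2)
  weight_in : ∀ j p q, [p, q] <:+: T.first j :: T.rest j →
    D.weight (φ (Sum.inl p.1), p.2) = T.wt p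
  next_out : ∀ x,
    D.next (Sum.elim (fun s => (φ (Sum.inr s.1), s.2))
      (fun j => (φ (Sum.inl (T.last j).1), (T.last j).2)) x) =
    Sum.elim (fun s => (φ (Sum.inr s.1), s.2))
      (fun j => (φ (Sum.inl (T.first j).1), (T.first j).2)) (O.link x)
  weight_out : ∀ x,
    D.weight (Sum.elim (fun s => (φ (Sum.inr s.1), s.2))
      (fun j => (φ (Sum.inl (T.last j).1), (T.last j).2)) x) =
    O.weight x + Sum.elim (fun _ => 0) (fun j => T.wt (T.last j)) x

/-- The sixteen MP moves. -/
inductive MPType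
  | A1 | A2 | A3 | A4
  | B1 | B2 | B3 | B4
  | C1 | C2 | C3 | C4
  | D1 | D2 | D3 | D4

namespace MPType

/-- Two crossings `0` and `1` of signs `k₀` and `k₁`, joined by an edge which leaves the strand `b₀`
of crossing `0` and enters the strand `b₁` of crossing `1`. All weights are zero. -/
def pair (b₀ b₁ : Bool) (k₀ k₁ : SignType) : OTangle 2 where
  sign := ![k₀, k₁]
  first := ![(0, b₀), (0, !b₀), (1, !b₁)]
  rest := ![[(1, b₁)], [], []]

/-- The tangle with two crossings before the move. -/
def before : MPType → OTangle 2
  | A1 => pair true true 1 1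
  | A2 => pair true true 1 (-1)
  | A3 => pair true true (-1) (-1)
  | A4 => pair true true 1 (-1)
  | B1 => pair false false (-1) (-1)
  | B2 => pair false false (-1) 1
  | B3 => pair false false 1 1
  | B4 => pair false false (-1) 1
  | C1 => pair false true (-1) 1
  | C2 => pair false true (-1) (-1)
  | C3 => pair false true 1 1
  | C4 => pair false true 1 (-1)
  | D1 => pair true false (-1) 1
  | D2 => pair true false 1 1
  | D3 => pair true false (-1) (-1)
  | D4 => pair true false 1 (-1)

/-- Passing over crossing `i`. -/
def o (i : Fin 3) : Fin 3 × Bool := (i, true)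

/-- Passing under crossing `i`. -/
def u (i : Fin 3) : Fin 3 × Bool := (i, false)

/-- Weight `c` on the edge following the passage `p`, weight `-c` on the edge following the passage `q`,
and weight zero otherwise. -/
def wts (p q : Fin 3 × Bool) (c : ℤ) : Fin 3 × Bool → ℤ :=
  fun s => if s = p then c else if s = q then -c else 0

/-- The tangle with three crossings after the move. The moves `A2, A4, B2, B4, C3, D3`, where the
three inner edges form an oriented cycle, are the ones with non-trivial weights. -/
def after : MPType → OTangle 3
  | A1 => { sign := ![1, 1, -1], first := ![o 1, o 0, u 0], rest := ![[], [u 1, o 2], [u 2]] }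
  | A2 => { sign := ![1, 1, -1], first := ![o 0, o 2, u 1], rest := ![[], [u 0, o 1], [u 2]]
            wt := wts (u 0) (o 1) (-1) }
  | A3 => { sign := ![1, -1, -1], first := ![o 1, u 0, o 0], rest := ![[], [u 2], [u 1, o 2]] }
  | A4 => { sign := ![1, -1, -1], first := ![o 2, u 0, o 1], rest := ![[], [u 1], [u 2, o 0]]
            wt := wts (u 0) (u 1) (-1) }
  | B1 => { sign := ![1, -1, -1], first := ![u 2, u 1, o 1], rest := ![[], [o 2, u 0], [o 0]] }
  | B2 => { sign := ![1, -1, -1], first := ![u 1, u 0, o 2], rest := ![[], [o 1, u 2], [o 0]]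
            wt := wts (o 1) (u 2) (-1) }
  | B3 => { sign := ![1, 1, -1], first := ![u 0, o 2, u 2], rest := ![[], [o 1], [o 0, u 1]] }
  | B4 => { sign := ![1, 1, -1], first := ![u 1, o 2, u 0], rest := ![[], [o 0], [o 1, u 2]]
            wt := wts (o 2) (o 0) (-1) }
  | C1 => { sign := ![1, 1, -1], first := ![o 1, o 0, u 0], rest := ![[u 2], [o 2], [u 1]] }
  | C2 => { sign := ![-1, -1, -1], first := ![o 0, o 1, u 0], rest := ![[u 2], [o 2], [u 1]] }
  | C3 => { sign := ![1, 1, -1], first := ![o 0, o 1, u 2], rest := ![[u 1], [o 2], [u 0]]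
            wt := wts (o 1) (o 2) 1 }
  | C4 => { sign := ![1, 1, -1], first := ![o 2, o 0, u 2], rest := ![[u 0], [o 1], [u 1]] }
  | D1 => { sign := ![1, -1, -1], first := ![u 0, u 1, o 0], rest := ![[o 1], [u 2], [o 2]] }
  | D2 => { sign := ![1, 1, 1], first := ![u 0, u 1, o 0], rest := ![[o 2], [u 2], [o 1]] }
  | D3 => { sign := ![1, -1, -1], first := ![u 1, u 2, o 0], rest := ![[o 2], [u 0], [o 1]]
            wt := wts (u 2) (u 0) 1 }
  | D4 => { sign := ![1, -1, -1], first := ![u 2, u 1, o 1], rest := ![[o 0], [u 0], [o 2]] }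

end MPType

namespace VDiagram

/-- The integral MP move of type `m`: the tangle `m.before` is replaced by the tangle `m.after`.
The weights in the two tangles may in addition be changed by arbitrary H-moves at the
crossings of the tangles (`h i` times at crossing `i` before, `h' i` times at crossing `i` after).
In this way one gets all choices of weights for which the rotation numbers of the `2`-cells
agree before and after the move. -/
def MP (m : MPType) (h : Fin 2 → ℤ) (h' : Fin 3 → ℤ) (D D' : VDiagram) : Prop :=
  ∃ (O : Outside) (E E' : VDiagram) (φ : Fin 2 ⊕ O.W ≃ E.V) (φ' : Fin 3 ⊕ O.W ≃ E'.V),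
    IsClosure m.before O E φ ∧ IsClosure m.after O E' φ' ∧
    D = E.gauge (fun v => Sum.elim h (fun _ => 0) (φ.symm v)) ∧
    D' = E'.gauge (fun v => Sum.elim h' (fun _ => 0) (φ'.symm v))

end VDiagram

/-! ### Integral normal o-graphs -/

/-- An integral normal o-graph: a weighted oriented virtual link diagram up to isomorphism and
insertion or removal of virtual crossings. -/
def IntegralOGraph : Type 1 := Quot VDiagram.Equivalent

namespace IntegralOGraph

/-- The integral normal o-graph of a diagram. -/
def mk (D : VDiagram) : IntegralOGraph := Quot.mk _ D

/-- Two integral normal o-graphs are represented by diagrams related by `R`. -/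
def Lift (R : VDiagram → VDiagram → Prop) (Γ Γ' : IntegralOGraph) : Prop :=
  ∃ D D' : VDiagram, mk D = Γ ∧ mk D' = Γ' ∧ R D D'

/-- The weight `x` satisfies `δ x = c_P`, and the polyhedron is standard along its singular set. -/
def IsFramed (Γ : IntegralOGraph) : Prop :=
  ∃ D : VDiagram, mk D = Γ ∧ D.NoFreeCircle ∧ D.Framed

/-- The integral MP move of type `m`. -/
def MPMove (m : MPType) (Γ Γ' : IntegralOGraph) : Prop :=
  ∃ (h : Fin 2 → ℤ) (h' : Fin 3 → ℤ), Lift (VDiagram.MP m h h') Γ Γ'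

/-- The primary integral MP move: the move of type `D2`, in which all crossings are positive, with all
weights in the two tangles equal to zero. -/
def PrimaryMPMove : IntegralOGraph → IntegralOGraph → Prop :=
  Lift (VDiagram.MP MPType.D2 0 0)

/-- The moves to be used: the primary integral MP move, the integral pure sliding moves and the
integral H-move. -/
inductive BasicMove : IntegralOGraph → IntegralOGraph → Prop
  | primary {Γ Γ' : IntegralOGraph} (h : PrimaryMPMove Γ Γ') : BasicMove Γ Γ'
  | slide (t : SlideType) {Γ Γ' : IntegralOGraph} (h : Lift (VDiagram.Slide t) Γ Γ') :
      BasicMove Γ Γ'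
  | hMove {Γ Γ' : IntegralOGraph} (h : Lift VDiagram.HMove Γ Γ') : BasicMove Γ Γ'

/-- A basic move or the inverse of a basic move, between framed integral normal o-graphs. -/
def Step (Γ Γ' : IntegralOGraph) : Prop :=
  Γ.IsFramed ∧ Γ'.IsFramed ∧ (BasicMove Γ Γ' ∨ BasicMove Γ' Γ)

end IntegralOGraph

/-! Every MP move is reduced to an already derived one by a detour. Let a move replace the
two-crossing tangle `T` by `T'`. Sliding two open edges of `T` over each other creates two real
crossings of opposite signs. The new crossing nearer to `T` forms, together with the two crossings
of `T`, the three-crossing side `R'` of another move `R → R'`; the farther one, which is always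
negative, stays outside in an annulus `A`. The annulus is chosen so that filling it with `R` gives
`T'`, up to H-moves. Thus `T → slid T = A ∪ R' → A ∪ R = T'`, and the step in the middle is the
inverse of a known move. This is `Detour.replaceable`. Starting from the primary move D2, the
detours form a tree: D2 gives A1, B3, C3; A1 gives C4; B3 gives C1; C3 gives A2, B4; C4 gives B2,
D1; C1 gives A4, D4; B2 gives D3; D1 gives B1; D4 gives A3; D3 gives C2. The data of a detour are
finite, and their correctness is a computation with Gauss codes that does not see the rest of the
diagram.

Weights. For types I and II the local path between the sliding edges passes exactly one solid dot,
so the formula for the new weights gives zero. Types III and IV create weights; they serve for the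
six cyclic moves and for C2, which comes from the cyclic move D3. The remaining discrepancies are
coboundaries of cochains on the crossings of the tangle, hence products of H-moves.

Framings. All intermediate diagrams must be framed. The rotation number of a cell is a sum over a
cycle of the permutation `succ` of the lines. The lines outside a tangle carry a first return map
which depends on the tangle only through the way lines pass through it and the rotation numbers
collected there. If two tangles agree in these data and the cells wholly inside the second have
rotation number -1, replacement preserves framedness (`Tangle.Similar`, `framed_of_through`). First
return maps also show that framedness is unchanged by inserting a virtual crossing, so that it may
be tested on any representative (`isFramed_mk_iff`).

Sliding moves. Their weights are prescribed by the path which joins the bottoms of the two edges,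
whereas in most detours the edges are close to each other above the new crossings. Since a framed
cell has total rotation number -1, the short path above determines the rotation number of the
unknown path below. Moving weights through the virtual crossings beforehand, and applying H-moves at
the two new crossings afterwards, gives a local form of the move (`Bigon.reach_slid_rotated`). -/

section

open Function Finset

/-! ### Sums over cycles, and their behaviour under first return maps. -/

/-- The sum of `r` over the cycle of `σ` through `x`. -/
noncomputable def cycleSum {X : Type*} (σ : X → X) (r : X → ℤ) (x : X) : ℤ :=
  ∑ i ∈ range (minimalPeriod σ x), r (σ^[i] x)

/-- Here `τ` is the first return map of `σ` to the image of `ι`, and `ρ` collects `r` over one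
excursion. The `σ`-cycle is the concatenation of the excursions of the `τ`-cycle, so the sums agree
once it is known that the cycle does not close up earlier. -/
theorem cycleSum_induced {X Y : Type*} (σ : X → X) (τ : Y → Y) (ι : Y → X) (hι : Injective ι)
    (r : X → ℤ) (ρ : Y → ℤ)
    (H : ∀ y, ∃ n, 0 < n ∧ σ^[n] (ι y) = ι (τ y) ∧
      (∀ i, 0 < i → i < n → σ^[i] (ι y) ∉ Set.range ι) ∧
      ∑ i ∈ range n, r (σ^[i] (ι y)) = ρ y)
    (y : Y) (hy : y ∈ periodicPts τ) : cycleSum σ r (ι y) = cycleSum τ ρ y := by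
  choose n hn0 hn hnr hs using H
  -- `S k` is the time of the `k`-th return.
  let S : ℕ → ℕ := fun k => ∑ i ∈ range k, n (τ^[i] y)
  have hS1 : ∀ k, S (k + 1) = n (τ^[k] y) + S k := fun k => by
    simp only [S, sum_range_succ]; ring
  have hσ : ∀ k, σ^[S k] (ι y) = ι (τ^[k] y) := by
    intro k
    induction k with
    | zero => simp [S]
    | succ k ih => rw [hS1, iterate_add_apply, ih, hn, iterate_succ_apply']
  have hsum : ∀ k, ∑ i ∈ range (S k), r (σ^[i] (ι y)) = ∑ i ∈ range k, ρ (τ^[i] y) := by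
    intro k
    induction k with
    | zero => simp [S]
    | succ k ih =>
      rw [hS1, add_comm, sum_range_add, ih, sum_range_succ, ← hs]
      congr 1
      refine sum_congr rfl fun i _ => ?_
      rw [add_comm, iterate_add_apply, hσ]
  have hmono : ∀ m k, m < S k → ∃ j < k, S j ≤ m ∧ m < S (j + 1) := by
    intro m k
    induction k with
    | zero => simp [S]
    | succ k ih =>
      intro h
      by_cases hm : m < S k
      · obtain ⟨j, hj, h1⟩ := ih hm
        exact ⟨j, by omega, h1⟩
      · exact ⟨k, by omega, by omega, h⟩
  have hp : 0 < minimalPeriod τ y := minimalPeriod_pos_of_mem_periodicPts hy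
  have hper : minimalPeriod σ (ι y) = S (minimalPeriod τ y) := by
    have hpos : 0 < S (minimalPeriod τ y) := by
      obtain ⟨k, hk⟩ : ∃ k, minimalPeriod τ y = k + 1 := ⟨_, (Nat.succ_pred_eq_of_pos hp).symm⟩
      rw [hk, hS1]
      have := hn0 (τ^[k] y)
      omega
    have hle : minimalPeriod σ (ι y) ≤ S (minimalPeriod τ y) := by
      refine IsPeriodicPt.minimalPeriod_le hpos ?_
      rw [IsPeriodicPt, IsFixedPt, hσ, iterate_minimalPeriod]
    refine le_antisymm hle (not_lt.mp fun hlt => ?_)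
    have hm0 : 0 < minimalPeriod σ (ι y) := by
      refine minimalPeriod_pos_of_mem_periodicPts ⟨_, hpos, ?_⟩
      rw [IsPeriodicPt, IsFixedPt, hσ, iterate_minimalPeriod]
    -- A premature return to `ι y` falls into some excursion `j`, at offset `d`. Offset zero
    -- contradicts the minimality of the period of `τ`; a positive offset would be a visit to the
    -- image of `ι` inside an excursion.
    obtain ⟨j, hj, h1, h2⟩ := hmono _ _ hlt
    have hret : σ^[minimalPeriod σ (ι y)] (ι y) = ι y := iterate_minimalPeriod
    obtain ⟨d, hd⟩ := Nat.exists_eq_add_of_le' h1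
    rw [hd, iterate_add_apply, hσ] at hret
    rcases Nat.eq_zero_or_pos d with h0 | h0
    · subst h0
      have h3 : τ^[j] y = y := hι hret
      have hj0 : 0 < j := by
        rcases Nat.eq_zero_or_pos j with h | h
        · subst h; simp [S] at hd; omega
        · exact h
      exact absurd (IsPeriodicPt.minimalPeriod_le hj0 h3) (by omega)
    · exact hnr _ d h0 (by have := hS1 j; omega) ⟨y, hret.symm⟩
  rw [cycleSum, cycleSum, hper, hsum]

theorem cycleSum_add_coboundary {X : Type*} (σ : X → X) (r f : X → ℤ) (x : X) :
    cycleSum σ (fun x => r x + (f (σ x) - f x)) x = cycleSum σ r x := by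
  have h := sum_range_sub (fun i => f (σ^[i] x)) (minimalPeriod σ x)
  simp only [iterate_minimalPeriod, iterate_zero, id_eq, sub_self, iterate_succ_apply'] at h
  rw [cycleSum, sum_add_distrib, h, add_zero, cycleSum]

theorem cycleSum_apply {X : Type*} (σ : X → X) (r : X → ℤ) {x : X} (hx : x ∈ periodicPts σ) :
    cycleSum σ r (σ x) = cycleSum σ r x := by
  have h := sum_range_succ' (fun i => r (σ^[i] x)) (minimalPeriod σ x)
  rw [sum_range_succ, iterate_minimalPeriod] at h
  rw [cycleSum, cycleSum, minimalPeriod_apply hx]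
  simp only [iterate_zero, id_eq, iterate_succ_apply] at h
  linarith

theorem cycleSum_iterate {X : Type*} (σ : X → X) (r : X → ℤ) (hσ : ∀ x, x ∈ periodicPts σ) (x : X)
    (n : ℕ) : cycleSum σ r (σ^[n] x) = cycleSum σ r x := by
  induction n with
  | zero => rfl
  | succ n ih => rw [iterate_succ_apply', cycleSum_apply _ _ (hσ _), ih]

theorem cycleSum_congr {X : Type*} {σ : X → X} {r r' : X → ℤ} (h : ∀ x, r x = r' x) (x : X) :
    cycleSum σ r x = cycleSum σ r' x := by rw [funext h]

theorem cycleSum_semiconj {X Y : Type*} {σ : X → X} {τ : Y → Y} {ι : Y → X} (hι : Injective ι)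
    (h : ∀ y, σ (ι y) = ι (τ y)) (hτ : ∀ y, y ∈ periodicPts τ) (r : X → ℤ) (y : Y) :
    cycleSum σ r (ι y) = cycleSum τ (r ∘ ι) y := by
  refine cycleSum_induced σ τ ι hι r _ (fun y => ⟨1, one_pos, h y, ?_, by simp⟩) y (hτ y)
  intro i h1 h2
  omega

/-- The orbit of `x` meets the set of points with `r ≠ 0` if and only if the sum of a
nonnegative `r` over the cycle does not vanish. -/
theorem cycleSum_ne_zero_iff {X : Type*} {σ : X → X} {r : X → ℤ} (hr : ∀ x, 0 ≤ r x) {x : X}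
    (hx : x ∈ periodicPts σ) : cycleSum σ r x ≠ 0 ↔ ∃ n, r (σ^[n] x) ≠ 0 := by
  rw [cycleSum, Ne, sum_eq_zero_iff_of_nonneg fun i _ => hr _]
  push Not
  constructor
  · rintro ⟨i, -, h⟩
    exact ⟨i, h⟩
  · rintro ⟨n, h⟩
    refine ⟨n % minimalPeriod σ x, ?_, by rwa [iterate_mod_minimalPeriod_eq]⟩
    simpa using Nat.mod_lt _ (minimalPeriod_pos_of_mem_periodicPts hx)

/-- If two points return to the same place after `n ≤ n'` steps, cancelling `n` steps leaves a visit
to the image of `ι` at time `n' - n` of the longer excursion, which forces `n = n'`. -/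
theorem injective_of_induced {X Y : Type*} {σ : X → X} (hσ : Injective σ) {τ : Y → Y} {ι : Y → X}
    (hι : Injective ι)
    (H : ∀ y, ∃ n, 0 < n ∧ σ^[n] (ι y) = ι (τ y) ∧
      ∀ i, 0 < i → i < n → σ^[i] (ι y) ∉ Set.range ι) : Injective τ := by
  have main : ∀ y y' n n', σ^[n] (ι y) = ι (τ y) → σ^[n'] (ι y') = ι (τ y') → 0 < n →
      (∀ i, 0 < i → i < n' → σ^[i] (ι y') ∉ Set.range ι) → n ≤ n' → τ y = τ y' → y = y' := by
    intro y y' n n' h1 h2 h0 h3 hle e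
    obtain ⟨d, rfl⟩ := Nat.exists_eq_add_of_le hle
    rw [← e, ← h1, iterate_add_apply] at h2
    have h4 := hσ.iterate n h2
    rcases Nat.eq_zero_or_pos d with rfl | hd
    · exact (hι h4).symm
    · exact absurd ⟨y, h4.symm⟩ (h3 d hd (by omega))
  intro y y' e
  obtain ⟨n, h0, h1, h2⟩ := H y
  obtain ⟨n', h0', h1', h2'⟩ := H y'
  rcases le_total n n' with h | h
  · exact main y y' n n' h1 h1' h0 h2' h e
  · exact (main y' y n' n h1' h1 h0' h2 h e.symm).symm

namespace VDiagram

/-! ### Framedness as a condition on integral cycle sums. -/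

/-- Twice the contribution to the rotation number of a corner between lines `l` and `l'`. -/
def turn2 (l l' : Fin 3) : ℤ := if (l = 2 ↔ l' = 2) then 0 else -1

/-- Twice the contribution of a line and of the corner at its end to the rotation number. -/
def rot2 (D : VDiagram) (g : D.Germ) : ℤ := 2 * D.along g + turn2 g.2 (D.succ g).2

theorem turn_eq (D : VDiagram) (g : D.Germ) : D.turn g = (turn2 g.2 (D.succ g).2 : ℚ) / 2 := by
  unfold turn turn2 Dot
  split_ifs <;> simp_all

theorem along_add_turn (D : VDiagram) (g : D.Germ) :
    (D.along g : ℚ) + D.turn g = (D.rot2 g : ℚ) / 2 := by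
  rw [turn_eq, rot2]; push_cast; ring

/-- Twice the rotation number is `2 δx` minus the number of dots, which clears the halves; the value
`-2` is twice the required `-1`. -/
theorem framed_iff (D : VDiagram) : D.Framed ↔ ∀ g, cycleSum D.succ D.rot2 g = -2 := by
  refine forall_congr' fun g => ?_
  have h : cycleSum D.succ D.rot2 g = 2 * D.coboundary g - D.dots g := by
    rw [cycleSum, coboundary, dots, card_filter]
    push_cast
    rw [mul_sum, ← sum_sub_distrib]
    refine sum_congr rfl fun i _ => ?_
    unfold rot2 turn2 Dot
    split_ifs <;> simp_all; ring
  rw [h, euler]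
  constructor
  · intro h1
    have h2 : (2 * D.coboundary g - D.dots g : ℚ) = -2 := by rw [h1]; ring
    exact_mod_cast h2
  · intro h1
    have h2 : (2 * D.coboundary g - D.dots g : ℚ) = -2 := by exact_mod_cast h1
    linarith

theorem corner_injective (ε : SignType) :
    Injective fun x : Bool × Fin 3 => corner ε x.1 x.2 := by
  cases ε <;> decide

/-- The incoming or outgoing end at which the line `g` arrives, with its line. -/
def arrival (D : VDiagram) (g : D.Germ) : D.Germ := (if g.2 = 2 then g.1 else D.next g.1, g.2)

/-- The line with which one leaves a crossing after arriving there. -/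
def depart (D : VDiagram) (a : D.Germ) : D.Germ :=
  let c := corner (D.kind a.1.1) a.1.2 a.2
  (if c.2 = 2 then D.next.symm (a.1.1, c.1) else (a.1.1, c.1), c.2)

theorem succ_eq (D : VDiagram) (g : D.Germ) : D.succ g = D.depart (D.arrival g) := rfl

theorem arrival_injective (D : VDiagram) : Injective D.arrival := by
  rintro ⟨s, l⟩ ⟨s', l'⟩ h
  simp only [arrival, Prod.mk.injEq] at h
  obtain ⟨h1, rfl⟩ := h
  split_ifs at h1 <;> simp_all

/-- The outgoing line number decides whether `next.symm` was applied; undoing it recovers the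
crossing, and the corner rule at a fixed crossing is injective. Together with finiteness this makes
every line periodic under `succ`, so the cells are genuine cycles. -/
theorem depart_injective (D : VDiagram) : Injective D.depart := by
  rintro ⟨⟨v, b⟩, l⟩ ⟨⟨v', b'⟩, l'⟩ h
  simp only [depart, Prod.mk.injEq] at h
  obtain ⟨h1, h2⟩ := h
  rw [← h2] at h1
  have h3 : (v, (corner (D.kind v) b l).1) = (v', (corner (D.kind v') b' l').1) := by
    split_ifs at h1
    · exact D.next.symm.injective h1
    · exact h1
  obtain ⟨rfl, h4⟩ := Prod.mk.inj h3
  have := corner_injective (D.kind v) (a₁ := (b, l)) (a₂ := (b', l')) (Prod.ext h4 h2)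
  simp_all

theorem succ_injective (D : VDiagram) : Injective D.succ :=
  D.depart_injective.comp D.arrival_injective

theorem mem_periodicPts_succ (D : VDiagram) (g : D.Germ) : g ∈ periodicPts D.succ :=
  haveI := D.fin
  D.succ_injective.mem_periodicPts g

theorem mem_periodicPts_next (D : VDiagram) (s : D.V × Bool) : s ∈ periodicPts D.next :=
  haveI := D.fin
  D.next.injective.mem_periodicPts s

/-- The indicator function of the real crossings. -/
noncomputable def isReal (D : VDiagram) (s : D.V × Bool) : ℤ := if D.kind s.1 = 0 then 0 else 1

theorem noFreeCircle_iff (D : VDiagram) :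
    D.NoFreeCircle ↔ ∀ s, cycleSum D.next D.isReal s ≠ 0 := by
  refine forall_congr' fun s => ?_
  rw [cycleSum_ne_zero_iff _ (D.mem_periodicPts_next s)]
  · simp [isReal]
  · intro x; unfold isReal; split_ifs <;> simp

/-- The diagram is framed and has no circle without real crossings. -/
def FN (D : VDiagram) : Prop := D.NoFreeCircle ∧ D.Framed

/-! ### Invariance under embeddings of diagrams -/

/-- `f` identifies `D` with a union of components of `D'`. -/
structure Emb (D D' : VDiagram) (f : D.V → D'.V) : Prop where
  inj : Injective f
  kind : ∀ v, D'.kind (f v) = D.kind v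
  next : ∀ s, D'.next (f s.1, s.2) = (f (D.next s).1, (D.next s).2)
  weight : ∀ s, D'.weight (f s.1, s.2) = D.weight s

theorem Emb.symm {D D' : VDiagram} {f : D.V → D'.V} (h : Emb D D' f) (s : D.V × Bool) :
    D'.next.symm (f s.1, s.2) = (f (D.next.symm s).1, (D.next.symm s).2) := by
  rw [Equiv.symm_apply_eq, h.next, Equiv.apply_symm_apply]

theorem Emb.succ {D D' : VDiagram} {f : D.V → D'.V} (h : Emb D D' f) (g : D.Germ) :
    D'.succ ((f g.1.1, g.1.2), g.2) = ((f (D.succ g).1.1, (D.succ g).1.2), (D.succ g).2) := by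
  have h1 : D'.arrival ((f g.1.1, g.1.2), g.2) =
      ((f (D.arrival g).1.1, (D.arrival g).1.2), (D.arrival g).2) := by
    unfold arrival
    by_cases hl : g.2 = 2
    · simp [hl]
    · simp [hl, h.next]
  rw [succ_eq, succ_eq, h1]
  generalize D.arrival g = a
  unfold depart
  simp only [h.kind]
  split_ifs with hl
  · exact Prod.ext (h.symm (a.1.1, (corner (D.kind a.1.1) a.1.2 a.2).1)) rfl
  · rfl

theorem Emb.cycleSum_rot2 {D D' : VDiagram} {f : D.V → D'.V} (h : Emb D D' f) (g : D.Germ) :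
    cycleSum D'.succ D'.rot2 ((f g.1.1, g.1.2), g.2) = cycleSum D.succ D.rot2 g := by
  have hι : Injective fun g : D.Germ => (((f g.1.1, g.1.2), g.2) : D'.Germ) := by
    rintro ⟨⟨v, b⟩, l⟩ ⟨⟨v', b'⟩, l'⟩ e
    simp only [Prod.mk.injEq] at e
    obtain ⟨⟨e1, e2⟩, e3⟩ := e
    simp [h.inj e1, e2, e3]
  rw [cycleSum_semiconj hι h.succ D.mem_periodicPts_succ]
  refine cycleSum_congr (fun g => ?_) g
  simp only [Function.comp, rot2, along, h.succ, h.weight]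

theorem Emb.cycleSum_isReal {D D' : VDiagram} {f : D.V → D'.V} (h : Emb D D' f) (s : D.V × Bool) :
    cycleSum D'.next D'.isReal (f s.1, s.2) = cycleSum D.next D.isReal s := by
  have hι : Injective fun s : D.V × Bool => ((f s.1, s.2) : D'.V × Bool) := by
    rintro ⟨v, b⟩ ⟨v', b'⟩ e
    simp only [Prod.mk.injEq] at e
    simp [h.inj e.1, e.2]
  rw [cycleSum_semiconj hι h.next D.mem_periodicPts_next]
  refine cycleSum_congr (fun s => ?_) s
  simp only [Function.comp, isReal, h.kind]

theorem Iso.emb {D D' : VDiagram} (h : Iso D D') : ∃ φ : D.V ≃ D'.V, Emb D D' φ := by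
  obtain ⟨φ, h1, h2, h3⟩ := h
  exact ⟨φ, φ.injective, h1, fun s => h2 s.1 s.2, fun s => h3 s.1 s.2⟩

theorem Iso.fn_iff {D D' : VDiagram} (h : Iso D D') : FN D ↔ FN D' := by
  obtain ⟨φ, h⟩ := h.emb
  simp only [FN, framed_iff, noFreeCircle_iff, ← h.cycleSum_rot2, ← h.cycleSum_isReal]
  constructor
  · rintro ⟨h1, h2⟩
    constructor
    · intro s; simpa using h1 (φ.symm s.1, s.2)
    · intro g; simpa using h2 ((φ.symm g.1.1, g.1.2), g.2)
  · rintro ⟨h1, h2⟩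
    exact ⟨fun s => h1 _, fun g => h2 _⟩

/-! ### Invariance under insertion of virtual crossings -/

/-- Disjoint union with a virtual crossing whose strands are closed up to loops. -/
noncomputable abbrev loops (D : VDiagram) : VDiagram :=
  haveI := D.fin
  { V := D.V ⊕ Unit
    kind := Sum.elim D.kind (fun _ => 0)
    next := D.addLoops
    weight := fun s => Sum.elim (fun v => D.weight (v, s.2)) (fun _ => 0) s.1 }

open Classical in
/-- Insert the strand `q` after the outgoing end `t`. -/
noncomputable abbrev splice (E : VDiagram) (t q : E.V × Bool) (u : ℤ) : VDiagram :=
  haveI := E.fin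
  { V := E.V
    kind := E.kind
    next := (Equiv.swap t q).trans E.next
    weight := Function.update (Function.update E.weight t (E.weight t - u)) q u }

/-- An insertion splits into elementary operations: add an isolated virtual crossing with two loops,
then splice one loop after the other into an edge. Invariance has to be checked only for splicing a
single loop. -/
theorem insertVirtual_eq (D : VDiagram) (s₁ : D.V × Bool) (s₂ : (D.V ⊕ Unit) × Bool) (u₁ u₂ : ℤ) :
    D.insertVirtual s₁ s₂ u₁ u₂ =
      (D.loops.splice (Sum.inl s₁.1, s₁.2) (Sum.inr (), true) u₁).splice s₂ (Sum.inr (), false) u₂ := by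
  unfold insertVirtual splice loops
  congr!

theorem loops_emb (D : VDiagram) : Emb D D.loops Sum.inl where
  inj := Sum.inl_injective
  kind _ := rfl
  next _ := rfl
  weight _ := rfl

section Splice

variable {E : VDiagram} {t q : E.V × Bool} (u : ℤ)

theorem splice_next_t : (E.splice t q u).next t = E.next q := by
  simp [splice]

theorem splice_next_q : (E.splice t q u).next q = E.next t := by
  simp [splice]

theorem splice_next_of_ne {s : E.V × Bool} (h1 : s ≠ t) (h2 : s ≠ q) :
    (E.splice t q u).next s = E.next s := by
  simp [splice, Equiv.swap_apply_of_ne_of_ne, h1, h2]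

/-- Off the loop `q`, the old connections are the first return map of the new ones, and the detour
through `q` contributes zero because its crossing is virtual. -/
theorem splice_cycleSum_isReal (hq : E.next q = q) (hk : E.kind q.1 = 0) (htq : t ≠ q)
    {s : E.V × Bool} (hs : s ≠ q) :
    cycleSum (E.splice t q u).next (E.splice t q u).isReal s = cycleSum E.next E.isReal s := by
  have hne : ∀ s, s ≠ q → E.next s ≠ q := fun s hs h => hs (E.next.injective (h.trans hq.symm))
  let τ : {s : E.V × Bool // s ≠ q} → {s : E.V × Bool // s ≠ q} := fun s => ⟨E.next s, hne s s.2⟩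
  have hτ : Injective τ := fun a b h =>
    Subtype.ext (E.next.injective (congrArg Subtype.val h))
  have hper : ∀ y, y ∈ periodicPts τ := fun y =>
    haveI := E.fin
    hτ.mem_periodicPts y
  have h2 : cycleSum E.next E.isReal s = cycleSum τ (E.isReal ∘ Subtype.val) ⟨s, hs⟩ :=
    cycleSum_semiconj (ι := Subtype.val) Subtype.val_injective (fun _ => rfl) hper _ ⟨s, hs⟩
  rw [h2]
  refine cycleSum_induced (E.splice t q u).next τ Subtype.val Subtype.val_injective _ _ ?_ ⟨s, hs⟩
    (hper _)
  rintro ⟨y, hy⟩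
  by_cases hyt : y = t
  · subst hyt
    have h3 : (E.splice y q u).next y = q := by rw [splice_next_t, hq]
    refine ⟨2, two_pos, ?_, ?_, ?_⟩
    · rw [iterate_succ_apply, iterate_one, h3, splice_next_q]
    · intro i h1 h2
      obtain rfl : i = 1 := by omega
      rw [iterate_one, h3]
      rintro ⟨z, hz⟩
      exact z.2 hz
    · rw [sum_range_succ, sum_range_one]
      have h4 : (E.splice y q u).isReal q = 0 := if_pos hk
      rw [iterate_one, h3, h4, add_zero]
      rfl
  · refine ⟨1, one_pos, ?_, fun i _ _ => by omega, ?_⟩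
    · rw [iterate_one, splice_next_of_ne u hyt hy]
    · rw [sum_range_one]
      rfl

theorem splice_cycleSum_isReal_self (hq : E.next q = q) :
    cycleSum (E.splice t q u).next (E.splice t q u).isReal q =
      cycleSum (E.splice t q u).next (E.splice t q u).isReal t := by
  have h : (E.splice t q u).next t = q := by rw [splice_next_t, hq]
  have h2 := cycleSum_apply (E.splice t q u).next (E.splice t q u).isReal (mem_periodicPts_next (E.splice t q u) t)
  rwa [h] at h2

theorem splice_symm_q (hq : E.next q = q) : (E.splice t q u).next.symm q = t := by
  rw [Equiv.symm_apply_eq, splice_next_t, hq]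

theorem splice_symm_next_t : (E.splice t q u).next.symm (E.next t) = q := by
  rw [Equiv.symm_apply_eq, splice_next_q]

theorem splice_symm_of_ne (hq : E.next q = q) {s : E.V × Bool} (h1 : s ≠ E.next t) (h2 : s ≠ q) :
    (E.splice t q u).next.symm s = E.next.symm s := by
  rw [Equiv.symm_apply_eq, splice_next_of_ne, Equiv.apply_symm_apply]
  · rintro h; exact h1 (by rw [← h, Equiv.apply_symm_apply])
  · rintro h; exact h2 (by rw [← hq, ← h, Equiv.apply_symm_apply])

theorem depart_of_virtual (D : VDiagram) {a : D.Germ} (h : D.kind a.1.1 = 0) :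
    D.depart a = (if a.2 = 2 then D.next.symm a.1 else a.1, a.2) := by
  have : corner (D.kind a.1.1) a.1.2 a.2 = (a.1.2, a.2) := by rw [h]; rfl
  simp only [depart, this]

theorem splice_succ_t (hq : E.next q = q) (hk : E.kind q.1 = 0) {l : Fin 3} (hl : l ≠ 2) :
    (E.splice t q u).succ (t, l) = (q, l) := by
  have h : (E.splice t q u).arrival (t, l) = (q, l) := by
    simp [arrival, hl, hq]
  rw [succ_eq, h, depart_of_virtual _ (by exact hk)]
  simp [hl]

theorem splice_succ_q (hq : E.next q = q) (hk : E.kind q.1 = 0) :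
    (E.splice t q u).succ (q, 2) = (t, 2) := by
  have h : (E.splice t q u).arrival (q, 2) = (q, 2) := by simp [arrival]
  rw [succ_eq, h, depart_of_virtual _ (by exact hk)]
  exact Prod.ext (splice_symm_q u hq) rfl

/-- At a virtual crossing the lines stay on their strand, so the lines along a loop through it are
closed up among themselves. -/
theorem succ_ne (hq : E.next q = q) (hk : E.kind q.1 = 0) {g : E.Germ} (hg : g.1 ≠ q) :
    (E.succ g).1 ≠ q := by
  have hne : ∀ s, E.next s = q → s = q := fun s h => E.next.injective (h.trans hq.symm)
  have hne' : ∀ s, E.next.symm s = q → s = q := fun s h => by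
    rw [Equiv.symm_apply_eq] at h; rw [h, hq]
  have ha : (E.arrival g).1 ≠ q := by
    unfold arrival
    split_ifs
    · exact hg
    · exact fun h => hg (hne _ h)
  rw [succ_eq]
  generalize E.arrival g = a at ha
  by_cases hv : a.1.1 = q.1
  · rw [depart_of_virtual _ (by rw [hv]; exact hk)]
    dsimp only
    split_ifs
    · exact fun h => ha (hne' _ h)
    · exact ha
  · unfold depart
    dsimp only
    split_ifs
    · intro h
      have h' := congrArg Prod.fst (hne' (a.1.1, _) h)
      exact hv h'
    · intro h
      have h' := congrArg Prod.fst h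
      exact hv h'

-- The old successor map is the first return map of the new one, with the divided edge `t` followed
-- by `q` traversed in two steps and the weight parts adding up. On the third line the edge is
-- traversed backwards and is entered at `q`, not at `t`; this is why the germ `(t, 2)` has to be
-- represented by `(q, 2)`.
open Classical in
theorem splice_cycleSum_rot2_aux (hq : E.next q = q) (hk : E.kind q.1 = 0) (htq : t ≠ q)
    {g : E.Germ} (hg : g.1 ≠ q) :
    cycleSum (E.splice t q u).succ (E.splice t q u).rot2 (if g = (t, 2) then (q, 2) else g) =
      cycleSum E.succ E.rot2 g := by
  let τ : {g : E.Germ // g.1 ≠ q} → {g : E.Germ // g.1 ≠ q} :=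
    fun g => ⟨E.succ g, succ_ne hq hk g.2⟩
  have hτ : Injective τ := fun a b h =>
    Subtype.ext (E.succ_injective (congrArg Subtype.val h))
  have hper : ∀ y, y ∈ periodicPts τ := fun y =>
    haveI := E.fin
    hτ.mem_periodicPts y
  have h2 : cycleSum E.succ E.rot2 g = cycleSum τ (E.rot2 ∘ Subtype.val) ⟨g, hg⟩ :=
    cycleSum_semiconj (ι := Subtype.val) Subtype.val_injective (fun _ => rfl) hper _ ⟨g, hg⟩
  let ι : {g : E.Germ // g.1 ≠ q} → (E.splice t q u).Germ :=
    fun g => if g.1 = (t, 2) then (q, 2) else g.1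
  have hι : Injective ι := by
    rintro ⟨a, ha⟩ ⟨b, hb⟩ h
    simp only [ι] at h
    apply Subtype.ext
    dsimp only
    split_ifs at h with h1 h2 h2
    · rw [h1, h2]
    · rw [← h] at hb; exact absurd rfl hb
    · rw [h] at ha; exact absurd rfl ha
    · exact h
  have hdep : ∀ a : E.Germ, a.1 ≠ q → (E.depart a).1 ≠ q → (E.splice t q u).depart a =
      if E.depart a = (t, 2) then (q, 2) else E.depart a := by
    intro a ha hda
    unfold depart at hda ⊢
    simp only at hda ⊢
    set c := corner (E.kind a.1.1) a.1.2 a.2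
    by_cases hc : c.2 = 2
    · simp only [hc, if_true, Prod.mk.injEq, and_true] at hda ⊢
      by_cases hx : (a.1.1, c.1) = E.next t
      · rw [hx]
        rw [Equiv.symm_apply_apply, if_pos rfl]
        exact Prod.ext (splice_symm_next_t u) rfl
      · have h3 : E.next.symm (a.1.1, c.1) ≠ t := by
          intro h; exact hx (by rw [← h, Equiv.apply_symm_apply])
        rw [if_neg h3]
        refine Prod.ext (splice_symm_of_ne u hq hx ?_) rfl
        intro h
        rw [h] at hda
        exact hda ((Equiv.symm_apply_eq _).2 hq.symm)
    · simp only [hc, if_false, Prod.mk.injEq, and_false]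
  have hw : ∀ s, s ≠ t → s ≠ q → (E.splice t q u).weight s = E.weight s := by
    intro s h1 h2
    simp [h1, h2]
  have hwt : (E.splice t q u).weight t = E.weight t - u := by
    simp [htq]
  have hwq : (E.splice t q u).weight q = u := by
    simp
  dsimp only [splice] at hw hwt hwq
  have hιl : ∀ y, (ι y).2 = y.1.2 := by
    intro y
    simp only [ι]
    split_ifs with h
    · rw [h]
    · rfl
  have harr : ∀ y : E.Germ, y.1 ≠ q → (E.arrival y).1 ≠ q := by
    intro y hy
    unfold arrival
    split_ifs
    · exact hy
    · exact fun h => hy (E.next.injective (h.trans hq.symm))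
  -- The successor depends only on the end of arrival, so it is enough to compare arrivals before
  -- and after splicing.
  have hstep : ∀ (z : (E.splice t q u).Germ) (y : {g : E.Germ // g.1 ≠ q}),
      (E.splice t q u).arrival z = E.arrival y.1 → (E.splice t q u).succ z = ι (τ y) := by
    intro z y h
    rw [succ_eq, h, hdep _ (harr _ y.2)]
    · simp only [ι, τ, succ_eq]
    · rw [← succ_eq]; exact succ_ne hq hk y.2
  rw [h2]
  refine cycleSum_induced _ _ ι hι _ _ ?_ ⟨g, hg⟩ (hper _)
  intro y
  by_cases hl : y.1.2 = 2
  · by_cases hyt : y.1.1 = t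
    · have hy : y.1 = (t, 2) := Prod.ext hyt hl
      have hιy : ι y = (q, 2) := by simp only [ι, hy, if_true]
      have h3 : (E.splice t q u).succ (t, 2) = ι (τ y) := by
        apply hstep; rw [hy]; simp [arrival]
      have h4 := splice_succ_q (t := t) u hq hk
      refine ⟨2, two_pos, ?_, ?_, ?_⟩
      · rw [iterate_succ_apply, iterate_one, hιy, h4, h3]
      · intro i i1 i2
        obtain rfl : i = 1 := by omega
        rw [iterate_one, hιy, h4]
        rintro ⟨z, hz⟩
        simp only [ι] at hz
        split_ifs at hz with hz2
        · exact htq (congrArg Prod.fst hz).symm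
        · exact hz2 hz
      · rw [sum_range_succ, sum_range_one, iterate_one, iterate_zero, id_eq, hιy, h4]
        unfold rot2
        rw [h4, h3, hιl]
        simp only [along, if_true, hwq, hwt, Function.comp, hy]
        rw [show τ y = ⟨E.succ (t, 2), hy ▸ (τ y).2⟩ from Subtype.ext (by simp only [τ, hy])]
        simp only [turn2, iff_self, if_true]
        ring
    · have hιy : ι y = y.1 := by
        simp only [ι]; rw [if_neg]; intro h; exact hyt (congrArg Prod.fst h)
      have h3 : (E.splice t q u).succ y.1 = ι (τ y) := by
        apply hstep; simp [arrival, hl]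
      refine ⟨1, one_pos, ?_, fun i _ _ => by omega, ?_⟩
      · rw [iterate_one, hιy, h3]
      · rw [sum_range_one, iterate_zero, id_eq, hιy]
        unfold rot2
        rw [h3, hιl]
        simp only [along, Function.comp, τ, hw _ hyt y.2]
  · have hιy : ι y = y.1 := by
      simp only [ι]; rw [if_neg]; intro h; exact hl (congrArg Prod.snd h)
    by_cases hyt : y.1.1 = t
    · have hy : y.1 = (t, y.1.2) := Prod.ext hyt rfl
      have h4 : (E.splice t q u).succ y.1 = (q, y.1.2) := by
        conv_lhs => rw [hy]
        exact splice_succ_t u hq hk hl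
      have h3 : (E.splice t q u).succ (q, y.1.2) = ι (τ y) := by
        apply hstep
        simp [arrival, hl, hyt]
      refine ⟨2, two_pos, ?_, ?_, ?_⟩
      · rw [iterate_succ_apply, iterate_one, hιy, h4, h3]
      · intro i i1 i2
        obtain rfl : i = 1 := by omega
        rw [iterate_one, hιy, h4]
        rintro ⟨z, hz⟩
        simp only [ι] at hz
        split_ifs at hz with hz2
        · exact hl (congrArg Prod.snd hz).symm
        · exact z.2 (congrArg Prod.fst hz)
      · rw [sum_range_succ, sum_range_one, iterate_one, iterate_zero, id_eq, hιy]
        rw [h4]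
        unfold rot2
        rw [h4, h3, hιl]
        simp only [along, hl, if_false, hwq, Function.comp, hyt, hwt, τ]
        simp only [turn2, iff_self, if_true]
        ring
    · have h3 : (E.splice t q u).succ y.1 = ι (τ y) := by
        apply hstep; simp [arrival, hl, splice_next_of_ne u hyt y.2]
      refine ⟨1, one_pos, ?_, fun i _ _ => by omega, ?_⟩
      · rw [iterate_one, hιy, h3]
      · rw [sum_range_one, iterate_zero, id_eq, hιy]
        unfold rot2
        rw [h3, hιl]
        simp only [along, Function.comp, τ, hw _ hyt y.2]

theorem splice_cycleSum_rot2 (hq : E.next q = q) (hk : E.kind q.1 = 0) (htq : t ≠ q)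
    {g : E.Germ} (hg : g.1 ≠ q) :
    cycleSum (E.splice t q u).succ (E.splice t q u).rot2 g = cycleSum E.succ E.rot2 g := by
  rw [← splice_cycleSum_rot2_aux u hq hk htq hg]
  split_ifs with h
  · rw [h, ← splice_succ_q (t := t) u hq hk, cycleSum_apply _ _ (mem_periodicPts_succ _ _)]
  · rfl

theorem splice_cycleSum_rot2_self (hq : E.next q = q) (hk : E.kind q.1 = 0) (l : Fin 3) :
    cycleSum (E.splice t q u).succ (E.splice t q u).rot2 (q, l) =
      cycleSum (E.splice t q u).succ (E.splice t q u).rot2 (t, l) := by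
  by_cases hl : l = 2
  · subst hl
    rw [← splice_succ_q (t := t) u hq hk, cycleSum_apply _ _ (mem_periodicPts_succ _ _)]
  · rw [← splice_succ_t (t := t) u hq hk hl, cycleSum_apply _ _ (mem_periodicPts_succ _ _)]

end Splice

section Splice

variable {E : VDiagram} {t₁ q₁ t₂ q₂ : E.V × Bool} (u₁ u₂ : ℤ)

theorem splice_next_loop (h₂ : E.next q₂ = q₂) (h₁₂ : q₁ ≠ q₂) (ht : t₁ ≠ q₂) :
    (E.splice t₁ q₁ u₁).next q₂ = q₂ := by
  rw [splice_next_of_ne u₁ ht.symm h₁₂.symm, h₂]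

/-- The edge `s'` is the edge of the original diagram of which `s` has become a part. Since `t₂` may
be `q₁`, an edge starting at `q₂` may have to be traced back twice. -/
theorem splice_splice_cycleSum_rot2 (h₁ : E.next q₁ = q₁) (h₂ : E.next q₂ = q₂) (h₁₂ : q₁ ≠ q₂)
    (k₁ : E.kind q₁.1 = 0) (k₂ : E.kind q₂.1 = 0) (ht₁ : t₁ ≠ q₁) (ht₁' : t₁ ≠ q₂) (ht₂ : t₂ ≠ q₂)
    (s : E.V × Bool) : ∃ s', s' ≠ q₁ ∧ s' ≠ q₂ ∧ (s ≠ q₁ → s ≠ q₂ → s' = s) ∧ ∀ l,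
      cycleSum ((E.splice t₁ q₁ u₁).splice t₂ q₂ u₂).succ
        ((E.splice t₁ q₁ u₁).splice t₂ q₂ u₂).rot2 (s, l) = cycleSum E.succ E.rot2 (s', l) := by
  have h₃ := splice_next_loop u₁ h₂ h₁₂ ht₁'
  have main : ∀ s : E.V × Bool, s ≠ q₂ → ∃ s', s' ≠ q₁ ∧ s' ≠ q₂ ∧ (s ≠ q₁ → s ≠ q₂ → s' = s) ∧
      ∀ l, cycleSum ((E.splice t₁ q₁ u₁).splice t₂ q₂ u₂).succ
        ((E.splice t₁ q₁ u₁).splice t₂ q₂ u₂).rot2 (s, l) = cycleSum E.succ E.rot2 (s', l) := by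
    intro s hs
    by_cases hs₁ : s = q₁
    · refine ⟨t₁, ht₁, ht₁', fun h => absurd hs₁ h, fun l => ?_⟩
      rw [splice_cycleSum_rot2 (E := E.splice t₁ q₁ u₁) u₂ h₃ k₂ ht₂ hs, hs₁,
        splice_cycleSum_rot2_self u₁ h₁ k₁, splice_cycleSum_rot2 u₁ h₁ k₁ ht₁ ht₁]
    · refine ⟨s, hs₁, hs, fun _ _ => rfl, fun l => ?_⟩
      rw [splice_cycleSum_rot2 (E := E.splice t₁ q₁ u₁) u₂ h₃ k₂ ht₂ hs,
        splice_cycleSum_rot2 u₁ h₁ k₁ ht₁ hs₁]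
  by_cases hs : s = q₂
  · obtain ⟨s', h1, h2, -, h3⟩ := main t₂ ht₂
    refine ⟨s', h1, h2, fun _ h => absurd hs h, fun l => ?_⟩
    rw [hs, splice_cycleSum_rot2_self (E := E.splice t₁ q₁ u₁) u₂ h₃ k₂, h3]
  · exact main s hs

theorem splice_splice_cycleSum_isReal (h₁ : E.next q₁ = q₁) (h₂ : E.next q₂ = q₂) (h₁₂ : q₁ ≠ q₂)
    (k₁ : E.kind q₁.1 = 0) (k₂ : E.kind q₂.1 = 0) (ht₁ : t₁ ≠ q₁) (ht₁' : t₁ ≠ q₂) (ht₂ : t₂ ≠ q₂)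
    (s : E.V × Bool) : ∃ s', s' ≠ q₁ ∧ s' ≠ q₂ ∧ (s ≠ q₁ → s ≠ q₂ → s' = s) ∧
      cycleSum ((E.splice t₁ q₁ u₁).splice t₂ q₂ u₂).next
        ((E.splice t₁ q₁ u₁).splice t₂ q₂ u₂).isReal s = cycleSum E.next E.isReal s' := by
  have h₃ := splice_next_loop u₁ h₂ h₁₂ ht₁'
  have main : ∀ s : E.V × Bool, s ≠ q₂ → ∃ s', s' ≠ q₁ ∧ s' ≠ q₂ ∧ (s ≠ q₁ → s ≠ q₂ → s' = s) ∧
      cycleSum ((E.splice t₁ q₁ u₁).splice t₂ q₂ u₂).next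
        ((E.splice t₁ q₁ u₁).splice t₂ q₂ u₂).isReal s = cycleSum E.next E.isReal s' := by
    intro s hs
    by_cases hs₁ : s = q₁
    · refine ⟨t₁, ht₁, ht₁', fun h => absurd hs₁ h, ?_⟩
      rw [splice_cycleSum_isReal (E := E.splice t₁ q₁ u₁) u₂ h₃ k₂ ht₂ hs, hs₁,
        splice_cycleSum_isReal_self u₁ h₁, splice_cycleSum_isReal u₁ h₁ k₁ ht₁ ht₁]
    · refine ⟨s, hs₁, hs, fun _ _ => rfl, ?_⟩
      rw [splice_cycleSum_isReal (E := E.splice t₁ q₁ u₁) u₂ h₃ k₂ ht₂ hs,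
        splice_cycleSum_isReal u₁ h₁ k₁ ht₁ hs₁]
  by_cases hs : s = q₂
  · obtain ⟨s', h1, h2, -, h3⟩ := main t₂ ht₂
    refine ⟨s', h1, h2, fun _ h => absurd hs h, ?_⟩
    rw [hs, splice_cycleSum_isReal_self (E := E.splice t₁ q₁ u₁) u₂ h₃, h3]
  · exact main s hs

end Splice

theorem insertVirtual_fn_iff (D : VDiagram) (s₁ : D.V × Bool) (s₂ : (D.V ⊕ Unit) × Bool) (u₁ u₂ : ℤ)
    (h : s₂ ≠ (Sum.inr (), false)) : FN D ↔ FN (D.insertVirtual s₁ s₂ u₁ u₂) := by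
  rw [insertVirtual_eq]
  have hr := splice_splice_cycleSum_rot2 (E := D.loops) (t₁ := (Sum.inl s₁.1, s₁.2))
    (q₁ := (Sum.inr (), true)) (t₂ := s₂) (q₂ := (Sum.inr (), false)) u₁ u₂ rfl rfl (by simp) rfl rfl
    (by simp) (by simp) h
  have hn := splice_splice_cycleSum_isReal (E := D.loops) (t₁ := (Sum.inl s₁.1, s₁.2))
    (q₁ := (Sum.inr (), true)) (t₂ := s₂) (q₂ := (Sum.inr (), false)) u₁ u₂ rfl rfl (by simp) rfl rfl
    (by simp) (by simp) h
  have hl : ∀ s : (D.V ⊕ Unit) × Bool, s ≠ (Sum.inr (), true) → s ≠ (Sum.inr (), false) →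
      ∃ s' : D.V × Bool, s = (Sum.inl s'.1, s'.2) := by
    rintro ⟨v | ⟨⟩, b⟩ h1 h2
    · exact ⟨(v, b), rfl⟩
    · cases b <;> simp_all
  rw [FN, FN, framed_iff, noFreeCircle_iff, framed_iff, noFreeCircle_iff]
  constructor
  · rintro ⟨h1, h2⟩
    constructor
    · intro s
      obtain ⟨s', a1, a2, -, a3⟩ := hn s
      obtain ⟨s'', rfl⟩ := hl s' a1 a2
      exact fun h => h1 s'' ((D.loops_emb.cycleSum_isReal s'').symm.trans (a3.symm.trans h))
    · rintro ⟨s, l⟩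
      obtain ⟨s', a1, a2, -, a3⟩ := hr s
      obtain ⟨s'', rfl⟩ := hl s' a1 a2
      exact (a3 l).trans ((D.loops_emb.cycleSum_rot2 (s'', l)).trans (h2 _))
  · rintro ⟨h1, h2⟩
    constructor
    · intro s
      obtain ⟨s', -, -, a2, a3⟩ := hn (Sum.inl s.1, s.2)
      rw [a2 (by simp) (by simp)] at a3
      exact fun h => h1 _ (a3.trans ((D.loops_emb.cycleSum_isReal s).trans h))
    · rintro ⟨s, l⟩
      obtain ⟨s', -, -, a2, a3⟩ := hr (Sum.inl s.1, s.2)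
      rw [a2 (by simp) (by simp)] at a3
      exact (D.loops_emb.cycleSum_rot2 (s, l)).symm.trans ((a3 l).symm.trans (h2 _))

theorem Equivalent.fn_iff {D D' : VDiagram} (h : Equivalent D D') : FN D ↔ FN D' := by
  cases h with
  | iso h => exact h.fn_iff
  | insert s₁ s₂ u₁ u₂ h => exact insertVirtual_fn_iff _ _ _ _ _ h

/-! ### Invariance under H-moves -/

/-- The potential of a line is the value of `f` at the crossing where the line begins in the
boundary orientation; for the third line this is the head of the edge. The change of `rot2`
telescopes around each cell. -/
theorem gauge_rot2 (D : VDiagram) (f : D.V → ℤ) (g : D.Germ) :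
    (D.gauge f).rot2 g = D.rot2 g +
      ((2 * (fun g : D.Germ => if g.2 = 2 then f (D.next g.1).1 else f g.1.1) (D.succ g)) -
        2 * (fun g : D.Germ => if g.2 = 2 then f (D.next g.1).1 else f g.1.1) g) := by
  have h1 : (D.gauge f).succ g = D.succ g := rfl
  have h2 : (if (D.succ g).2 = 2 then f (D.next (D.succ g).1).1 else f (D.succ g).1.1) =
      f (D.arrival g).1.1 := by
    rw [succ_eq]
    unfold depart
    split_ifs <;> simp_all
  simp only [h2]
  unfold rot2 along arrival
  rw [h1]
  simp only [gauge]
  split_ifs <;> ring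

theorem gauge_framed_iff (D : VDiagram) (f : D.V → ℤ) : (D.gauge f).Framed ↔ D.Framed := by
  rw [framed_iff, framed_iff]
  refine forall_congr' fun g => ?_
  rw [show cycleSum (D.gauge f).succ (D.gauge f).rot2 g = cycleSum D.succ (D.gauge f).rot2 g from rfl,
    cycleSum_congr (gauge_rot2 D f) g, cycleSum_add_coboundary D.succ D.rot2
      (fun x => 2 * (fun g : D.Germ => if g.2 = 2 then f (D.next g.1).1 else f g.1.1) x) g]

theorem gauge_fn_iff (D : VDiagram) (f : D.V → ℤ) : (D.gauge f).FN ↔ D.FN := by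
  rw [FN, FN, gauge_framed_iff]; rfl

end VDiagram

/-! ### Framedness depends only on the class of a diagram. -/

namespace IntegralOGraph

open VDiagram

/-- The definition asks for one framed representative. Both properties in `FN` are invariant under
the generating equivalences, so every representative will do. -/
theorem isFramed_mk_iff (D : VDiagram) : (mk D).IsFramed ↔ D.FN := by
  constructor
  · rintro ⟨D', h, h'⟩
    have : Relation.EqvGen Equivalent D' D := Quot.eqvGen_exact h
    have h2 : D'.FN ↔ D.FN := by
      clear h h'
      induction this with
      | rel _ _ h => exact h.fn_iff
      | refl => rfl
      | symm _ _ _ ih => exact ih.symm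
      | trans _ _ _ _ _ ih1 ih2 => exact ih1.trans ih2
    exact h2.1 h'
  · exact fun h => ⟨D, rfl, h⟩

theorem mk_eq_of_iso {D D' : VDiagram} (h : Iso D D') : mk D = mk D' := Quot.sound (.iso h)

end IntegralOGraph

/-! ### Recognizing a diagram with a virtual crossing to be removed. -/

namespace VDiagram

/-- `D'` arises from `D` by inserting a virtual crossing `ψ (Sum.inr ())`, with strand `b` inserted
into the edge `s b`; if both strands are inserted into the same edge, then strand `c` comes first. -/
structure Refines (D D' : VDiagram) (ψ : D.V ⊕ Unit ≃ D'.V) (s : Bool → D.V × Bool) (c : Bool) :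
    Prop where
  kind_inl : ∀ x, D'.kind (ψ (Sum.inl x)) = D.kind x
  kind_inr : D'.kind (ψ (Sum.inr ())) = 0
  other : ∀ x, x ≠ s true → x ≠ s false →
    D'.next (ψ (Sum.inl x.1), x.2) = (ψ (Sum.inl (D.next x).1), (D.next x).2) ∧
    D'.weight (ψ (Sum.inl x.1), x.2) = D.weight x
  ne : s true ≠ s false → ∀ b,
    D'.next (ψ (Sum.inl (s b).1), (s b).2) = (ψ (Sum.inr ()), b) ∧
    D'.next (ψ (Sum.inr ()), b) = (ψ (Sum.inl (D.next (s b)).1), (D.next (s b)).2) ∧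
    D'.weight (ψ (Sum.inl (s b).1), (s b).2) + D'.weight (ψ (Sum.inr ()), b) = D.weight (s b)
  eq : s true = s false →
    D'.next (ψ (Sum.inl (s c).1), (s c).2) = (ψ (Sum.inr ()), c) ∧
    D'.next (ψ (Sum.inr ()), c) = (ψ (Sum.inr ()), !c) ∧
    D'.next (ψ (Sum.inr ()), !c) = (ψ (Sum.inl (D.next (s c)).1), (D.next (s c)).2) ∧
    D'.weight (ψ (Sum.inl (s c).1), (s c).2) + D'.weight (ψ (Sum.inr ()), true) +
      D'.weight (ψ (Sum.inr ()), false) = D.weight (s c)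

section

variable {D D' : VDiagram} {ψ : D.V ⊕ Unit ≃ D'.V} {s : Bool → D.V × Bool} {c : Bool}

theorem splice_weight_t {E : VDiagram} {t q : E.V × Bool} (u : ℤ) (h : t ≠ q) :
    (E.splice t q u).weight t = E.weight t - u := by
  simp [h]

theorem splice_weight_q {E : VDiagram} {t q : E.V × Bool} (u : ℤ) :
    (E.splice t q u).weight q = u := by
  simp

theorem splice_weight_of_ne {E : VDiagram} {t q x : E.V × Bool} (u : ℤ) (h : x ≠ t) (h' : x ≠ q) :
    (E.splice t q u).weight x = E.weight x := by
  simp [h, h']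

theorem Refines.mk_eq_ne (h : Refines D D' ψ s c) (hs : s true ≠ s false) :
    IntegralOGraph.mk D = IntegralOGraph.mk D' := by
  have hq : (((Sum.inl (s false).1, (s false).2) : (D.V ⊕ Unit) × Bool)) ≠ (Sum.inr (), false) := by
    simp
  have hts : ((Sum.inl (s true).1, (s true).2) : (D.V ⊕ Unit) × Bool) ≠
      (Sum.inl (s false).1, (s false).2) := by
    intro e
    simp only [Prod.mk.injEq, Sum.inl.injEq] at e
    exact hs (Prod.ext e.1 e.2)
  refine (Quot.sound (Equivalent.insert D (s true) (Sum.inl (s false).1, (s false).2)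
    (D'.weight (ψ (Sum.inr ()), true)) (D'.weight (ψ (Sum.inr ()), false)) hq)).trans
    (IntegralOGraph.mk_eq_of_iso ?_)
  rw [insertVirtual_eq]
  obtain ⟨a1, a2, a3⟩ := h.ne hs true
  obtain ⟨b1, b2, b3⟩ := h.ne hs false
  refine ⟨ψ, ?_, ?_, ?_⟩
  · rintro (x | ⟨⟩)
    · exact h.kind_inl x
    · exact h.kind_inr
  · rintro (x | ⟨⟩) b
    · by_cases h1 : (x, b) = s true
      · have e1 : x = (s true).1 := congrArg Prod.fst h1
        have e2 : b = (s true).2 := congrArg Prod.snd h1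
        subst e1 e2
        rw [splice_next_of_ne _ hts (by simp), splice_next_t, a1]
        rfl
      · by_cases h2 : (x, b) = s false
        · have e1 : x = (s false).1 := congrArg Prod.fst h2
          have e2 : b = (s false).2 := congrArg Prod.snd h2
          subst e1 e2
          rw [splice_next_t, splice_next_of_ne _ (by simp) (by simp), b1]
          rfl
        · rw [splice_next_of_ne, splice_next_of_ne]
          · exact (h.other (x, b) h1 h2).1
          · intro e; simp only [Prod.mk.injEq, Sum.inl.injEq] at e; exact h1 (Prod.ext e.1 e.2)
          · simp
          · intro e; simp only [Prod.mk.injEq, Sum.inl.injEq] at e; exact h2 (Prod.ext e.1 e.2)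
          · simp
    · cases b
      · rw [splice_next_q, splice_next_of_ne _ hts.symm (by simp), b2]
        rfl
      · rw [splice_next_of_ne _ (by simp) (by simp), splice_next_q, a2]
        rfl
  · rintro (x | ⟨⟩) b
    · by_cases h1 : (x, b) = s true
      · have e1 : x = (s true).1 := congrArg Prod.fst h1
        have e2 : b = (s true).2 := congrArg Prod.snd h1
        subst e1 e2
        rw [splice_weight_of_ne _ hts (by simp), splice_weight_t _ (by simp), eq_sub_iff_add_eq, a3]
        rfl
      · by_cases h2 : (x, b) = s false
        · have e1 : x = (s false).1 := congrArg Prod.fst h2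
          have e2 : b = (s false).2 := congrArg Prod.snd h2
          subst e1 e2
          rw [splice_weight_t _ (by simp), splice_weight_of_ne _ hts.symm (by simp),
            eq_sub_iff_add_eq, b3]
          rfl
        · rw [splice_weight_of_ne, splice_weight_of_ne]
          · exact (h.other (x, b) h1 h2).2
          · intro e; simp only [Prod.mk.injEq, Sum.inl.injEq] at e; exact h1 (Prod.ext e.1 e.2)
          · simp
          · intro e; simp only [Prod.mk.injEq, Sum.inl.injEq] at e; exact h2 (Prod.ext e.1 e.2)
          · simp
    · cases b
      · rw [splice_weight_q]
      · rw [splice_weight_of_ne _ (by simp) (by simp), splice_weight_q]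

/-- The strand `false` comes second on the common edge, so it is inserted into the edge starting at
the newly inserted strand `true`. -/
theorem Refines.mk_eq_true (h : Refines D D' ψ s true) (hs : s true = s false) :
    IntegralOGraph.mk D = IntegralOGraph.mk D' := by
  have hq : ((Sum.inr (), true) : (D.V ⊕ Unit) × Bool) ≠ (Sum.inr (), false) := by
    simp
  refine (Quot.sound (Equivalent.insert D (s true) (Sum.inr (), true)
    -- The second insertion takes its share away from the edge after the strand `true`, so that edge
    -- must first receive both shares.
    (D'.weight (ψ (Sum.inr ()), true) + D'.weight (ψ (Sum.inr ()), false))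
    (D'.weight (ψ (Sum.inr ()), false)) hq)).trans
    (IntegralOGraph.mk_eq_of_iso ?_)
  rw [insertVirtual_eq]
  obtain ⟨a1, a2, a3, a4⟩ := h.eq hs
  refine ⟨ψ, ?_, ?_, ?_⟩
  · rintro (x | ⟨⟩)
    · exact h.kind_inl x
    · exact h.kind_inr
  · rintro (x | ⟨⟩) b
    · by_cases h1 : (x, b) = s true
      · have e1 : x = (s true).1 := congrArg Prod.fst h1
        have e2 : b = (s true).2 := congrArg Prod.snd h1
        subst e1 e2
        rw [splice_next_of_ne _ (by simp) (by simp), splice_next_t, a1]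
        rfl
      · rw [splice_next_of_ne _ (by simp) (by simp), splice_next_of_ne]
        · exact (h.other (x, b) h1 (hs ▸ h1)).1
        · intro e; simp only [Prod.mk.injEq, Sum.inl.injEq] at e; exact h1 (Prod.ext e.1 e.2)
        · simp
    · cases b
      · rw [splice_next_q, splice_next_q]
        exact a3
      · rw [splice_next_t, splice_next_of_ne _ (by simp) (by simp)]
        exact a2
  · rintro (x | ⟨⟩) b
    · by_cases h1 : (x, b) = s true
      · have e1 : x = (s true).1 := congrArg Prod.fst h1
        have e2 : b = (s true).2 := congrArg Prod.snd h1
        subst e1 e2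
        rw [splice_weight_of_ne _ (by simp) (by simp), splice_weight_t _ (by simp),
          eq_sub_iff_add_eq, ← add_assoc, a4]
        rfl
      · rw [splice_weight_of_ne _ (by simp) (by simp), splice_weight_of_ne]
        · exact (h.other (x, b) h1 (hs ▸ h1)).2
        · intro e; simp only [Prod.mk.injEq, Sum.inl.injEq] at e; exact h1 (Prod.ext e.1 e.2)
        · simp
    · cases b
      · rw [splice_weight_q]
      · rw [splice_weight_t _ (by simp), splice_weight_q]
        ring

/-- An insertion always treats the strand `true` first. To have the strand `false` in front, it is
inserted into the initial part of the divided edge. -/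
theorem Refines.mk_eq_false (h : Refines D D' ψ s false) (hs : s true = s false) :
    IntegralOGraph.mk D = IntegralOGraph.mk D' := by
  have hq : ((Sum.inl (s true).1, (s true).2) : (D.V ⊕ Unit) × Bool) ≠ (Sum.inr (), false) := by
    simp
  refine (Quot.sound (Equivalent.insert D (s true) (Sum.inl (s true).1, (s true).2)
    (D'.weight (ψ (Sum.inr ()), true))
    (D'.weight (ψ (Sum.inr ()), false)) hq)).trans
    (IntegralOGraph.mk_eq_of_iso ?_)
  rw [insertVirtual_eq]
  obtain ⟨a1, a2, a3, a4⟩ := h.eq hs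
  rw [← hs] at a1 a3 a4
  refine ⟨ψ, ?_, ?_, ?_⟩
  · rintro (x | ⟨⟩)
    · exact h.kind_inl x
    · exact h.kind_inr
  · rintro (x | ⟨⟩) b
    · by_cases h1 : (x, b) = s true
      · have e1 : x = (s true).1 := congrArg Prod.fst h1
        have e2 : b = (s true).2 := congrArg Prod.snd h1
        subst e1 e2
        rw [splice_next_t, splice_next_of_ne _ (by simp) (by simp), a1]
        rfl
      · rw [splice_next_of_ne, splice_next_of_ne]
        · exact (h.other (x, b) h1 (hs ▸ h1)).1
        · intro e; simp only [Prod.mk.injEq, Sum.inl.injEq] at e; exact h1 (Prod.ext e.1 e.2)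
        · simp
        · intro e; simp only [Prod.mk.injEq, Sum.inl.injEq] at e; exact h1 (Prod.ext e.1 e.2)
        · simp
    · cases b
      · rw [splice_next_q, splice_next_t]
        exact a2
      · rw [splice_next_of_ne _ (by simp) (by simp), splice_next_q]
        exact a3
  · rintro (x | ⟨⟩) b
    · by_cases h1 : (x, b) = s true
      · have e1 : x = (s true).1 := congrArg Prod.fst h1
        have e2 : b = (s true).2 := congrArg Prod.snd h1
        subst e1 e2
        rw [splice_weight_t _ (by simp), splice_weight_t _ (by simp),
          eq_sub_iff_add_eq, eq_sub_iff_add_eq, add_right_comm, a4]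
        rfl
      · rw [splice_weight_of_ne, splice_weight_of_ne]
        · exact (h.other (x, b) h1 (hs ▸ h1)).2
        · intro e; simp only [Prod.mk.injEq, Sum.inl.injEq] at e; exact h1 (Prod.ext e.1 e.2)
        · simp
        · intro e; simp only [Prod.mk.injEq, Sum.inl.injEq] at e; exact h1 (Prod.ext e.1 e.2)
        · simp
    · cases b
      · rw [splice_weight_q]
      · rw [splice_weight_of_ne _ (by simp) (by simp), splice_weight_q]

theorem Refines.mk_eq (h : Refines D D' ψ s c) : IntegralOGraph.mk D = IntegralOGraph.mk D' := by
  by_cases hs : s true = s false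
  · cases c
    · exact h.mk_eq_false hs
    · exact h.mk_eq_true hs
  · exact h.mk_eq_ne hs

end

end VDiagram

/-! ### Moving weights through a virtual crossing. -/

namespace VDiagram

/-- The same diagram with other weights. -/
abbrev withWeight (D : VDiagram) (w : D.V × Bool → ℤ) : VDiagram := { D with weight := w }

open Classical in
/-- Move the weight `u` along the strand `q`, from the incoming edge to the outgoing edge. -/
noncomputable def shift (D : VDiagram) (q : D.V × Bool) (u : ℤ) (w : D.V × Bool → ℤ) :
    D.V × Bool → ℤ :=
  fun x => w x + (if x = q then u else 0) - if D.next x = q then u else 0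

section

variable {D D' : VDiagram} {ψ : D.V ⊕ Unit ≃ D'.V} {s : Bool → D.V × Bool} {c : Bool}

open Classical in
/-- The weights which a diagram inherits when a virtual crossing is removed. -/
noncomputable def merge (ψ : D.V ⊕ Unit ≃ D'.V) (s : Bool → D.V × Bool) (w : D'.V × Bool → ℤ) :
    D.V × Bool → ℤ := fun x => w (ψ (Sum.inl x.1), x.2) +
      if s true = s false then
        if x = s true then w (ψ (Sum.inr ()), true) + w (ψ (Sum.inr ()), false) else 0
      else if x = s true then w (ψ (Sum.inr ()), true)
        else if x = s false then w (ψ (Sum.inr ()), false) else 0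

theorem Refines.withWeight (h : Refines D D' ψ s c) (w : D'.V × Bool → ℤ) :
    Refines (D.withWeight (merge ψ s w)) (D'.withWeight w) ψ s c where
  kind_inl := h.kind_inl
  kind_inr := h.kind_inr
  other x h1 h2 := ⟨(h.other x h1 h2).1, by simp [merge, h1, h2]⟩
  ne hs b := by
    obtain ⟨h1, h2, -⟩ := h.ne hs b
    refine ⟨h1, h2, ?_⟩
    cases b
    · simp [merge, hs, Ne.symm hs]
    · simp [merge, hs]
  eq hs := by
    obtain ⟨h1, h2, h3, -⟩ := h.eq hs
    refine ⟨h1, h2, h3, ?_⟩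
    cases c
    · simp [merge, hs, add_assoc]
    · simp [merge, hs, add_assoc]

/-- The merged weight of an edge is the sum over its parts, and a shift along the removed crossing
moves weight only between parts of one edge. -/
theorem Refines.merge_shift (h : Refines D D' ψ s c) (w : D'.V × Bool → ℤ) (b : Bool) (u : ℤ) :
    merge ψ s (D'.shift (ψ (Sum.inr ()), b) u w) = merge ψ s w := by
  funext x
  unfold merge
  have hψ : ∀ y b', ((ψ (Sum.inl y), b') : D'.V × Bool) ≠ (ψ (Sum.inr ()), b) := by
    intro y b' e
    have := ψ.injective (congrArg Prod.fst e)
    simp at this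
  by_cases hs : s true = s false
  · obtain ⟨h1, h2, h3, -⟩ := h.eq hs
    by_cases hx : x = s true
    · rw [hs] at hx
      subst hx
      simp only [hs, if_true, shift]
      cases c
      · rw [Bool.not_false] at h2 h3
        rw [h1, h2, h3]
        simp only [hψ, if_false]
        cases b <;> simp; ring
      · rw [hs] at h1 h3
        rw [Bool.not_true] at h2 h3
        rw [h1, h2, h3]
        simp only [hψ, if_false]
        cases b <;> simp; ring
    · have h4 := (h.other x hx (hs ▸ hx)).1
      rw [if_pos hs, if_pos hs, if_neg hx, if_neg hx]
      simp only [shift, hψ, if_false, h4]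
      simp
  · obtain ⟨h1, h2, -⟩ := h.ne hs true
    obtain ⟨h3, h4, -⟩ := h.ne hs false
    simp only [hs, if_false]
    by_cases hx : x = s true
    · subst hx
      simp only [shift, if_true]
      rw [h1, h2]
      simp only [hψ, if_false]
      cases b <;> simp
    · by_cases hx' : x = s false
      · subst hx'
        simp only [shift, if_true]
        rw [h3, h4]
        simp only [hψ, hx, if_false]
        cases b <;> simp
      · have h4 := (h.other x hx hx').1
        simp only [shift, h4, hψ, if_false, hx, hx']
        simp

theorem Refines.shift_mk_eq (h : Refines D D' ψ s c) (w : D'.V × Bool → ℤ) (b : Bool) (u : ℤ) :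
    IntegralOGraph.mk (D'.withWeight (D'.shift (ψ (Sum.inr ()), b) u w)) =
      IntegralOGraph.mk (D'.withWeight w) := by
  rw [← (h.withWeight w).mk_eq,
    ← (h.withWeight (D'.shift (ψ (Sum.inr ()), b) u w)).mk_eq, h.merge_shift]

end

end VDiagram

/-! ### Tangles with three open strands -/

/-- Three strands which pass through the points of `P`. -/
structure Code (P : Type) where
  first : Fin 3 → P
  rest : Fin 3 → List P

namespace Code

variable {P : Type}

/-- The last point of a strand. -/
def last (C : Code P) (j : Fin 3) : P := (C.rest j).getLastD (C.first j)

variable [DecidableEq P]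

/-- The point after `p` in a list. -/
def after (p : P) : List P → Option P
  | a :: b :: l => if a = p then some b else after p (b :: l)
  | _ => none

theorem infix_of_after {p q : P} : ∀ {l : List P}, after p l = some q → [p, q] <:+: l
  | [], h => by simp [after] at h
  | [a], h => by simp [after] at h
  | a :: b :: l, h => by
    unfold after at h
    split_ifs at h with h1
    · obtain rfl : b = q := by simpa using h
      subst h1
      exact ⟨[], l, rfl⟩
    · obtain ⟨s, t, hst⟩ := infix_of_after h
      exact ⟨a :: s, t, by simp [← hst]⟩

/-- The point of the code after `p`, or the strand which ends at `p`. -/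
def next (C : Code P) (p : P) : P ⊕ Fin 3 :=
  match after p (C.first 0 :: C.rest 0), after p (C.first 1 :: C.rest 1),
    after p (C.first 2 :: C.rest 2) with
  | some q, _, _ => .inl q
  | none, some q, _ => .inl q
  | none, none, some q => .inl q
  | none, none, none => .inr (if p = C.last 0 then 0 else if p = C.last 1 then 1 else 2)

/-- The point of the code before `q`, or the strand which starts at `q`. -/
def back (C : Code P) (q : P) : P ⊕ Fin 3 :=
  match after q (C.first 0 :: C.rest 0).reverse, after q (C.first 1 :: C.rest 1).reverse,
    after q (C.first 2 :: C.rest 2).reverse with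
  | some p, _, _ => .inl p
  | none, some p, _ => .inl p
  | none, none, some p => .inl p
  | none, none, none => .inr (if q = C.first 0 then 0 else if q = C.first 1 then 1 else 2)

theorem infix_of_next {C : Code P} {p q : P} (h : C.next p = .inl q) :
    ∃ j, [p, q] <:+: C.first j :: C.rest j := by
  unfold next at h
  split at h
  · rename_i h1; cases h; exact ⟨0, infix_of_after h1⟩
  · rename_i h1; cases h; exact ⟨1, infix_of_after h1⟩
  · rename_i h1; cases h; exact ⟨2, infix_of_after h1⟩
  · cases h

/-- Every point lies exactly once on the three strands. -/
abbrev Valid (C : Code P) : Prop :=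
  (∀ p q, C.next p = .inl q ↔ C.back q = .inl p) ∧ (∀ p j, C.next p = .inr j ↔ p = C.last j) ∧
    ∀ q j, C.back q = .inr j ↔ q = C.first j

variable {X : Type}

/-- The incoming ends of the outside and of the strands. -/
def inn (C : Code P) : X ⊕ Fin 3 → P ⊕ X := Sum.elim .inr fun j => .inl (C.first j)

/-- The outgoing ends of the outside and of the strands. -/
def out (C : Code P) : X ⊕ Fin 3 → P ⊕ X := Sum.elim .inr fun j => .inl (C.last j)

/-- Join the strands of a code by `link`. -/
def join (C : Code P) (hC : C.Valid) (link : X ⊕ Fin 3 ≃ X ⊕ Fin 3) : P ⊕ X ≃ P ⊕ X where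
  toFun := Sum.elim (fun p => Sum.elim .inl (fun j => C.inn (link (.inr j))) (C.next p))
    fun x => C.inn (link (.inl x))
  invFun := Sum.elim (fun q => Sum.elim .inl (fun j => C.out (link.symm (.inr j))) (C.back q))
    fun x => C.out (link.symm (.inl x))
  left_inv := by
    have key : ∀ y, (Sum.elim (fun q => Sum.elim .inl (fun j => C.out (link.symm (.inr j)))
        (C.back q)) fun x => C.out (link.symm (.inl x))) (C.inn y) = C.out (link.symm y) := by
      rintro (x | j)
      · rfl
      · simp only [inn, Sum.elim_inr, Sum.elim_inl, (hC.2.2 _ j).2 rfl]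
    rintro (p | x)
    · simp only [Sum.elim_inl]
      rcases h : C.next p with q | j
      · simp only [Sum.elim_inl, (hC.1 p q).1 h]
      · simp only [Sum.elim_inr, key, Equiv.symm_apply_apply]
        simp only [out, Sum.elim_inr, (hC.2.1 p j).1 h]
    · simp only [Sum.elim_inr, key, Equiv.symm_apply_apply]
      rfl
  right_inv := by
    have key : ∀ y, (Sum.elim (fun p => Sum.elim .inl (fun j => C.inn (link (.inr j)))
        (C.next p)) fun x => C.inn (link (.inl x))) (C.out y) = C.inn (link y) := by
      rintro (x | j)
      · rfl
      · simp only [out, Sum.elim_inr, Sum.elim_inl, (hC.2.1 _ j).2 rfl]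
    rintro (p | x)
    · simp only [Sum.elim_inl]
      rcases h : C.back p with q | j
      · simp only [Sum.elim_inl, (hC.1 q p).2 h]
      · simp only [Sum.elim_inr, key, Equiv.apply_symm_apply]
        simp only [inn, Sum.elim_inr, (hC.2.2 p j).1 h]
    · simp only [Sum.elim_inr, key, Equiv.apply_symm_apply]
      rfl

/-- The weights of the edges after joining the strands of a code. -/
def joinWt (C : Code P) (link : X ⊕ Fin 3 ≃ X ⊕ Fin 3) (wt : P → ℤ) (win : Fin 3 → ℤ)
    (w : X ⊕ Fin 3 → ℤ) : P ⊕ X → ℤ :=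
  Sum.elim (fun p => wt p + Sum.elim (fun _ => 0)
      (fun j => w (.inr j) + Sum.elim (fun _ => 0) win (link (.inr j))) (C.next p))
    fun x => w (.inl x) + Sum.elim (fun _ => 0) win (link (.inl x))

section

variable (C : Code P) (link : X ⊕ Fin 3 ≃ X ⊕ Fin 3) (wt : P → ℤ) (win : Fin 3 → ℤ)
    (w : X ⊕ Fin 3 → ℤ)

theorem join_out (hC : C.Valid) (y : X ⊕ Fin 3) : C.join hC link (C.out y) = C.inn (link y) := by
  rcases y with x | j
  · rfl
  · simp only [out, Sum.elim_inr, join, Equiv.coe_fn_mk, Sum.elim_inl, (hC.2.1 _ j).2 rfl]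

theorem join_inl (hC : C.Valid) {p q : P} (h : C.next p = .inl q) : C.join hC link (.inl p) = .inl q := by
  simp only [join, Equiv.coe_fn_mk, Sum.elim_inl, h]

theorem join_symm_inn (hC : C.Valid) (y : X ⊕ Fin 3) :
    (C.join hC link).symm (C.inn y) = C.out (link.symm y) := by
  rw [Equiv.symm_apply_eq, join_out, Equiv.apply_symm_apply]

theorem join_symm_inl (hC : C.Valid) {p q : P} (h : C.back q = .inl p) :
    (C.join hC link).symm (.inl q) = .inl p := by
  rw [Equiv.symm_apply_eq, join_inl _ _ hC ((hC.1 p q).2 h)]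

theorem joinWt_out (hC : C.Valid) (y : X ⊕ Fin 3) : C.joinWt link wt win w (C.out y) =
    w y + Sum.elim (fun _ => 0) (fun j => wt (C.last j)) y +
      Sum.elim (fun _ => 0) win (link y) := by
  rcases y with x | j
  · simp [out, joinWt]
  · simp only [out, joinWt, Sum.elim_inr, Sum.elim_inl, (hC.2.1 _ j).2 rfl]
    ring

theorem joinWt_inl {p q : P} (h : C.next p = .inl q) :
    C.joinWt link wt win w (.inl p) = wt p := by
  simp [joinWt, h]

end

end Code

/-- A weighted tangle with three open strands. `win j` is the weight of the open edge at the
beginning of strand `j`, and `wt p` is the weight of the edge after the passage `p`. -/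
structure Tangle (n : ℕ) extends Code (Fin n × Bool) where
  sign : Fin n → SignType
  wt : Fin n × Bool → ℤ
  win : Fin 3 → ℤ

namespace Tangle

variable {n : ℕ}

/-- The diagram obtained by gluing a tangle to an outside. -/
def closure (T : Tangle n) (h : T.Valid) (O : Outside) : VDiagram :=
  haveI := O.fin
  { V := Fin n ⊕ O.W
    kind := Sum.elim T.sign O.kind
    next := (Equiv.sumProdDistrib (Fin n) O.W Bool).trans
      ((T.join h O.link).trans (Equiv.sumProdDistrib (Fin n) O.W Bool).symm)
    weight := fun s => T.joinWt O.link T.wt T.win O.weight (Equiv.sumProdDistrib (Fin n) O.W Bool s) }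

variable (T : Tangle n) (h : T.Valid) (O : Outside)

/-- The crossings of the closure. -/
def vert : Fin n ⊕ O.W ≃ (T.closure h O).V := Equiv.refl _

/-- The ends at the crossings of the closure. -/
def port : (Fin n × Bool) ⊕ (O.W × Bool) ≃ (T.closure h O).V × Bool :=
  (Equiv.sumProdDistrib (Fin n) O.W Bool).symm

theorem port_inl (p : Fin n × Bool) : T.port h O (.inl p) = (T.vert h O (.inl p.1), p.2) := rfl

theorem port_inr (x : O.W × Bool) : T.port h O (.inr x) = (T.vert h O (.inr x.1), x.2) := rfl

theorem kind_inl (i : Fin n) : (T.closure h O).kind (T.vert h O (.inl i)) = T.sign i := rfl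

theorem kind_inr (x : O.W) : (T.closure h O).kind (T.vert h O (.inr x)) = O.kind x := rfl

theorem next_port (s : (Fin n × Bool) ⊕ (O.W × Bool)) :
    (T.closure h O).next (T.port h O s) = T.port h O (T.join h O.link s) := by
  rcases s with s | s <;> rfl

theorem symm_port (s : (Fin n × Bool) ⊕ (O.W × Bool)) :
    (T.closure h O).next.symm (T.port h O s) = T.port h O ((T.join h O.link).symm s) := by
  rw [Equiv.symm_apply_eq, next_port, Equiv.apply_symm_apply]

theorem weight_port (s : (Fin n × Bool) ⊕ (O.W × Bool)) :
    (T.closure h O).weight (T.port h O s) = T.joinWt O.link T.wt T.win O.weight s := by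
  rcases s with s | s <;> rfl

end Tangle

namespace Tangle

variable {n : ℕ} (T : Tangle n)

/-! ### Following the lines inside a tangle

The edges of the closure which meet the tangle are given by `Sum.inl p`, the edge after the
passage `p`, or by `Sum.inr j`, the edge at the beginning of strand `j`. -/

/-- The line on which one leaves the crossing after arriving at an end. -/
def step (a : (Fin n × Bool) × Fin 3) : ((Fin n × Bool) ⊕ Fin 3) × Fin 3 :=
  let c := VDiagram.corner (T.sign a.1.1) a.1.2 a.2
  (if c.2 = 2 then T.back (a.1.1, c.1) else .inl (a.1.1, c.1), c.2)

/-- The end of the tangle at which a line arrives. -/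
def arrive (g : ((Fin n × Bool) ⊕ Fin 3) × Fin 3) : Option ((Fin n × Bool) × Fin 3) :=
  match g.1 with
  | .inl p => if g.2 = 2 then some (p, 2) else
      match T.next p with
      | .inl q => some (q, g.2)
      | .inr _ => none
  | .inr j => if g.2 = 2 then none else some (T.first j, g.2)

/-- Twice the contribution of the weights of the tangle along a line. -/
def val (g : ((Fin n × Bool) ⊕ Fin 3) × Fin 3) : ℤ :=
  2 * if g.2 = 2 then -Sum.elim T.wt T.win g.1 else Sum.elim T.wt T.win g.1

/-- Follow a line until it leaves the tangle or reaches `halt`. The result is the last line and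
twice the rotation number before it. -/
def trace (halt : ((Fin n × Bool) ⊕ Fin 3) × Fin 3 → Bool) :
    ℕ → (Fin n × Bool) × Fin 3 → Option ((((Fin n × Bool) ⊕ Fin 3) × Fin 3) × ℤ)
  | 0, _ => none
  | k + 1, a =>
    if halt (T.step a) then some (T.step a, VDiagram.turn2 a.2 (T.step a).2) else
      match T.arrive (T.step a) with
      | none => some (T.step a, VDiagram.turn2 a.2 (T.step a).2)
      | some a' => (trace halt k a').map fun r =>
          (r.1, VDiagram.turn2 a.2 (T.step a).2 + T.val (T.step a) + r.2)

variable (h : T.Valid) (O : Outside)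

/-- The edges of the closure which meet the tangle. -/
def edge : (Fin n × Bool) ⊕ Fin 3 → (T.closure h O).V × Bool :=
  Sum.elim (fun p => T.port h O (.inl p)) fun j => T.port h O (T.out (O.link.symm (.inr j)))

theorem next_edge_inr (j : Fin 3) :
    (T.closure h O).next (T.edge h O (.inr j)) = T.port h O (.inl (T.first j)) := by
  simp only [edge, Sum.elim_inr, next_port, Code.join_out, Equiv.apply_symm_apply]
  rfl

theorem symm_port_inl (p : Fin n × Bool) :
    (T.closure h O).next.symm (T.port h O (.inl p)) = T.edge h O (T.back p) := by
  rcases hb : T.back p with q | j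
  · rw [symm_port, Code.join_symm_inl _ _ h hb]; rfl
  · rw [Equiv.symm_apply_eq, next_edge_inr, (h.2.2 p j).1 hb]

/-- The lines of the closure along edges which meet the tangle. -/
def line (g : ((Fin n × Bool) ⊕ Fin 3) × Fin 3) : (T.closure h O).Germ := (T.edge h O g.1, g.2)

theorem arrival_line {g : ((Fin n × Bool) ⊕ Fin 3) × Fin 3} {a : (Fin n × Bool) × Fin 3}
    (ha : T.arrive g = some a) :
    (T.closure h O).arrival (T.line h O g) = (T.port h O (.inl a.1), a.2) := by
  obtain ⟨e | j, l⟩ := g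
  · simp only [arrive] at ha
    split_ifs at ha with hl
    · cases ha; simp [VDiagram.arrival, line, hl, edge]
    · split at ha
      · rename_i q hq
        cases ha
        simp [VDiagram.arrival, line, hl, edge, next_port, Code.join_inl _ _ h hq]
      · cases ha
  · simp only [arrive] at ha
    split_ifs at ha with hl
    cases ha
    simp [VDiagram.arrival, line, hl, next_edge_inr]

theorem depart_mk (D : VDiagram) (v : D.V) (b : Bool) (l : Fin 3) {c : Bool × Fin 3}
    (hc : VDiagram.corner (D.kind v) b l = c) :
    D.depart ((v, b), l) = (if c.2 = 2 then D.next.symm (v, c.1) else (v, c.1), c.2) := by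
  subst hc; rfl

theorem step_mk (i : Fin n) (b : Bool) (l : Fin 3) {c : Bool × Fin 3}
    (hc : VDiagram.corner (T.sign i) b l = c) :
    T.step ((i, b), l) = (if c.2 = 2 then T.back (i, c.1) else .inl (i, c.1), c.2) := by
  subst hc; rfl

theorem depart_port (a : (Fin n × Bool) × Fin 3) :
    (T.closure h O).depart (T.port h O (.inl a.1), a.2) = T.line h O (T.step a) := by
  obtain ⟨⟨i, b⟩, l⟩ := a
  obtain ⟨⟨c, l'⟩, hc⟩ : ∃ c, VDiagram.corner (T.sign i) b l = c := ⟨_, rfl⟩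
  rw [port_inl, depart_mk _ _ _ _ ((congrArg (fun k => VDiagram.corner k b l)
    (T.kind_inl h O i)).trans hc), T.step_mk _ _ _ hc, line]
  by_cases hl : l' = 2
  · simp only [hl, if_true]
    exact Prod.ext (T.symm_port_inl h O (i, c)) rfl
  · simp only [hl, if_false]
    rfl

theorem succ_line {g : ((Fin n × Bool) ⊕ Fin 3) × Fin 3} {a : (Fin n × Bool) × Fin 3}
    (ha : T.arrive g = some a) :
    (T.closure h O).succ (T.line h O g) = T.line h O (T.step a) := by
  rw [VDiagram.succ_eq, arrival_line _ _ _ ha, depart_port]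

theorem weight_edge_inl {p q : Fin n × Bool} (hp : T.next p = .inl q) :
    (T.closure h O).weight (T.edge h O (.inl p)) = T.wt p := by
  simp only [edge, Sum.elim_inl, weight_port, Code.joinWt_inl _ _ _ _ _ hp]

/-- A line that leaves a crossing of the tangle and again arrives at one without going outside runs
along an inner edge. Its weight is then entirely the tangle's, so the rotation number can be
accumulated without knowing the outside. -/
theorem step_inner {a : (Fin n × Bool) × Fin 3} {a' : (Fin n × Bool) × Fin 3}
    (h : T.Valid) (ha : T.arrive (T.step a) = some a') :
    ∃ p q, (T.step a).1 = .inl p ∧ T.next p = .inl q := by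
  generalize hg : T.step a = g at ha ⊢
  unfold step at hg
  dsimp only at hg
  obtain ⟨e | j, l⟩ := g
  · refine ⟨e, ?_⟩
    simp only [arrive] at ha
    split_ifs at ha with hl
    · simp only [hl, Prod.mk.injEq] at hg
      obtain ⟨h1, h2⟩ := hg
      rw [if_pos h2] at h1
      exact ⟨_, rfl, (h.1 _ _).2 h1⟩
    · split at ha
      · rename_i q hq
        exact ⟨q, rfl, hq⟩
      · cases ha
  · simp only [arrive] at ha
    split_ifs at ha with hl
    simp only [Prod.mk.injEq] at hg
    obtain ⟨h1, h2⟩ := hg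
    rw [if_neg (h2 ▸ hl)] at h1
    cases h1

/-- The strand at whose end a line leaves the tangle. -/
def label (g : ((Fin n × Bool) ⊕ Fin 3) × Fin 3) : Fin 3 × Fin 3 :=
  (match g.1 with
    | .inl p => match T.next p with
      | .inl _ => 0
      | .inr j => j
    | .inr j => j, g.2)

/-- The line along which one leaves the tangle at an end of strand `j`. -/
def exit (j l : Fin 3) : ((Fin n × Bool) ⊕ Fin 3) × Fin 3 :=
  (if l = 2 then .inr j else .inl (T.last j), l)

theorem eq_exit {a : (Fin n × Bool) × Fin 3} (h : T.Valid) (ha : T.arrive (T.step a) = none) :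
    T.step a = T.exit (T.label (T.step a)).1 (T.label (T.step a)).2 := by
  generalize hg : T.step a = g at ha ⊢
  obtain ⟨e | j, l⟩ := g
  · simp only [arrive] at ha
    split_ifs at ha with hl
    split at ha
    · cases ha
    · rename_i j hj
      have h1 : T.label (.inl e, l) = (j, l) := by simp [label, hj]
      rw [h1, exit, if_neg hl, (h.2.1 _ _).1 hj]
  · simp only [arrive] at ha
    split_ifs at ha with hl
    subst hl
    rfl

/-- This carries the finite computation `trace` over to closures: the corner rules and the inner
edges are independent of the outside. The initial line `z` is arbitrary except for the end where it
arrives, so that it may come from outside. The bound on intermediate lines gives both that they are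
inner, needed for first returns, and that `halt` failed on them, needed for minimal periods. -/
theorem trace_spec (halt : ((Fin n × Bool) ⊕ Fin 3) × Fin 3 → Bool) (k : ℕ) :
    ∀ (a : (Fin n × Bool) × Fin 3) (g : ((Fin n × Bool) ⊕ Fin 3) × Fin 3) (s : ℤ),
      T.trace halt k a = some (g, s) →
      (halt g = true ∨ g = T.exit (T.label g).1 (T.label g).2) ∧
      ∀ z : (T.closure h O).Germ,
      (T.closure h O).arrival z = (T.port h O (.inl a.1), a.2) →
      ∃ m, 0 < m ∧ (T.closure h O).succ^[m] z = T.line h O g ∧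
        (∀ i, 0 < i → i < m → ∃ p q l, (T.closure h O).succ^[i] z = T.line h O (.inl p, l) ∧
          T.next p = .inl q ∧ halt (.inl p, l) = false) ∧
        ∑ i ∈ range m, (T.closure h O).rot2 ((T.closure h O).succ^[i] z) =
          2 * (T.closure h O).along z + s := by
  induction k with
  | zero => intro a g s hs; simp [trace] at hs
  | succ k ih =>
    intro a g s hs
    have hsucc : ∀ z : (T.closure h O).Germ,
        (T.closure h O).arrival z = (T.port h O (.inl a.1), a.2) →
        (T.closure h O).succ z = T.line h O (T.step a) := by
      intro z hz
      rw [VDiagram.succ_eq, hz, depart_port]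
    have hrot : ∀ z : (T.closure h O).Germ,
        (T.closure h O).arrival z = (T.port h O (.inl a.1), a.2) →
        (T.closure h O).rot2 z = 2 * (T.closure h O).along z +
          VDiagram.turn2 a.2 (T.step a).2 := by
      intro z hz
      have h2 : z.2 = a.2 := congrArg Prod.snd hz
      rw [VDiagram.rot2, hsucc z hz, h2]; rfl
    have hone : (∀ z : (T.closure h O).Germ,
        (T.closure h O).arrival z = (T.port h O (.inl a.1), a.2) →
        ∃ m, 0 < m ∧ (T.closure h O).succ^[m] z = T.line h O (T.step a) ∧
        (∀ i, 0 < i → i < m → ∃ p q l, (T.closure h O).succ^[i] z = T.line h O (.inl p, l) ∧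
          T.next p = .inl q ∧ halt (.inl p, l) = false) ∧
        ∑ i ∈ range m, (T.closure h O).rot2 ((T.closure h O).succ^[i] z) =
          2 * (T.closure h O).along z + VDiagram.turn2 a.2 (T.step a).2) := by
      intro z hz
      refine ⟨1, one_pos, hsucc z hz, fun i _ _ => by omega, ?_⟩
      rw [sum_range_one, iterate_zero, id_eq, hrot z hz]
    unfold trace at hs
    split_ifs at hs with h1
    · simp only [Option.some.injEq, Prod.mk.injEq] at hs
      obtain ⟨rfl, rfl⟩ := hs
      exact ⟨.inl h1, hone⟩
    · split at hs
      · rename_i h2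
        simp only [Option.some.injEq, Prod.mk.injEq] at hs
        obtain ⟨rfl, rfl⟩ := hs
        exact ⟨.inr (T.eq_exit h h2), hone⟩
      · rename_i a' h2
        simp only [Option.map_eq_some_iff, Prod.mk.injEq] at hs
        obtain ⟨⟨g', s'⟩, h3, rfl, rfl⟩ := hs
        obtain ⟨i1, i2⟩ := ih a' g' s' h3
        refine ⟨i1, fun z hz => ?_⟩
        obtain ⟨m, j1, j2, j3, j4⟩ := i2 (T.line h O (T.step a)) (T.arrival_line h O h2)
        obtain ⟨p, q, hp, hq⟩ := T.step_inner h h2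
        refine ⟨m + 1, by omega, ?_, ?_, ?_⟩
        · rw [iterate_succ_apply, hsucc z hz, j2]
        · intro i k1 k2
          obtain ⟨i, rfl⟩ : ∃ i', i = i' + 1 := ⟨i - 1, by omega⟩
          rw [iterate_succ_apply, hsucc z hz]
          rcases Nat.eq_zero_or_pos i with rfl | hi
          · refine ⟨p, q, (T.step a).2, ?_, hq, ?_⟩
            · rw [iterate_zero, id_eq, ← hp]
            · rw [← hp]; simpa using h1
          · exact j3 i hi (by omega)
        · rw [sum_range_succ']
          simp only [iterate_succ_apply, hsucc z hz, iterate_zero, id_eq]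
          rw [j4, hrot z hz]
          have hv : 2 * (T.closure h O).along (T.line h O (T.step a)) = T.val (T.step a) := by
            simp only [VDiagram.along, line, val, hp, weight_edge_inl T h O hq, Sum.elim_inl]
          rw [hv]
          ring

/-! ### Transfer of framings between tangles -/

/-- The line along which one enters the tangle at an end of strand `j`. -/
def entry (j l : Fin 3) : ((Fin n × Bool) ⊕ Fin 3) × Fin 3 :=
  (if l = 2 then .inl (T.last j) else .inr j, l)

/-- How a line that enters the tangle leaves it, and twice the rotation number in between. -/
def through (j l : Fin 3) : Option ((Fin 3 × Fin 3) × ℤ) :=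
  (T.trace (fun _ => false) 32 (if l = 2 then T.last j else T.first j, l)).map fun r =>
    (T.label r.1, T.val (T.entry j l) + r.2 + T.val r.1)

/-- Follow the line along an inner edge until one returns or leaves the tangle. -/
def loop (p : Fin n × Bool) (l : Fin 3) : Option ((((Fin n × Bool) ⊕ Fin 3) × Fin 3) × ℤ) :=
  (T.arrive (.inl p, l)).bind (T.trace (fun g => g = (.inl p, l)) 32)

/-- The rotation number along each `2`-cell contained in the tangle is `-1`. -/
abbrev LoopsFramed : Prop := ∀ p l, (T.next p).isLeft → (T.loop p l).isSome ∧
  ∀ r ∈ T.loop p l, r.1 = (.inl p, l) → T.val r.1 + r.2 = -2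

/-- A line of the closure along an edge which is not an inner edge of the tangle. -/
def outer (y : ((O.W × Bool) ⊕ Fin 3) × Fin 3) : (T.closure h O).Germ :=
  (T.port h O (T.out y.1), y.2)

theorem out_injective (h : T.Valid) {X : Type} : Injective (T.out : X ⊕ Fin 3 → _) := by
  rintro (x | j) (x' | j') e
  · exact congrArg _ (Sum.inr_injective e)
  · cases e
  · cases e
  · have e' : T.last j = T.last j' := Sum.inl_injective e
    have := (h.2.1 _ _).2 e'
    rw [(h.2.1 _ _).2 rfl] at this
    exact congrArg _ (Sum.inr_injective this)

theorem outer_injective : Injective (T.outer h O) := by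
  rintro ⟨y, l⟩ ⟨y', l'⟩ e
  obtain ⟨e1, e2⟩ := Prod.mk.inj e
  exact Prod.ext (T.out_injective h ((T.port h O).injective e1)) e2

theorem line_notMem_range_outer {p q : Fin n × Bool} (hp : T.next p = .inl q) (l : Fin 3) :
    T.line h O (.inl p, l) ∉ Set.range (T.outer h O) := by
  rintro ⟨⟨x | j, l'⟩, e⟩
  · have := (T.port h O).injective (congrArg Prod.fst e)
    cases this
  · have := (T.port h O).injective (congrArg Prod.fst e)
    have h1 : T.last j = p := Sum.inl_injective this
    rw [← h1, (h.2.1 _ _).2 rfl] at hp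
    cases hp

/-- The end at which a line outside of the tangle arrives. -/
def outArrive (y : ((O.W × Bool) ⊕ Fin 3) × Fin 3) : (O.W × Bool) ⊕ Fin 3 :=
  if y.2 = 2 then y.1 else O.link y.1

/-- The line outside of the tangle that starts at an end. -/
def outDepart (z : (O.W × Bool) ⊕ Fin 3) (l : Fin 3) : ((O.W × Bool) ⊕ Fin 3) × Fin 3 :=
  (if l = 2 then O.link.symm z else z, l)

/-- The end from which a line outside of the tangle starts. -/
def outStart (y : ((O.W × Bool) ⊕ Fin 3) × Fin 3) : (O.W × Bool) ⊕ Fin 3 :=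
  if y.2 = 2 then O.link y.1 else y.1

theorem outStart_outDepart (z : (O.W × Bool) ⊕ Fin 3) (l : Fin 3) :
    outStart O (outDepart O z l) = z := by
  unfold outStart outDepart
  by_cases hl : l = 2 <;> simp [hl]

variable (F : Fin 3 → Fin 3 → (Fin 3 × Fin 3) × ℤ)

/-- The first return map to the lines outside of the tangle, where `F` describes the lines in the
tangle. -/
def outSucc (y : ((O.W × Bool) ⊕ Fin 3) × Fin 3) : ((O.W × Bool) ⊕ Fin 3) × Fin 3 :=
  match outArrive O y with
  | .inl x => outDepart O (.inl (x.1, (VDiagram.corner (O.kind x.1) x.2 y.2).1))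
      (VDiagram.corner (O.kind x.1) x.2 y.2).2
  | .inr j => outDepart O (.inr (F j y.2).1.1) (F j y.2).1.2

/-- Twice the rotation number until the return to the outside of the tangle. -/
def outRot (y : ((O.W × Bool) ⊕ Fin 3) × Fin 3) : ℤ :=
  2 * (if y.2 = 2 then -O.weight y.1 else O.weight y.1) +
    match outArrive O y with
    | .inl x => VDiagram.turn2 y.2 (VDiagram.corner (O.kind x.1) x.2 y.2).2
    | .inr j => (F j y.2).2

/-- Twice the contribution of the weight of the tangle at the beginning of a line. -/
def potential (y : ((O.W × Bool) ⊕ Fin 3) × Fin 3) : ℤ :=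
  Sum.elim (fun _ => 0) (fun j => T.val (T.exit j y.2)) (outStart O y)

theorem line_exit (j l : Fin 3) : T.line h O (T.exit j l) = T.outer h O (outDepart O (.inr j) l) := by
  unfold line exit outer outDepart
  by_cases hl : l = 2
  · simp only [hl, if_true]; rfl
  · simp only [hl, if_false]; rfl

theorem depart_inr (x : O.W × Bool) (l : Fin 3) :
    (T.closure h O).depart (T.port h O (.inr x), l) =
      T.outer h O (outDepart O (.inl (x.1, (VDiagram.corner (O.kind x.1) x.2 l).1))
        (VDiagram.corner (O.kind x.1) x.2 l).2) := by
  obtain ⟨x, b⟩ := x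
  obtain ⟨⟨c, l'⟩, hc⟩ : ∃ c, VDiagram.corner (O.kind x) b l = c := ⟨_, rfl⟩
  rw [port_inr, depart_mk _ _ _ _ ((congrArg (fun k => VDiagram.corner k b l)
    (T.kind_inr h O x)).trans hc)]
  simp only [hc, outer, outDepart]
  by_cases hl : l' = 2
  · simp only [hl, if_true]
    refine Prod.ext ?_ rfl
    exact (T.symm_port h O (.inr (x, c))).trans
      (congrArg _ (T.join_symm_inn O.link h (.inl (x, c))))
  · simp only [hl, if_false]
    rfl

/-- An outer edge may contain an open end of the tangle at its start, at its end, or at both; its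
weight has one summand for each of these and one for the outside. -/
theorem two_along_outer (y : ((O.W × Bool) ⊕ Fin 3) × Fin 3) :
    2 * (T.closure h O).along (T.outer h O y) =
      2 * (if y.2 = 2 then -O.weight y.1 else O.weight y.1) + T.potential O y +
        Sum.elim (fun _ => 0) (fun j => T.val (T.entry j y.2)) (outArrive O y) := by
  obtain ⟨y, l⟩ := y
  simp only [VDiagram.along, outer, weight_port, Code.joinWt_out _ _ _ _ _ h, potential, outStart,
    outArrive]
  by_cases hl : l = 2
  · subst hl
    simp only [if_true, val, exit, entry]
    rcases y with x | j <;> rcases O.link _ with x' | j' <;> simp <;> ring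
  · simp only [hl, if_false, val, exit, entry]
    rcases y with x | j <;> rcases O.link _ with x' | j' <;> simp <;> ring

theorem arrival_outer (y : ((O.W × Bool) ⊕ Fin 3) × Fin 3) :
    (T.closure h O).arrival (T.outer h O y) = match outArrive O y with
      | .inl x => (T.port h O (.inr x), y.2)
      | .inr j => (T.port h O (.inl (if y.2 = 2 then T.last j else T.first j)), y.2) := by
  obtain ⟨y, l⟩ := y
  simp only [VDiagram.arrival, outer, outArrive]
  by_cases hl : l = 2
  · simp only [hl, if_true]
    rcases y with x | j <;> rfl
  · simp only [hl, if_false, next_port, Code.join_out]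
    rcases O.link y with x | j <;> rfl

/-- One step of the first return map is a corner outside or a passage through the tangle. In
`through` the weight of the exit edge belongs to the passage, while the diagram counts it with the
following outer line. The mismatch is the difference of `potential` at consecutive lines and cancels
around a cell. -/
theorem outer_spec {T : Tangle n} (h : T.Valid) (hF : ∀ j l, T.through j l = some (F j l))
    (y : ((O.W × Bool) ⊕ Fin 3) × Fin 3) :
    ∃ m, 0 < m ∧ (T.closure h O).succ^[m] (T.outer h O y) = T.outer h O (outSucc O F y) ∧
      (∀ i, 0 < i → i < m →
        (T.closure h O).succ^[i] (T.outer h O y) ∉ Set.range (T.outer h O)) ∧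
      ∑ i ∈ range m, (T.closure h O).rot2 ((T.closure h O).succ^[i] (T.outer h O y)) =
        outRot O F y + ((-T.potential O (outSucc O F y)) - (-T.potential O y)) := by
  have harr := T.arrival_outer h O y
  have hal := T.two_along_outer h O y
  have hrot : (T.outer h O y).2 = y.2 := rfl
  unfold outSucc outRot
  rcases hz : outArrive O y with x | j
  · rw [hz] at harr hal
    have h1 := (VDiagram.succ_eq _ (T.outer h O y)).trans
      ((congrArg _ harr).trans (T.depart_inr h O x y.2))
    refine ⟨1, one_pos, h1, fun i _ _ => by omega, ?_⟩
    rw [sum_range_one, iterate_zero, id_eq, VDiagram.rot2, hal, h1]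
    simp only [potential, outStart_outDepart, Sum.elim_inl, hrot]
    simp only [outer, outDepart]
    ring
  · rw [hz] at harr hal
    have hj := hF j y.2
    simp only [through, Option.map_eq_some_iff] at hj
    obtain ⟨⟨g, s⟩, h1, h2⟩ := hj
    obtain ⟨h3, h4⟩ := T.trace_spec h O _ _ _ _ _ h1
    obtain ⟨m, h5, h6, h7, h8⟩ := h4 _ harr
    have hg : g = T.exit (F j y.2).1.1 (F j y.2).1.2 := by
      rcases h3 with h3 | h3
      · cases h3
      · rw [← h2]; exact h3
    refine ⟨m, h5, ?_, ?_, ?_⟩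
    · rw [h6, hg, line_exit]
    · intro i i1 i2
      obtain ⟨p, q, l, e, hp, -⟩ := h7 i i1 i2
      rw [e]
      exact T.line_notMem_range_outer h O hp l
    · rw [h8, hal]
      simp only [potential, outStart_outDepart, Sum.elim_inr]
      have h9 : T.val (T.exit (F j y.2).1.1 (outDepart O (.inr (F j y.2).1.1) (F j y.2).1.2).2) =
        T.val g := by rw [hg]; rfl
      rw [h9, ← h2]
      simp only
      ring

theorem outSucc_injective {T : Tangle n} (h : T.Valid) (hF : ∀ j l, T.through j l = some (F j l)) :
    Injective (outSucc O F) :=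
  injective_of_induced (T.closure h O).succ_injective (T.outer_injective h O) fun y => by
    obtain ⟨m, h1, h2, h3, -⟩ := outer_spec O F h hF y
    exact ⟨m, h1, h2, h3⟩

theorem cycleSum_outer {T : Tangle n} (h : T.Valid) (hF : ∀ j l, T.through j l = some (F j l))
    (y : ((O.W × Bool) ⊕ Fin 3) × Fin 3) :
    cycleSum (T.closure h O).succ (T.closure h O).rot2 (T.outer h O y) =
      cycleSum (outSucc O F) (outRot O F) y := by
  have := O.fin
  rw [cycleSum_induced _ (outSucc O F) (T.outer h O) (T.outer_injective h O) _ _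
    (outer_spec O F h hF) y ((outSucc_injective O F h hF).mem_periodicPts y)]
  exact cycleSum_add_coboundary (outSucc O F) (outRot O F) (fun y => -T.potential O y) y

/-- Both closures induce the same first return map with the same rotation contributions on the outer
lines. So cells which meet the outside keep their rotation number, and the remaining cells lie in
`T'` and are covered by `LoopsFramed`. -/
theorem framed_of_through {n' : ℕ} {T : Tangle n} {T' : Tangle n'} (h : T.Valid) (h' : T'.Valid)
    (O : Outside) (ht : ∀ j l, (T.through j l).isSome ∧ T.through j l = T'.through j l)
    (hl : T'.LoopsFramed) (hT : (T.closure h O).Framed) : (T'.closure h' O).Framed := by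
  rw [VDiagram.framed_iff] at hT ⊢
  have hF : ∀ j l, T.through j l = some ((T.through j l).get (ht j l).1) := fun j l => by simp
  have hF' : ∀ j l, T'.through j l = some ((T.through j l).get (ht j l).1) := fun j l =>
    (ht j l).2.symm.trans (hF j l)
  have hout : ∀ y, cycleSum (T'.closure h' O).succ (T'.closure h' O).rot2 (T'.outer h' O y) = -2 := by
    intro y
    rw [cycleSum_outer O _ h' hF' y, ← cycleSum_outer O _ h hF y, hT]
  rintro ⟨s, l⟩
  obtain ⟨s, rfl⟩ := (T'.port h' O).surjective s
  rcases s with p | x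
  · rcases hp : T'.next p with q | j
    · obtain ⟨hs, hs'⟩ := hl p l (by rw [hp]; rfl)
      obtain ⟨⟨g, s⟩, hr⟩ := Option.isSome_iff_exists.1 hs
      have hs' := hs' _ hr
      simp only [loop, Option.bind_eq_some_iff] at hr
      obtain ⟨a, h1, h2⟩ := hr
      obtain ⟨h3, h4⟩ := T'.trace_spec h' O _ _ _ _ _ h2
      obtain ⟨m, h5, h6, h7, h8⟩ := h4 _ (T'.arrival_line h' O h1)
      have hz : (T'.port h' O (.inl p), l) = T'.line h' O (.inl p, l) := rfl
      rw [hz]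
      by_cases hg : g = (.inl p, l)
      · have hv : 2 * (T'.closure h' O).along (T'.line h' O (.inl p, l)) = T'.val (.inl p, l) := by
          simp only [VDiagram.along, line, val, weight_edge_inl T' h' O hp, Sum.elim_inl]
        rw [hv, ← hg, hs' hg] at h8
        rw [hg] at h6 h8
        -- The trace was stopped at the first return to the starting line, since `halt` was false on
        -- all lines before.
        have hm : minimalPeriod (T'.closure h' O).succ (T'.line h' O (.inl p, l)) = m := by
          refine le_antisymm (IsPeriodicPt.minimalPeriod_le h5 h6) (not_lt.1 fun hlt => ?_)
          obtain ⟨p', q', l', e, -, e'⟩ := h7 _ (minimalPeriod_pos_of_mem_periodicPts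
            (VDiagram.mem_periodicPts_succ _ _)) hlt
          rw [iterate_minimalPeriod] at e
          obtain ⟨e1, e2⟩ := Prod.mk.inj e
          have e3 : p = p' := Sum.inl_injective ((T'.port h' O).injective e1)
          simp only at e2
          subst e2 e3
          simp at e'
        rw [cycleSum, hm, h8]
      -- The line escapes from the tangle, so its cell contains an outer line and is already known
      -- to be framed.
      · have h3 : g = T'.exit (T'.label g).1 (T'.label g).2 := by simpa [hg] using h3
        rw [← cycleSum_iterate _ _ (VDiagram.mem_periodicPts_succ _) _ m, h6, h3, line_exit, hout]
    · have := hout (.inr j, l)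
      rwa [outer, show T'.out (Sum.inr j : (O.W × Bool) ⊕ Fin 3) = .inl p from
        congrArg _ ((h'.2.1 _ _).1 hp).symm] at this
  · exact hout (.inl x, l)

/-- Follow an edge outside: up to the first entry into the tangle both closures agree, and an entry
into `T'` meets a real crossing at once. -/
theorem noFreeCircle_of_closure {n' : ℕ} {T : Tangle n} {T' : Tangle n'} (h : T.Valid) (h' : T'.Valid)
    (O : Outside) (hs : ∀ i, T'.sign i ≠ 0) (hT : (T.closure h O).NoFreeCircle) :
    (T'.closure h' O).NoFreeCircle := by
  have key : ∀ m (x : O.W × Bool),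
      (T.closure h O).kind ((T.closure h O).next^[m] (T.port h O (.inr x))).1 ≠ 0 →
      ∃ m', (T'.closure h' O).kind ((T'.closure h' O).next^[m'] (T'.port h' O (.inr x))).1 ≠ 0 := by
    intro m
    induction m with
    | zero => exact fun x hx => ⟨0, hx⟩
    | succ m ih =>
      intro x hx
      rw [iterate_succ_apply, show (T.closure h O).next (T.port h O (.inr x)) =
        T.port h O (T.inn (O.link (.inl x))) from T.next_port h O _] at hx
      have h2 : (T'.closure h' O).next (T'.port h' O (.inr x)) =
        T'.port h' O (T'.inn (O.link (.inl x))) := T'.next_port h' O _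
      rcases hx' : O.link (.inl x) with x' | j
      · rw [hx'] at hx h2
        obtain ⟨m', h3⟩ := ih x' hx
        exact ⟨m' + 1, by rw [iterate_succ_apply, h2]; exact h3⟩
      · rw [hx'] at h2
        exact ⟨1, by rw [iterate_one, h2]; exact hs _⟩
  intro s
  obtain ⟨s, rfl⟩ := (T'.port h' O).surjective s
  rcases s with p | x
  · exact ⟨0, hs _⟩
  · obtain ⟨m, hm⟩ := hT (T.port h O (.inr x))
    exact key m x hm

/-- A condition under which the replacement of the tangle `T` by `T'` preserves framings. -/
abbrev Similar {n' : ℕ} (T : Tangle n) (T' : Tangle n') : Prop :=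
  (∀ j l, (T.through j l).isSome ∧ T.through j l = T'.through j l) ∧ T'.LoopsFramed ∧
    ∀ i, T'.sign i ≠ 0

theorem Similar.fn {n' : ℕ} {T : Tangle n} {T' : Tangle n'} (hs : T.Similar T') (h : T.Valid)
    (h' : T'.Valid) {O : Outside} (hT : (T.closure h O).FN) : (T'.closure h' O).FN :=
  ⟨noFreeCircle_of_closure h h' O hs.2.2 hT.1, framed_of_through h h' O hs.1 hs.2.1 hT.2⟩

end Tangle

/-! ### Closures up to isomorphism -/

/-- The weighted tangle with given Gauss code; the open edges at the beginning of the strands have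
weight zero. -/
def OTangle.toTangle {n : ℕ} (T : OTangle n) : Tangle n where
  first := T.first
  rest := T.rest
  sign := T.sign
  wt := T.wt
  win := fun _ => 0

/-- Each outgoing end is either followed by another passage of its strand or is an end of the
outside or of a strand, so the clauses of `IsClosure` determine the whole diagram. -/
theorem IsClosure.iso {n : ℕ} {T : OTangle n} {O : Outside} {D : VDiagram} {φ : Fin n ⊕ O.W ≃ D.V}
    (hD : IsClosure T O D φ) (h : T.toTangle.Valid) : VDiagram.Iso (T.toTangle.closure h O) D := by
  have hpt : ∀ s, ((φ ((T.toTangle.vert h O).symm (T.toTangle.port h O s).1),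
      (T.toTangle.port h O s).2) : D.V × Bool) =
      Sum.elim (fun p => (φ (.inl p.1), p.2)) (fun x => (φ (.inr x.1), x.2)) s := by
    rintro (p | x) <;> rfl
  have hout : ∀ y : (O.W × Bool) ⊕ Fin 3, (Sum.elim (fun p => (φ (.inl p.1), p.2)) (fun x => (φ (.inr x.1), x.2))
      (T.toTangle.out y) : D.V × Bool) = Sum.elim (fun s => (φ (.inr s.1), s.2))
        (fun j => (φ (.inl (T.last j).1), (T.last j).2)) y := by
    rintro (x | j) <;> rfl
  have hinn : ∀ y : (O.W × Bool) ⊕ Fin 3, (Sum.elim (fun p => (φ (.inl p.1), p.2)) (fun x => (φ (.inr x.1), x.2))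
      (T.toTangle.inn y) : D.V × Bool) = Sum.elim (fun s => (φ (.inr s.1), s.2))
        (fun j => (φ (.inl (T.first j).1), (T.first j).2)) y := by
    rintro (x | j) <;> rfl
  have main : ∀ s, D.next (Sum.elim (fun p => (φ (.inl p.1), p.2)) (fun x => (φ (.inr x.1), x.2)) s) =
        Sum.elim (fun p => (φ (.inl p.1), p.2)) (fun x => (φ (.inr x.1), x.2))
          (T.toTangle.join h O.link s) ∧
      D.weight (Sum.elim (fun p => (φ (.inl p.1), p.2)) (fun x => (φ (.inr x.1), x.2)) s) =
        T.toTangle.joinWt O.link T.wt (fun _ => 0) O.weight s := by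
    have hy : ∀ y, D.next (Sum.elim (fun p => (φ (.inl p.1), p.2)) (fun x => (φ (.inr x.1), x.2))
          (T.toTangle.out y)) =
        Sum.elim (fun p => (φ (.inl p.1), p.2)) (fun x => (φ (.inr x.1), x.2))
          (T.toTangle.join h O.link (T.toTangle.out y)) ∧
      D.weight (Sum.elim (fun p => (φ (.inl p.1), p.2)) (fun x => (φ (.inr x.1), x.2))
          (T.toTangle.out y)) =
        T.toTangle.joinWt O.link T.wt (fun _ => 0) O.weight (T.toTangle.out y) := by
      intro y
      rw [Code.join_out, Code.joinWt_out _ _ _ _ _ h, hout, hinn]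
      refine ⟨hD.next_out y, (hD.weight_out y).trans ?_⟩
      rcases O.link y with x | j <;> exact (add_zero _).symm
    rintro (p | x)
    · rcases hp : T.toTangle.next p with q | j
      · obtain ⟨j, hj⟩ := Code.infix_of_next hp
        rw [Code.join_inl _ _ h hp, Code.joinWt_inl _ _ _ _ _ hp]
        exact ⟨hD.next_in j p q hj, hD.weight_in j p q hj⟩
      · have := (h.2.1 _ _).1 hp
        rw [this]
        exact hy (.inr j)
    · exact hy (.inl x)
  refine ⟨(T.toTangle.vert h O).symm.trans φ, ?_, ?_, ?_⟩
  · rintro (i | x)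
    · exact hD.kind_in i
    · exact hD.kind_out x
  · rintro v b
    obtain ⟨s, hs⟩ := (T.toTangle.port h O).surjective (v, b)
    have h1 := hpt s
    rw [hs] at h1
    have h2 := hpt (T.toTangle.join h O.link s)
    rw [← Tangle.next_port, hs] at h2
    exact (congrArg _ h1).trans ((main s).1.trans h2.symm)
  · rintro v b
    obtain ⟨s, hs⟩ := (T.toTangle.port h O).surjective (v, b)
    have h1 := hpt s
    rw [hs] at h1
    rw [← hs, Tangle.weight_port]
    exact (congrArg _ h1).trans (main s).2

theorem OTangle.isClosure {n : ℕ} (T : OTangle n) (h : T.toTangle.Valid)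
    (hT : ∀ j p q, [p, q] <:+: T.first j :: T.rest j → T.toTangle.next p = .inl q) (O : Outside) :
    IsClosure T O (T.toTangle.closure h O) (T.toTangle.vert h O) where
  kind_in _ := rfl
  kind_out _ := rfl
  next_in j p q hpq := (T.toTangle.next_port h O (.inl p)).trans
    (congrArg _ (Code.join_inl _ _ h (hT j p q hpq)))
  weight_in j p q hpq := (T.toTangle.weight_port h O (.inl p)).trans
    (Code.joinWt_inl _ _ _ _ _ (hT j p q hpq))
  next_out y := by
    have h1 : ∀ y, T.toTangle.port h O (T.toTangle.out y) =
        Sum.elim (fun s => (T.toTangle.vert h O (.inr s.1), s.2))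
          (fun j => (T.toTangle.vert h O (.inl (T.last j).1), (T.last j).2)) y := by
      rintro (x | j) <;> rfl
    have h2 : ∀ y, T.toTangle.port h O (T.toTangle.inn y) =
        Sum.elim (fun s => (T.toTangle.vert h O (.inr s.1), s.2))
          (fun j => (T.toTangle.vert h O (.inl (T.first j).1), (T.first j).2)) y := by
      rintro (x | j) <;> rfl
    rw [← h1, ← h2, Tangle.next_port, Code.join_out]
  weight_out y := by
    have h1 : ∀ y, T.toTangle.port h O (T.toTangle.out y) =
        Sum.elim (fun s => (T.toTangle.vert h O (.inr s.1), s.2))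
          (fun j => (T.toTangle.vert h O (.inl (T.last j).1), (T.last j).2)) y := by
      rintro (x | j) <;> rfl
    rw [← h1, Tangle.weight_port, Code.joinWt_out _ _ _ _ _ h]
    rcases O.link y with x | j <;> exact add_zero _

namespace Tangle

variable {n : ℕ}

/-! ### H-moves at the crossings of a tangle -/

/-- Add the coboundary of a `0`-cochain on the crossings to the weights. -/
def gauge (T : Tangle n) (f : Fin n → ℤ) : Tangle n :=
  { T with
    wt := fun p => T.wt p + Sum.elim (fun q => f q.1) (fun _ => 0) (T.next p) - f p.1
    win := fun j => T.win j + f (T.first j).1 }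

/-- Extend a function on the crossings of a tangle by zero to the closure. -/
def extend (T : Tangle n) (f : Fin n → ℤ) (h : T.Valid) (O : Outside) (v : (T.closure h O).V) : ℤ :=
  Sum.elim f (fun _ => 0) ((T.vert h O).symm v)

theorem extend_out (T : Tangle n) (f : Fin n → ℤ) (h : T.Valid) (O : Outside)
    (y : (O.W × Bool) ⊕ Fin 3) : T.extend f h O (T.port h O (T.out y)).1 =
      Sum.elim (fun _ => 0) (fun j => f (T.last j).1) y := by
  rcases y with x | j <;> rfl

theorem extend_inn (T : Tangle n) (f : Fin n → ℤ) (h : T.Valid) (O : Outside)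
    (y : (O.W × Bool) ⊕ Fin 3) : T.extend f h O (T.port h O (T.inn y)).1 =
      Sum.elim (fun _ => 0) (fun j => f (T.first j).1) y := by
  rcases y with x | j <;> rfl

theorem extend_inl (T : Tangle n) (f : Fin n → ℤ) (h : T.Valid) (O : Outside)
    (p : Fin n × Bool) : T.extend f h O (T.port h O (.inl p)).1 = f p.1 := rfl

/-- The cochain vanishes outside, so on an open edge its coboundary sees only ends in the tangle.
These contributions are stored in `win` at the beginning and in `wt` at the end of a strand, and
they add up if both ends of an edge belong to the tangle. -/
theorem closure_gauge (T : Tangle n) (f : Fin n → ℤ) (h : T.Valid) (O : Outside) :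
    (T.gauge f).closure h O = (T.closure h O).gauge (T.extend f h O) := by
  have key : ∀ s, T.joinWt O.link (T.gauge f).wt (T.gauge f).win O.weight s =
      (T.closure h O).weight (T.port h O s) +
        T.extend f h O ((T.closure h O).next (T.port h O s)).1 -
        T.extend f h O (T.port h O s).1 := by
    intro s
    rw [weight_port, next_port]
    have hy : ∀ y, T.joinWt O.link (T.gauge f).wt (T.gauge f).win O.weight (T.out y) =
        T.joinWt O.link T.wt T.win O.weight (T.out y) +
          T.extend f h O (T.port h O (T.join h O.link (T.out y))).1 -
        T.extend f h O (T.port h O (T.out y)).1 := by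
      intro y
      rw [Code.join_out, Code.joinWt_out _ _ _ _ _ h, Code.joinWt_out _ _ _ _ _ h,
        extend_out, extend_inn]
      have h1 : ∀ j, (T.gauge f).wt (T.last j) = T.wt (T.last j) - f (T.last j).1 := fun j => by
        simp only [gauge, (h.2.1 _ j).2 rfl, Sum.elim_inr, add_zero]
      rcases y with x | j <;> rcases O.link _ with x' | j' <;>
        simp only [Sum.elim_inl, Sum.elim_inr, h1] <;>
        (try simp only [gauge]) <;> ring
    rcases s with p | x
    · rcases hp : T.next p with q | j
      · rw [Code.join_inl _ _ h hp, Code.joinWt_inl _ _ _ _ _ hp, Code.joinWt_inl _ _ _ _ _ hp,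
          extend_inl, extend_inl]
        simp only [gauge, hp, Sum.elim_inl]
      · rw [(h.2.1 _ _).1 hp]
        exact hy (.inr j)
    · exact hy (.inl x)
  refine congrArg (fun w => ({ T.closure h O with weight := w } : VDiagram)) (funext fun s => ?_)
  obtain ⟨s, rfl⟩ := (T.port h O).surjective s
  rw [← key]
  exact (T.gauge f).weight_port h O s

end Tangle

/-! ### Crossings which become part of the outside -/

/-- What surrounds a smaller tangle in a tangle with one more crossing: the strands of the larger
tangle run through the points `Sum.inl b`, the strands of the additional crossing, and
`Sum.inr j`, the strands of the smaller tangle. -/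
structure Annulus extends Code (Bool ⊕ Fin 3) where
  sign : SignType
  wt : Bool ⊕ Fin 3 → ℤ
  win : Fin 3 → ℤ

namespace Annulus

/-- The ends outside of the smaller tangle. -/
def ends (X : Type) : ((X ⊕ Unit) × Bool) ⊕ Fin 3 ≃ (Bool ⊕ Fin 3) ⊕ (X × Bool) where
  toFun := Sum.elim (fun s => Sum.elim (fun x => .inr (x, s.2)) (fun _ => .inl (.inl s.2)) s.1)
    fun j => .inl (.inr j)
  invFun := Sum.elim (Sum.elim (fun b => .inl (.inr (), b)) .inr) fun x => .inl (.inl x.1, x.2)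
  left_inv := by rintro (⟨x | ⟨⟩, b⟩ | j) <;> rfl
  right_inv := by rintro ((b | j) | ⟨x, b⟩) <;> rfl

variable (A : Annulus)

/-- The outside of the smaller tangle. -/
def outside (hA : A.Valid) (O : Outside) : Outside :=
  haveI := O.fin
  { W := O.W ⊕ Unit
    kind := Sum.elim O.kind fun _ => A.sign
    link := (ends O.W).trans ((A.join hA O.link).trans (ends O.W).symm)
    weight := fun y => A.joinWt O.link A.wt A.win O.weight (ends O.W y) }

/-- The ends of the outside of the smaller tangle. -/
def endsEquiv (hA : A.Valid) (O : Outside) :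
    ((A.outside hA O).W × Bool) ⊕ Fin 3 ≃ (Bool ⊕ Fin 3) ⊕ (O.W × Bool) := ends O.W

theorem link_endsEquiv (hA : A.Valid) (O : Outside) (z : (Bool ⊕ Fin 3) ⊕ (O.W × Bool)) :
    (A.outside hA O).link ((A.endsEquiv hA O).symm z) =
      (A.endsEquiv hA O).symm (A.join hA O.link z) :=
  congrArg (fun z => (ends O.W).symm (A.join hA O.link z)) ((ends O.W).apply_symm_apply z)

theorem weight_endsEquiv (hA : A.Valid) (O : Outside) (z : (Bool ⊕ Fin 3) ⊕ (O.W × Bool)) :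
    (A.outside hA O).weight ((A.endsEquiv hA O).symm z) = A.joinWt O.link A.wt A.win O.weight z :=
  congrArg (A.joinWt O.link A.wt A.win O.weight) ((ends O.W).apply_symm_apply z)

end Annulus

namespace Tangle

variable {k n : ℕ}

/-- The tangle `T` consists of the tangle `S` and of the annulus `A`; the function `e`
identifies the crossings. -/
structure IsGlue (A : Annulus) (S : Tangle k) (T : Tangle n) (e : Fin k ⊕ Unit → Fin n) : Prop where
  bij : Bijective e
  sign_inl : ∀ i, T.sign (e (.inl i)) = S.sign i
  sign_inr : T.sign (e (.inr ())) = A.sign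
  inner : ∀ p q, S.next p = .inl q → T.next (e (.inl p.1), p.2) = .inl (e (.inl q.1), q.2) ∧
    T.wt (e (.inl p.1), p.2) = S.wt p
  annulus : ∀ a,
    T.next (Sum.elim (fun b => (e (.inr ()), b)) (fun j => (e (.inl (S.last j).1), (S.last j).2)) a) =
      Sum.map (Sum.elim (fun b => (e (.inr ()), b))
        (fun j => (e (.inl (S.first j).1), (S.first j).2))) id (A.next a) ∧
    T.wt (Sum.elim (fun b => (e (.inr ()), b)) (fun j => (e (.inl (S.last j).1), (S.last j).2)) a) =
      Sum.elim (fun _ => 0) (fun j => S.wt (S.last j)) a + A.wt a +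
        Sum.elim (Sum.elim (fun _ => 0) S.win) (fun _ => 0) (A.next a)
  first : ∀ J, T.first J = Sum.elim (fun b => (e (.inr ()), b))
    (fun j => (e (.inl (S.first j).1), (S.first j).2)) (A.first J) ∧
    T.win J = A.win J + Sum.elim (fun _ => 0) S.win (A.first J)

/-- Gluing is associative: the annulus can be attached to the outside or to the inner tangle. An
edge leaving a point of the annulus either reaches another such point, hence is an inner edge of
`T`, or reaches the outer boundary and is continued by `O`. -/
theorem IsGlue.iso {A : Annulus} {S : Tangle k} {T : Tangle n} {e : Fin k ⊕ Unit → Fin n}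
    (H : IsGlue A S T e) (hA : A.Valid) (hS : S.Valid) (hT : T.Valid) (O : Outside) :
    VDiagram.Iso (S.closure hS (A.outside hA O)) (T.closure hT O) := by
  let ε : Fin k ⊕ Unit ≃ Fin n := Equiv.ofBijective e H.bij
  let φ : Fin k ⊕ (O.W ⊕ Unit) ≃ Fin n ⊕ O.W :=
    (Equiv.sumCongr (Equiv.refl _) (Equiv.sumComm _ _)).trans
      ((Equiv.sumAssoc _ _ _).symm.trans (Equiv.sumCongr ε (Equiv.refl _)))
  let Φ : (S.closure hS (A.outside hA O)).V ≃ (T.closure hT O).V :=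
    (S.vert hS (A.outside hA O)).symm.trans (φ.trans (T.vert hT O))
  let src : Bool ⊕ Fin 3 → Fin n × Bool :=
    Sum.elim (fun b => (e (.inr ()), b)) fun j => (e (.inl (S.last j).1), (S.last j).2)
  let tgt : Bool ⊕ Fin 3 → Fin n × Bool :=
    Sum.elim (fun b => (e (.inr ()), b)) fun j => (e (.inl (S.first j).1), (S.first j).2)
  let Ψ : (S.closure hS (A.outside hA O)).V × Bool → (T.closure hT O).V × Bool :=
    fun s => (Φ s.1, s.2)
  have hin : ∀ p, Ψ (S.port hS _ (.inl p)) = T.port hT O (.inl (e (.inl p.1), p.2)) := fun _ => rfl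
  have hsrc : ∀ z, Ψ (S.port hS _ (S.out ((A.endsEquiv hA O).symm z))) =
      T.port hT O (Sum.map src id z) := by
    rintro ((b | j) | x) <;> rfl
  have htgt : ∀ z, Ψ (S.port hS _ (S.inn ((A.endsEquiv hA O).symm z))) =
      T.port hT O (Sum.map tgt id z) := by
    rintro ((b | j) | x) <;> rfl
  have hinn : ∀ y : (O.W × Bool) ⊕ Fin 3, Sum.map tgt id (A.inn y) = T.inn y := by
    rintro (x | j)
    · rfl
    · exact congrArg Sum.inl (H.first j).1.symm
  have main : ∀ s, (T.closure hT O).next (Ψ s) = Ψ ((S.closure hS (A.outside hA O)).next s) ∧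
      (T.closure hT O).weight (Ψ s) = (S.closure hS (A.outside hA O)).weight s := by
    have hy : ∀ y, (T.closure hT O).next (Ψ (S.port hS _ (S.out y))) =
          Ψ ((S.closure hS (A.outside hA O)).next (S.port hS _ (S.out y))) ∧
        (T.closure hT O).weight (Ψ (S.port hS _ (S.out y))) =
          (S.closure hS (A.outside hA O)).weight (S.port hS _ (S.out y)) := by
      intro y
      obtain ⟨z, rfl⟩ := (A.endsEquiv hA O).symm.surjective y
      have hl := A.link_endsEquiv hA O z
      have hw := A.weight_endsEquiv hA O z
      rw [S.next_port, Code.join_out, hl, htgt, hsrc, next_port, weight_port, weight_port,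
        Code.joinWt_out _ _ _ _ _ hS, hl, hw]
      have e1 : ∀ z : (Bool ⊕ Fin 3) ⊕ (O.W × Bool),
          Sum.elim (fun _ => 0) (fun j => S.wt (S.last j)) ((A.endsEquiv hA O).symm z) =
          Sum.elim (Sum.elim (fun _ => 0) fun j => S.wt (S.last j)) (fun _ => 0) z := by
        rintro ((b | j) | x) <;> rfl
      have e2 : ∀ z : (Bool ⊕ Fin 3) ⊕ (O.W × Bool),
          Sum.elim (fun _ => 0) S.win ((A.endsEquiv hA O).symm z) =
          Sum.elim (Sum.elim (fun _ => 0) S.win) (fun _ => 0) z := by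
        rintro ((b | j) | x) <;> rfl
      have e3 : ∀ y : (O.W × Bool) ⊕ Fin 3, Sum.elim (fun _ => 0) T.win y =
          Sum.elim (fun _ => 0) A.win y +
            Sum.elim (Sum.elim (fun _ => 0) S.win) (fun _ => 0) (A.inn y) := by
        rintro (x | j)
        · rfl
        · exact (H.first j).2
      rw [e1, e2]
      have ho : ∀ y : (O.W × Bool) ⊕ Fin 3, Sum.map src id (A.out y) =
            Sum.elim (fun x => .inr x) (fun j => .inl (T.last j)) y →
          T.port hT O (T.join hT O.link (Sum.map src id (A.out y))) =
            T.port hT O (Sum.map tgt id (A.join hA O.link (A.out y))) := by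
        intro y h1
        rw [h1, Code.join_out, hinn, ← Code.join_out T.toCode O.link hT]
        rcases y with x | j <;> rfl
      rcases z with a | x
      · rcases ha : A.next a with a' | J
        · have h1 := (H.annulus a).1
          have h2 := (H.annulus a).2
          rw [ha] at h1 h2
          rw [Code.join_inl _ _ hA ha, Code.joinWt_inl _ _ _ _ _ ha]
          constructor
          · exact congrArg _ (Code.join_inl _ _ hT h1)
          · refine (Code.joinWt_inl _ _ _ _ _ h1).trans (h2.trans ?_)
            simp only [Sum.elim_inl]
            ring
        · have h1 := (H.annulus a).1
          have h2 := (H.annulus a).2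
          rw [ha] at h1 h2
          have h3 : src a = T.last J := (hT.2.1 _ _).1 h1
          have h4 : (Sum.inl a : (Bool ⊕ Fin 3) ⊕ (O.W × Bool)) = A.out (.inr J) :=
            congrArg _ ((hA.2.1 _ _).1 ha)
          constructor
          · rw [h4]
            refine ho _ ?_
            rw [← h4]
            exact congrArg Sum.inl h3
          · have h5 : (Sum.map src id (Sum.inl a) : _ ⊕ (O.W × Bool)) = T.out (.inr J) :=
              congrArg Sum.inl h3
            rw [h5, Code.joinWt_out _ _ _ _ _ hT, e3]
            rw [h4, Code.join_out, Code.joinWt_out _ _ _ _ _ hA, ← h4]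
            have h6 : A.wt a = A.wt (A.last J) := congrArg _ ((hA.2.1 _ _).1 ha)
            simp only [Sum.elim_inr, Sum.elim_inl, ← h3] at h2 ⊢
            rw [h2, h6]
            ring
      · constructor
        · exact ho (.inl x) rfl
        · rw [show (Sum.map src id (Sum.inr x) : _ ⊕ (O.W × Bool)) = T.out (.inl x) from rfl,
            Code.joinWt_out _ _ _ _ _ hT, e3,
            show (Sum.inr x : (Bool ⊕ Fin 3) ⊕ (O.W × Bool)) = A.out (.inl x) from rfl,
            Code.join_out, Code.joinWt_out _ _ _ _ _ hA]
          simp only [Sum.elim_inl, Code.out]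
          simp only [Sum.elim_inr]
          ring
    intro s
    obtain ⟨s, rfl⟩ := (S.port hS (A.outside hA O)).surjective s
    rcases s with p | x
    · rcases hp : S.next p with q | j
      · obtain ⟨h1, h2⟩ := H.inner p q hp
        rw [hin, next_port, next_port, weight_port, weight_port, Code.join_inl _ _ hT h1,
          Code.join_inl _ _ hS hp, Code.joinWt_inl _ _ _ _ _ h1, Code.joinWt_inl _ _ _ _ _ hp]
        exact ⟨rfl, h2⟩
      · rw [(hS.2.1 _ _).1 hp]
        exact hy (.inr j)
    · exact hy (.inl x)
  refine ⟨Φ, ?_, fun v b => (main (v, b)).1, fun v b => (main (v, b)).2⟩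
  rintro (i | x | ⟨⟩)
  · exact H.sign_inl i
  · rfl
  · exact H.sign_inr

end Tangle

/-! ### Insertion of virtual crossings into tangles -/

namespace Tangle

variable {n n' : ℕ}

/-- `T'` arises from `T` by inserting a virtual crossing `e (Sum.inr ())`, with its strand `b`
inserted into the edge `loc b`, where all weights in the tangles are zero. -/
structure IsRefined (T : Tangle n) (T' : Tangle n') (e : Fin n ⊕ Unit → Fin n')
    (loc : Bool → (Fin n × Bool) ⊕ Fin 3) : Prop where
  bij : Bijective e
  loc_ne : loc true ≠ loc false
  sign_inl : ∀ i, T'.sign (e (.inl i)) = T.sign i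
  sign_inr : T'.sign (e (.inr ())) = 0
  wt : ∀ p, T.wt p = 0
  win : ∀ j, T.win j = 0
  wt' : ∀ p, T'.wt p = 0
  win' : ∀ j, T'.win j = 0
  next_other : ∀ p, loc true ≠ .inl p → loc false ≠ .inl p →
    T'.next (e (.inl p.1), p.2) = Sum.map (fun q => (e (.inl q.1), q.2)) id (T.next p)
  next_loc : ∀ p b, loc b = .inl p → T'.next (e (.inl p.1), p.2) = .inl (e (.inr ()), b) ∧
    T'.next (e (.inr ()), b) = Sum.map (fun q => (e (.inl q.1), q.2)) id (T.next p)
  first_other : ∀ j, loc true ≠ .inr j → loc false ≠ .inr j →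
    T'.first j = (e (.inl (T.first j).1), (T.first j).2)
  first_loc : ∀ j b, loc b = .inr j → T'.first j = (e (.inr ()), b) ∧
    T'.next (e (.inr ()), b) = .inl (e (.inl (T.first j).1), (T.first j).2)

namespace IsRefined

variable {T : Tangle n} {T' : Tangle n'} {e : Fin n ⊕ Unit → Fin n'}
  {loc : Bool → (Fin n × Bool) ⊕ Fin 3}

/-- The crossings of the closure after the insertion. -/
noncomputable def equiv (H : IsRefined T T' e loc) (h : T.Valid) (h' : T'.Valid) (O : Outside) :
    (T.closure h O).V ⊕ Unit ≃ (T'.closure h' O).V :=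
  (Equiv.sumCongr (T.vert h O).symm (Equiv.refl _)).trans
    ((((Equiv.sumAssoc _ _ _).trans (Equiv.sumCongr (Equiv.refl _) (Equiv.sumComm _ _))).trans
      ((Equiv.sumAssoc _ _ _).symm.trans (Equiv.sumCongr (Equiv.ofBijective e H.bij)
        (Equiv.refl _)))).trans (T'.vert h' O))

/-- Two different edges of the tangle can become one edge of the closure, namely when the outside
joins the end of a strand directly to the beginning of a strand. In this case the part at the end of
the strand comes first, which explains the choice `(loc true).isLeft`. -/
theorem refines (H : IsRefined T T' e loc) (h : T.Valid) (h' : T'.Valid) (O : Outside) :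
    VDiagram.Refines (T.closure h O) (T'.closure h' O) (H.equiv h h' O)
      (fun b => T.edge h O (loc b)) (loc true).isLeft := by
  let κ : Fin n × Bool → Fin n' × Bool := fun p => (e (.inl p.1), p.2)
  have hport : ∀ s, ((H.equiv h h' O (.inl (T.port h O s).1), (T.port h O s).2) :
      (T'.closure h' O).V × Bool) = T'.port h' O (Sum.map κ id s) := by
    rintro (p | x) <;> rfl
  have hν : ∀ b, ((H.equiv h h' O (.inr ()), b) : (T'.closure h' O).V × Bool) =
      T'.port h' O (.inl (e (.inr ()), b)) := fun b => rfl
  have hedge : ∀ j, T.edge h O (.inr j) = T.port h O (T.out (O.link.symm (.inr j))) := fun _ => rfl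
  have hw0 : ∀ {p q}, T'.next p = .inl q → (T'.closure h' O).weight (T'.port h' O (.inl p)) = 0 := by
    intro p q hp
    rw [weight_port, Code.joinWt_inl _ _ _ _ _ hp, H.wt']
  have hwy : ∀ y, (T'.closure h' O).weight (T'.port h' O (T'.out y)) = O.weight y := by
    intro y
    rw [weight_port, Code.joinWt_out _ _ _ _ _ h']
    rcases y with x | j <;> rcases O.link _ with x' | j' <;> simp [H.wt', H.win']
  have hwy' : ∀ y, (T.closure h O).weight (T.port h O (T.out y)) = O.weight y := by
    intro y
    rw [weight_port, Code.joinWt_out _ _ _ _ _ h]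
    rcases y with x | j <;> rcases O.link _ with x' | j' <;> simp [H.wt, H.win]
  have hw0' : ∀ {p q}, T.next p = .inl q → (T.closure h O).weight (T.port h O (.inl p)) = 0 := by
    intro p q hp
    rw [weight_port, Code.joinWt_inl _ _ _ _ _ hp, H.wt]
  have hny : ∀ y, (T'.closure h' O).next (T'.port h' O (T'.out y)) =
      T'.port h' O (T'.inn (O.link y)) := by
    intro y; rw [next_port, Code.join_out]
  have hny' : ∀ y, (T.closure h O).next (T.port h O (T.out y)) =
      T.port h O (T.inn (O.link y)) := by
    intro y; rw [next_port, Code.join_out]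
  have hinn : ∀ y : (O.W × Bool) ⊕ Fin 3, (∀ b j, loc b = .inr j → y ≠ .inr j) →
      T'.inn y = Sum.map κ id (T.inn y) := by
    rintro (x | j) hy
    · rfl
    · exact congrArg Sum.inl (H.first_other j (fun h => hy _ _ h rfl) fun h => hy _ _ h rfl)
  have hout : ∀ y : (O.W × Bool) ⊕ Fin 3, (∀ b p, loc b = .inl p → T.out y ≠ .inl p) →
      T'.out y = Sum.map κ id (T.out y) := by
    rintro (x | j) hy
    · rfl
    · have h1 := H.next_other (T.last j) (fun h => hy _ _ h rfl) fun h => hy _ _ h rfl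
      rw [(h.2.1 _ j).2 rfl] at h1
      exact congrArg Sum.inl ((h'.2.1 _ j).1 h1).symm
  constructor
  · rintro (i | x)
    · exact H.sign_inl i
    · rfl
  · exact H.sign_inr
  · intro x h1 h2
    have hx : ∀ b, x ≠ T.edge h O (loc b) := by
      rintro (_ | _)
      · exact h2
      · exact h1
    clear h1 h2
    obtain ⟨s, rfl⟩ := (T.port h O).surjective x
    have hy : ∀ y, (∀ b, T.port h O (T.out y) ≠ T.edge h O (loc b)) →
        (T'.closure h' O).next (H.equiv h h' O (.inl (T.port h O (T.out y)).1),
          (T.port h O (T.out y)).2) =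
        (H.equiv h h' O (.inl ((T.closure h O).next (T.port h O (T.out y))).1),
          ((T.closure h O).next (T.port h O (T.out y))).2) ∧
        (T'.closure h' O).weight (H.equiv h h' O (.inl (T.port h O (T.out y)).1),
          (T.port h O (T.out y)).2) = (T.closure h O).weight (T.port h O (T.out y)) := by
      intro y hx
      rw [hport, hny', hport, hwy', ← hout, ← hinn, hny, hwy]
      · exact ⟨rfl, rfl⟩
      · intro b j hb e
        refine hx b ?_
        rw [hb, hedge, ← e, Equiv.symm_apply_apply]
      · intro b p hb e
        refine hx b ?_
        rw [hb, e]
        rfl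
    rcases s with p | x
    · rcases hp : T.next p with q | j
      · have h1 := H.next_other p (fun h => hx true (by rw [h]; rfl)) fun h => hx false (by rw [h]; rfl)
        rw [hp] at h1
        rw [hport, T.next_port, Code.join_inl _ _ h hp, hport, hw0' hp]
        exact ⟨(T'.next_port h' O _).trans (congrArg _ (Code.join_inl _ _ h' h1)), hw0 h1⟩
      · rw [(h.2.1 _ _).1 hp] at hx ⊢
        exact hy (.inr j) hx
    · exact hy (.inl x) hx
  · intro hs b
    have hs' : T.edge h O (loc b) ≠ T.edge h O (loc (!b)) := by
      cases b
      · exact hs.symm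
      · exact hs
    rcases hb : loc b with p | j
    · obtain ⟨h1, h2⟩ := H.next_loc p b hb
      have hp' : T.edge h O (.inl p) = T.port h O (.inl p) := rfl
      rw [hp', hport, hν, next_port, next_port]
      refine ⟨congrArg _ (Code.join_inl _ _ h' h1), ?_, ?_⟩
      · rcases hp : T.next p with q | j
        · rw [hp] at h2
          rw [Code.join_inl _ _ h' h2, next_port, Code.join_inl _ _ h hp, hport]
          rfl
        · rw [hp] at h2
          have h3 : (Sum.inl (e (.inr ()), b) : _ ⊕ (O.W × Bool)) = T'.out (.inr j) :=
            congrArg _ ((h'.2.1 _ _).1 h2)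
          have h4 : (Sum.inl p : _ ⊕ (O.W × Bool)) = T.out (.inr j) :=
            congrArg _ ((h.2.1 _ _).1 hp)
          rw [h3, h4, Code.join_out, hny', hport, ← hinn]
          intro b' j' hb' e'
          have hbb : b' = !b := Bool.eq_not.2 (by rintro rfl; rw [hb] at hb'; cases hb')
          subst hbb
          apply hs'
          rw [hb', hedge, ← e', Equiv.symm_apply_apply, ← h4, hb]
          rfl
      · refine (congrArg₂ _ (hw0 h1) rfl).trans ?_
        rw [zero_add]
        rcases hp : T.next p with q | j
        · rw [hp] at h2
          rw [hw0 h2, hw0' hp]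
        · rw [hp] at h2
          have h3 : (Sum.inl (e (.inr ()), b) : _ ⊕ (O.W × Bool)) = T'.out (.inr j) :=
            congrArg _ ((h'.2.1 _ _).1 h2)
          have h4 : (Sum.inl p : _ ⊕ (O.W × Bool)) = T.out (.inr j) :=
            congrArg _ ((h.2.1 _ _).1 hp)
          rw [h3, h4, hwy, hwy']
    · obtain ⟨h1, h2⟩ := H.first_loc j b hb
      have h3 : T'.out (O.link.symm (.inr j)) = Sum.map κ id (T.out (O.link.symm (.inr j))) := by
        apply hout
        intro b' p hb' e'
        have hbb : b' = !b := Bool.eq_not.2 (by rintro rfl; rw [hb] at hb'; cases hb')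
        subst hbb
        apply hs'
        rw [hb', hb, hedge, e']
        rfl
      rw [hedge, hport, hν, ← h3, hny, hwy, hwy', hw0 h2, hny', Equiv.apply_symm_apply, hport,
        next_port, Code.join_inl _ _ h' h2]
      refine ⟨?_, rfl, add_zero _⟩
      exact congrArg (fun p => T'.port h' O (.inl p)) h1
  · intro hs
    have hs' : ∀ b, T.edge h O (loc b) = T.edge h O (loc (!b)) := by
      rintro (_ | _)
      · exact hs.symm
      · exact hs
    have hll : ∀ p q, T.edge h O (.inl p) = T.edge h O (.inl q) → p = q := fun p q e =>
      Sum.inl_injective ((T.port h O).injective e)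
    have hrr : ∀ i j, T.edge h O (.inr i) = T.edge h O (.inr j) → i = j := fun i j e =>
      Sum.inr_injective (O.link.symm.injective (T.out_injective h ((T.port h O).injective e)))
    have hne := H.loc_ne
    -- The only possible coincidence: `p` is the last passage of a strand whose end is linked to the
    -- beginning of strand `j`.
    have main : ∀ c p j, loc c = .inl p → loc (!c) = .inr j →
        (T'.closure h' O).next (H.equiv h h' O (.inl (T.edge h O (loc c)).1),
          (T.edge h O (loc c)).2) = (H.equiv h h' O (.inr ()), c) ∧
        (T'.closure h' O).next (H.equiv h h' O (.inr ()), c) = (H.equiv h h' O (.inr ()), !c) ∧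
        (T'.closure h' O).next (H.equiv h h' O (.inr ()), !c) =
          (H.equiv h h' O (.inl ((T.closure h O).next (T.edge h O (loc c))).1),
            ((T.closure h O).next (T.edge h O (loc c))).2) ∧
        (T'.closure h' O).weight (H.equiv h h' O (.inl (T.edge h O (loc c)).1),
          (T.edge h O (loc c)).2) + (T'.closure h' O).weight (H.equiv h h' O (.inr ()), c) +
          (T'.closure h' O).weight (H.equiv h h' O (.inr ()), !c) =
            (T.closure h O).weight (T.edge h O (loc c)) := by
      intro c p j hc hc'
      have hsc := hs' c
      rw [hc, hc', hedge] at hsc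
      have h3 : Sum.inl p = T.out (O.link.symm (.inr j)) := (T.port h O).injective hsc
      rcases hy : O.link.symm (.inr j) with x | J
      · rw [hy] at h3; cases h3
      · have hJ : O.link (.inr J) = .inr j := by rw [← hy, Equiv.apply_symm_apply]
        rw [hy] at h3
        obtain ⟨h1, h2⟩ := H.next_loc p c hc
        have hp : p = T.last J := Sum.inl_injective h3
        rw [hp, (h.2.1 _ J).2 rfl] at h2
        obtain ⟨h5, h6⟩ := H.first_loc j (!c) hc'
        have h7 : (Sum.inl (e (.inr ()), c) : _ ⊕ (O.W × Bool)) = T'.out (.inr J) :=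
          congrArg _ ((h'.2.1 _ _).1 h2)
        have hp' : T.edge h O (.inl p) = T.port h O (.inl p) := rfl
        rw [hc, hp', hport, hν, hν, next_port, h7, hny, hJ, next_port, Code.join_inl _ _ h' h6, hwy,
          hw0 h6, h3, hny', hwy', hJ, hport, ← h3]
        refine ⟨?_, ?_, rfl, ?_⟩
        · rw [← h7]
          exact congrArg _ (Code.join_inl _ _ h' h1)
        · exact congrArg (fun p => T'.port h' O (.inl p)) h5
        · refine (congrArg (fun a => a + _ + 0) (hw0 h1)).trans ?_
          ring
    rcases h1 : loc true with p | i
    · rcases h2 : loc false with q | j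
      · rw [h1, h2] at hs hne
        exact absurd (congrArg _ (hll _ _ hs)) hne
      · obtain ⟨a1, a2, a3, a4⟩ := main true p j h1 h2
        exact ⟨a1, a2, a3, a4⟩
    · rcases h2 : loc false with q | j
      · obtain ⟨a1, a2, a3, a4⟩ := main false q i h2 h1
        refine ⟨a1, a2, a3, ?_⟩
        simp only [Sum.isLeft_inr]
        rw [← a4]
        simp only [Bool.not_false]
        ring
      · rw [h1, h2] at hs hne
        exact absurd (congrArg _ (hrr _ _ hs)) hne

end IsRefined

end Tangle

namespace IntegralOGraph

open VDiagram

/-! ### Sequences of moves -/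

theorem Step.symm {Γ Γ' : IntegralOGraph} (h : Step Γ Γ') : Step Γ' Γ := ⟨h.2.1, h.1, h.2.2.symm⟩

/-- The diagrams are related by a sequence of basic moves and their inverses through framed
diagrams. -/
def Reach (D D' : VDiagram) : Prop := Relation.ReflTransGen Step (mk D) (mk D')

theorem Reach.symm {D D' : VDiagram} (h : Reach D D') : Reach D' D := by
  have : Std.Symm Step := ⟨fun _ _ => Step.symm⟩
  exact symm_of (Relation.ReflTransGen Step) h

theorem Reach.trans {D D' D'' : VDiagram} (h : Reach D D') (h' : Reach D' D'') : Reach D D'' :=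
  Relation.ReflTransGen.trans h h'

theorem Reach.of_eq {D D' : VDiagram} (h : mk D = mk D') : Reach D D' := by
  rw [Reach, h]

theorem Reach.of_iso {D D' : VDiagram} (h : Iso D D') : Reach D D' := .of_eq (mk_eq_of_iso h)

theorem Reach.of_basicMove {D D' : VDiagram} (hD : D.FN) (hD' : D'.FN)
    (h : BasicMove (mk D) (mk D')) : Reach D D' :=
  .single ⟨(isFramed_mk_iff D).2 hD, (isFramed_mk_iff D').2 hD', .inl h⟩

theorem gauge_gauge (D : VDiagram) (f g : D.V → ℤ) : (D.gauge f).gauge g = D.gauge (f + g) := by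
  unfold VDiagram.gauge
  congr 1
  funext s
  simp only [Pi.add_apply]
  ring

theorem gauge_zero (D : VDiagram) : D.gauge 0 = D := by
  unfold VDiagram.gauge
  cases D
  congr 1
  funext s
  simp

open Classical in
theorem reach_gauge_single (D : VDiagram) (hD : D.FN) (v : D.V) (hv : D.kind v ≠ 0) (k : ℤ) :
    Reach D (D.gauge fun u => if u = v then k else 0) := by
  have step : ∀ k : ℤ, Reach (D.gauge fun u => if u = v then k else 0)
      (D.gauge fun u => if u = v then k + 1 else 0) := by
    intro k
    refine .of_basicMove ((gauge_fn_iff _ _).2 hD) ((gauge_fn_iff _ _).2 hD)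
      (.hMove ⟨_, _, rfl, rfl, v, hv, ?_⟩)
    refine Eq.trans ?_ (gauge_gauge D _ _).symm
    congr 1
    funext u
    change _ = (if u = v then k else 0) + (if u = v then 1 else 0)
    split_ifs <;> simp
  have h0 : D.gauge (fun u => if u = v then 0 else 0) = D := by
    simp only [ite_self]
    exact gauge_zero D
  induction k using Int.induction_on with
  | zero => rw [h0]; exact .of_eq rfl
  | succ k ih => exact ih.trans (step _)
  | pred k ih =>
    have := step (-k - 1)
    rw [sub_add_cancel] at this
    exact ih.trans this.symm

/-- A cochain is a finite sum of multiples of indicator functions, and each of these is realized by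
H-moves or their inverses. H-moves exist only at real crossings, hence the condition on `f`. -/
theorem reach_gauge (D : VDiagram) (hD : D.FN) (f : D.V → ℤ) (hf : ∀ v, D.kind v = 0 → f v = 0) :
    Reach D (D.gauge f) := by
  classical
  have := D.fin
  have := Fintype.ofFinite D.V
  have key : ∀ s : Finset D.V, Reach D (D.gauge fun u => if u ∈ s then f u else 0) := by
    intro s
    induction s using Finset.induction_on with
    | empty =>
      simp only [notMem_empty, if_false]
      rw [show D.gauge (fun _ => 0) = D from gauge_zero D]
      exact .of_eq rfl
    | insert v s hv ih =>
      have h1 : D.gauge (fun u => if u ∈ insert v s then f u else 0) =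
          (D.gauge fun u => if u ∈ s then f u else 0).gauge fun u => if u = v then f v else 0 := by
        refine Eq.trans ?_ (gauge_gauge D _ _).symm
        congr 1
        funext u
        change _ = (if u ∈ s then f u else 0) + (if u = v then f v else 0)
        simp only [mem_insert]
        by_cases hu : u = v
        · subst hu; simp [hv]
        · simp [hu]
      rw [h1]
      by_cases hk : D.kind v = 0
      · rw [hf v hk]
        simp only [ite_self]
        rw [show (D.gauge fun u => if u ∈ s then f u else 0).gauge (fun _ => 0) = _ from
          gauge_zero _]
        exact ih
      · exact ih.trans (reach_gauge_single _ ((gauge_fn_iff _ _).2 hD) v hk _)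
  simpa using key univ

end IntegralOGraph

/-! ### Pure sliding moves in a form that can be checked locally. -/

namespace SlideType

/-- The weight on the middle part of the right edge. -/
def mid : SlideType → ℤ
  | I => 0 | II => 0 | III => 1 | IV => -1

/-- Twice the weight on the lower part of the right edge, in terms of twice the rotation number. -/
def low : SlideType → ℤ → ℤ
  | I, p => -p - 1
  | II, p => -p - 1
  | III, p => -p - 2
  | IV, p => p + 2

theorem midWeight_eq (t : SlideType) : t.midWeight = t.mid := by cases t <;> simp [midWeight, mid]

theorem lowWeight_eq (t : SlideType) {p a : ℤ} (h : 2 * a = t.low p) :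
    t.lowWeight ((p : ℚ) / 2) = a := by
  have h' : (2 * a : ℚ) = t.low p := by exact_mod_cast h
  cases t <;> simp only [low, lowWeight] at h' ⊢ <;> push_cast at h' <;> linarith

end SlideType

namespace VDiagram

open IntegralOGraph

theorem succ_of_next (D : VDiagram) {s s' : D.V × Bool} {l : Fin 3} (hl : l ≠ 2) (h : D.next s = s')
    (hs : D.kind s'.1 = 0) : D.succ (s, l) = (s', l) := by
  subst h
  rw [succ_eq, show D.arrival (s, l) = (D.next s, l) by simp [arrival, hl], depart_of_virtual _ hs]
  simp [hl]

theorem succ_of_next' (D : VDiagram) {s s' : D.V × Bool} (h : D.next s' = s)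
    (hs : D.kind s.1 = 0) : D.succ (s, 2) = (s', 2) := by
  subst h
  rw [succ_eq, show D.arrival (D.next s', 2) = (D.next s', 2) by simp [arrival],
    depart_of_virtual _ hs]
  simp

section Slide

variable (D : VDiagram) (t : SlideType) (B T : D.V)

abbrev low₁ : D.V × Bool := D.lowEdge B t.leftOver t.leftUp
abbrev low₂ : D.V × Bool := D.lowEdge B (!t.leftOver) t.rightUp
abbrev mid₁ : D.V × Bool := D.midEdge B T t.leftOver t.leftUp
abbrev mid₂ : D.V × Bool := D.midEdge B T (!t.leftOver) t.rightUp
abbrev high₁ : D.V × Bool := D.highEdge T t.leftOver t.leftUp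
abbrev high₂ : D.V × Bool := D.highEdge T (!t.leftOver) t.rightUp

open Classical in
/-- The diagram after a pure sliding move with weight `a` on the edge `near` and weight
`-(a + t.mid)` on the edge `far`. -/
noncomputable def slid (near far : D.V × Bool) (a : ℤ) : VDiagram :=
  { D with
    kind := Function.update (Function.update D.kind B t.bottomSign) T (-t.bottomSign)
    weight := fun s => D.weight s + (if s = near then a else 0)
      + (if s = D.mid₂ t B T then t.mid else 0) - (if s = far then a + t.mid else 0) }

/-- Two strands cross each other twice at virtual crossings. -/
structure Bigon : Prop where
  ne : B ≠ T
  kind_bot : D.kind B = 0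
  kind_top : D.kind T = 0
  left : D.Passes B T t.leftOver t.leftUp
  right : D.Passes B T (!t.leftOver) t.rightUp

variable {D t B T}

theorem Bigon.slide (h : D.Bigon t B T) {n : ℕ} {p a : ℤ}
    (hl₁ : D.weight (D.low₁ t B) = 0) (hm₁ : D.weight (D.mid₁ t B T) = 0)
    (hl₂ : D.weight (D.low₂ t B) = 0) (hm₂ : D.weight (D.mid₂ t B T) = 0)
    (hn : n < minimalPeriod D.succ (D.low₁ t B, t.leftLine))
    (hn' : D.succ^[n] (D.low₁ t B, t.leftLine) = (D.low₂ t B, t.rightLine))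
    (hp : p = ∑ i ∈ range n, D.rot2 (D.succ^[i] (D.low₁ t B, t.leftLine)))
    (ha : 2 * a = t.low p) : Slide t D (D.slid t B T (D.low₂ t B) (D.high₂ t T) a) := by
  refine ⟨B, T, n, (p : ℚ) / 2, (D.slid t B T (D.low₂ t B) (D.high₂ t T) a).weight, h.ne, h.kind_bot,
    h.kind_top, h.left, h.right, hl₁, hm₁, hl₂, hm₂, hn, hn', ?_, ?_, ?_⟩
  · rw [hp, Int.cast_sum, sum_div]
    exact sum_congr rfl fun i _ => (D.along_add_turn _).symm
  · intro s
    rw [t.lowWeight_eq ha, t.midWeight_eq]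
    simp only [slid]
    push_cast
    rfl
  · unfold slid
    congr!

/-- The path below the crossings consists of the lower left edge and of `g`. The two inequalities
between edges exclude periods 1 and 2 for the cell, as required of a path of length 2. -/
theorem Bigon.reach_slid (h : D.Bigon t B T) {g : D.Germ} {a : ℤ}
    (hl₁ : D.weight (D.low₁ t B) = 0) (hm₁ : D.weight (D.mid₁ t B T) = 0)
    (hl₂ : D.weight (D.low₂ t B) = 0) (hm₂ : D.weight (D.mid₂ t B T) = 0)
    (h1 : D.succ (D.low₁ t B, t.leftLine) = g) (h2 : D.succ g = (D.low₂ t B, t.rightLine))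
    (h3 : g.1 ≠ D.low₁ t B) (h4 : D.low₂ t B ≠ D.low₁ t B)
    (ha : 2 * a = t.low (D.rot2 (D.low₁ t B, t.leftLine) + D.rot2 g))
    (hD : D.FN) (hD' : (D.slid t B T (D.low₂ t B) (D.high₂ t T) a).FN) :
    Reach D (D.slid t B T (D.low₂ t B) (D.high₂ t T) a) := by
  refine .of_basicMove hD hD' (.slide t ⟨_, _, rfl, rfl, h.slide (n := 2) hl₁ hm₁ hl₂ hm₂ ?_ ?_ rfl ?_⟩)
  · by_contra hn
    have h0 := minimalPeriod_pos_of_mem_periodicPts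
      (D.mem_periodicPts_succ (D.low₁ t B, t.leftLine))
    have h5 := iterate_minimalPeriod (f := D.succ) (x := (D.low₁ t B, t.leftLine))
    have h6 : minimalPeriod D.succ (D.low₁ t B, t.leftLine) = 1 ∨
      minimalPeriod D.succ (D.low₁ t B, t.leftLine) = 2 := by omega
    rcases h6 with h6 | h6
    · rw [h6, iterate_one, h1] at h5
      exact h3 (congrArg Prod.fst h5)
    · rw [h6, iterate_succ_apply, iterate_one, h1, h2] at h5
      exact h4 (congrArg Prod.fst h5)
  · rw [iterate_succ_apply, iterate_one, h1, h2]
  · rw [sum_range_succ, sum_range_one, iterate_one, iterate_zero, id_eq, h1]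
    exact ha

theorem Bigon.succ_high₁ (h : D.Bigon t B T) :
    D.succ (D.high₁ t T, t.leftLine) = (D.mid₁ t B T, t.leftLine) := by
  have hp := h.left
  cases t
  · exact D.succ_of_next' hp h.kind_top
  · exact D.succ_of_next' hp h.kind_top
  · exact D.succ_of_next (by decide) (D.next.apply_symm_apply _) h.kind_top
  · exact D.succ_of_next' hp h.kind_top

theorem Bigon.succ_mid₁ (h : D.Bigon t B T) :
    D.succ (D.mid₁ t B T, t.leftLine) = (D.low₁ t B, t.leftLine) := by
  have hp := h.left
  cases t
  · exact D.succ_of_next' (D.next.apply_symm_apply _) h.kind_bot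
  · exact D.succ_of_next' (D.next.apply_symm_apply _) h.kind_bot
  · exact D.succ_of_next (by decide) hp h.kind_bot
  · exact D.succ_of_next' (D.next.apply_symm_apply _) h.kind_bot

theorem Bigon.succ_low₂ (h : D.Bigon t B T) :
    D.succ (D.low₂ t B, t.rightLine) = (D.mid₂ t B T, t.rightLine) := by
  have hp := h.right
  cases t
  · exact D.succ_of_next (by decide) (D.next.apply_symm_apply _) h.kind_bot
  · exact D.succ_of_next (by decide) (D.next.apply_symm_apply _) h.kind_bot
  · exact D.succ_of_next (by decide) (D.next.apply_symm_apply _) h.kind_bot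
  · exact D.succ_of_next' hp h.kind_bot

theorem Bigon.succ_mid₂ (h : D.Bigon t B T) :
    D.succ (D.mid₂ t B T, t.rightLine) = (D.high₂ t T, t.rightLine) := by
  have hp := h.right
  cases t
  · exact D.succ_of_next (by decide) hp h.kind_top
  · exact D.succ_of_next (by decide) hp h.kind_top
  · exact D.succ_of_next (by decide) hp h.kind_top
  · exact D.succ_of_next' (D.next.apply_symm_apply _) h.kind_top

/-! ### Pure sliding moves with the path above the crossings -/

open Classical in
/-- The indicator function of a point. -/
noncomputable def ind {X : Type*} (x y : X) : ℤ := if x = y then 1 else 0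

theorem ite_eq_mul_ind {X : Type*} (x y : X) [Decidable (x = y)] (a : ℤ) :
    (if x = y then a else 0) = a * ind x y := by
  by_cases h : x = y <;> simp [ind, h]

/-- The edge between the two crossings leaves one and enters the other, so it cancels and only the
outermost edges remain. The direction of the strand affects only the sign. -/
theorem Passes.ind_eq {b up : Bool} (h : D.Passes B T b up) (s : D.V × Bool) :
    ind s (B, b) + ind s (T, b) - ind (D.next s) (B, b) - ind (D.next s) (T, b) =
      (if up then 1 else -1) * (ind s (D.highEdge T b up) - ind s (D.lowEdge B b up)) := by
  have h1 : ∀ x y, ind (D.next x) (D.next y) = ind x y := fun x y => by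
    by_cases e : x = y <;> simp [ind, e]
  have h2 : ∀ x y, ind x (D.next.symm y) = ind (D.next x) y := fun x y => by
    rw [← h1, Equiv.apply_symm_apply]
  unfold Passes midEdge at h
  unfold highEdge lowEdge
  cases up
  · simp only [Bool.false_eq_true, if_false] at h ⊢
    rw [h2, ← h, h1]
    ring
  · simp only [if_true] at h ⊢
    rw [h2, ← h, h1]
    ring

theorem Passes.shift {b up : Bool} (h : D.Passes B T b up) (w : D.V × Bool → ℤ) (k : ℤ) :
    D.shift (T, b) ((if up then 1 else -1) * k) (D.shift (B, b) ((if up then 1 else -1) * k) w) =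
      fun s => w s + k * ind s (D.highEdge T b up) - k * ind s (D.lowEdge B b up) := by
  funext s
  have := h.ind_eq s
  simp only [VDiagram.shift, ite_eq_mul_ind]
  have h1 : ((if up then 1 else -1 : ℤ)) * (if up then 1 else -1) = 1 := by cases up <;> rfl
  linear_combination ((if up then 1 else -1) * k) * this +
    k * (ind s (D.highEdge T b up) - ind s (D.lowEdge B b up)) * h1

/-- Equal numbers of H-moves at both crossings cancel on the middle edges; they transport weight
between the lower and upper edges of both strands. -/
theorem Bigon.ind_gauge (h : D.Bigon t B T) (c : ℤ) (s : D.V × Bool) :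
    c * (ind (D.next s).1 B + ind (D.next s).1 T) - c * (ind s.1 B + ind s.1 T) =
      -c * ((if t.leftUp then 1 else -1) * (ind s (D.high₁ t T) - ind s (D.low₁ t B)) +
        (if t.rightUp then 1 else -1) * (ind s (D.high₂ t T) - ind s (D.low₂ t B))) := by
  have h1 : ∀ (x : D.V × Bool) v b, ind x.1 v = ind x (v, b) + ind x (v, !b) := by
    rintro ⟨x, b'⟩ v b
    by_cases hx : x = v
    · cases b <;> cases b' <;> simp [ind, hx]
    · simp [ind, hx]
  have h2 := h.left.ind_eq s
  have h3 := h.right.ind_eq s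
  rw [h1 _ B t.leftOver, h1 _ T t.leftOver, h1 _ B t.leftOver, h1 _ T t.leftOver]
  linear_combination (-c) * h2 + (-c) * h3

/-- The cell runs up the right strand, through `g`, down the left strand, and back along an unknown
path below. Framedness says that the doubled rotation numbers add up to `-2`, so the part above
determines the rotation number below and hence the weights of the move. These differ from the
weights computed from the upper path by a gauge at the two new crossings. -/
theorem Bigon.reach_slid_rotated (h : D.Bigon t B T) {g : D.Germ} {a : ℤ}
    (hB : ∀ w b u, IntegralOGraph.mk (D.withWeight (D.shift (B, b) u w)) = IntegralOGraph.mk (D.withWeight w))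
    (hT : ∀ w b u, IntegralOGraph.mk (D.withWeight (D.shift (T, b) u w)) = IntegralOGraph.mk (D.withWeight w))
    (hm₁ : D.weight (D.mid₁ t B T) = 0) (hm₂ : D.weight (D.mid₂ t B T) = 0)
    (hh₁ : D.weight (D.high₁ t T) = 0) (hh₂ : D.weight (D.high₂ t T) = 0)
    (h1 : D.succ (D.high₂ t T, t.rightLine) = g) (h2 : D.succ g = (D.high₁ t T, t.leftLine))
    (hnd : [D.mid₁ t B T, D.mid₂ t B T, D.high₁ t T, D.high₂ t T, g.1].Nodup)
    (hl₁ : D.low₁ t B ∉ [D.mid₁ t B T, D.mid₂ t B T, D.high₁ t T, D.high₂ t T, g.1])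
    (hl₂ : D.low₂ t B ∉ [D.mid₁ t B T, D.mid₂ t B T, D.high₁ t T, D.high₂ t T, g.1])
    (ha : 2 * a = t.low (D.rot2 (D.high₂ t T, t.rightLine) + D.rot2 g))
    (hD : D.FN) (hD' : (D.slid t B T (D.high₂ t T) (D.low₂ t B) a).FN) :
    Reach D (D.slid t B T (D.high₂ t T) (D.low₂ t B) a) := by
  simp only [List.nodup_cons, List.mem_cons, not_or, List.not_mem_nil, not_false_eq_true, and_true,
    List.nodup_nil] at hnd hl₁ hl₂
  obtain ⟨⟨n1, n2, n3, n4⟩, ⟨n5, n6, n7⟩, ⟨n8, n9⟩, n10⟩ := hnd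
  obtain ⟨a1, a2, a3, a4, a5⟩ := hl₁
  obtain ⟨b1, b2, b3, b4, b5⟩ := hl₂
  have i0 : ∀ {x y : D.V × Bool}, x ≠ y → ind x y = 0 := fun h => by simp [ind, h]
  have i1 : ∀ x : D.V × Bool, ind x x = 1 := fun x => by simp [ind]
  -- The move requires weight zero on the lower edges, so `k` and `l` are pushed from there through
  -- the virtual crossings to the upper edges. The lower edges may be the same edge, in which case
  -- its weight must be moved only once.
  obtain ⟨k, l, hk, hl⟩ : ∃ k l : ℤ, D.weight (D.low₁ t B) - k - l * ind (D.low₁ t B) (D.low₂ t B) = 0 ∧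
      D.weight (D.low₂ t B) - k * ind (D.low₂ t B) (D.low₁ t B) - l = 0 := by
    by_cases e : D.low₁ t B = D.low₂ t B
    · refine ⟨D.weight (D.low₁ t B), 0, by ring, ?_⟩
      rw [← e, i1]; ring
    · refine ⟨D.weight (D.low₁ t B), D.weight (D.low₂ t B), ?_, ?_⟩
      · rw [i0 e]; ring
      · rw [i0 (Ne.symm e)]; ring
  let w₁ : D.V × Bool → ℤ := fun s => D.weight s + l * ind s (D.high₂ t T) - l * ind s (D.low₂ t B)
    + k * ind s (D.high₁ t T) - k * ind s (D.low₁ t B)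
  let D₁ : VDiagram := D.withWeight w₁
  have hmk : IntegralOGraph.mk D₁ = IntegralOGraph.mk D := by
    have e := h.left.shift (fun s => D.weight s + l * ind s (D.high₂ t T) - l * ind s (D.low₂ t B)) k
    have e' := h.right.shift D.weight l
    rw [← e'] at e
    have : D₁ = D.withWeight _ := congrArg D.withWeight e.symm
    rw [this, hT, hB, hT, hB]
  have hD₁ : D₁.FN := by
    rw [← isFramed_mk_iff, hmk, isFramed_mk_iff]; exact hD
  have hb₁ : D₁.Bigon t B T := ⟨h.ne, h.kind_bot, h.kind_top, h.left, h.right⟩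
  have wl₁ : w₁ (D.low₁ t B) = 0 := by
    simp only [w₁]; rw [i0 a3, i0 a4, i1]; linarith
  have wl₂ : w₁ (D.low₂ t B) = 0 := by
    simp only [w₁]; rw [i0 b3, i0 b4, i1]; linarith
  have wm₁ : w₁ (D.mid₁ t B T) = 0 := by
    simp only [w₁]; rw [hm₁, i0 n3, i0 n2, i0 (Ne.symm a1), i0 (Ne.symm b1)]; ring
  have wm₂ : w₁ (D.mid₂ t B T) = 0 := by
    simp only [w₁]; rw [hm₂, i0 n6, i0 n5, i0 (Ne.symm a2), i0 (Ne.symm b2)]; ring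
  have wh₁ : w₁ (D.high₁ t T) = k := by
    simp only [w₁]; rw [hh₁, i0 n8, i1, i0 (Ne.symm a3), i0 (Ne.symm b3)]; ring
  have wh₂ : w₁ (D.high₂ t T) = l := by
    simp only [w₁]; rw [hh₂, i0 (Ne.symm n8), i1, i0 (Ne.symm a4), i0 (Ne.symm b4)]; ring
  have wg : w₁ g.1 = D.weight g.1 := by
    simp only [w₁]; rw [i0 (Ne.symm n9), i0 (Ne.symm n10), i0 (Ne.symm a5), i0 (Ne.symm b5)]; ring
  -- the cell between the edges
  have hs : D.succ^[6] (D.low₂ t B, t.rightLine) = (D.low₁ t B, t.leftLine) ∧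
      ∀ i, 0 < i → i < 6 →
        D.succ^[i] (D.low₂ t B, t.rightLine) ≠ (D.low₁ t B, t.leftLine) := by
    have s2 : D.succ^[2] (D.low₂ t B, t.rightLine) = (D.high₂ t T, t.rightLine) := by
      rw [iterate_succ_apply', iterate_one, h.succ_low₂, h.succ_mid₂]
    have s3 : D.succ^[3] (D.low₂ t B, t.rightLine) = g := by
      rw [iterate_succ_apply', s2, h1]
    have s4 : D.succ^[4] (D.low₂ t B, t.rightLine) = (D.high₁ t T, t.leftLine) := by
      rw [iterate_succ_apply', s3, h2]
    have s5 : D.succ^[5] (D.low₂ t B, t.rightLine) = (D.mid₁ t B T, t.leftLine) := by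
      rw [iterate_succ_apply', s4, h.succ_high₁]
    refine ⟨by rw [iterate_succ_apply', s5, h.succ_mid₁], fun i hi hi' e => ?_⟩
    interval_cases i
    · rw [iterate_one, h.succ_low₂] at e
      exact a2 (congrArg Prod.fst e).symm
    · rw [s2] at e
      exact a4 (congrArg Prod.fst e).symm
    · rw [s3] at e
      exact a5 (congrArg Prod.fst e).symm
    · rw [s4] at e
      exact a3 (congrArg Prod.fst e).symm
    · rw [s5] at e
      exact a1 (congrArg Prod.fst e).symm
  -- Six steps lead from the bottom of the right strand over the top to the bottom of the left
  -- strand, without meeting that line earlier. The other `n` steps form the path to which the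
  -- definition of the move refers.
  obtain ⟨n, hn, hn'⟩ : ∃ n, minimalPeriod D.succ (D.low₁ t B, t.leftLine) = n + 6 ∧
      D.succ^[n] (D.low₁ t B, t.leftLine) = (D.low₂ t B, t.rightLine) := by
    have h0 := minimalPeriod_pos_of_mem_periodicPts
      (D.mem_periodicPts_succ (D.low₁ t B, t.leftLine))
    have hN := iterate_minimalPeriod (f := D.succ) (x := (D.low₁ t B, t.leftLine))
    have h6 : 6 ≤ minimalPeriod D.succ (D.low₁ t B, t.leftLine) := by
      by_contra hlt
      refine hs.2 (6 - minimalPeriod D.succ (D.low₁ t B, t.leftLine)) (by omega) (by omega)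
        (D.succ_injective.iterate (minimalPeriod D.succ (D.low₁ t B, t.leftLine)) ?_)
      rw [← iterate_add_apply, Nat.add_sub_cancel' (by omega), hs.1, hN]
    obtain ⟨n, hn⟩ := Nat.exists_eq_add_of_le' h6
    refine ⟨n, hn, D.succ_injective.iterate 6 ?_⟩
    rw [← iterate_add_apply, add_comm, ← hn, hN, hs.1]
  have hsum := (framed_iff D₁).1 hD₁.2 (D.low₁ t B, t.leftLine)
  rw [cycleSum, show minimalPeriod D₁.succ (D.low₁ t B, t.leftLine) = n + 6 from hn,
    sum_range_add] at hsum
  have hr : ∀ (g g' : D.Germ), D.succ g = g' → D₁.rot2 g =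
      2 * (if g.2 = 2 then -w₁ g.1 else w₁ g.1) + turn2 g.2 g'.2 := by
    intro g g' e
    rw [← e]; rfl
  have hr' : ∀ (g g' : D.Germ), D.succ g = g' → D.rot2 g =
      2 * (if g.2 = 2 then -D.weight g.1 else D.weight g.1) + turn2 g.2 g'.2 := by
    intro g g' e
    rw [← e]; rfl
  have ht : ∀ l, turn2 l l = 0 := fun l => by simp [turn2]
  have h6 : ∑ i ∈ range 6, D₁.rot2 (D₁.succ^[n + i] (D.low₁ t B, t.leftLine)) =
      D.rot2 (D.high₂ t T, t.rightLine) + D.rot2 g +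
        2 * (if t.rightLine = 2 then -l else l) + 2 * (if t.leftLine = 2 then -k else k) := by
    have e : ∀ i, D₁.succ^[n + i] (D.low₁ t B, t.leftLine) =
        D.succ^[i] (D.low₂ t B, t.rightLine) := by
      intro i
      rw [add_comm, iterate_add_apply]
      exact congrArg (D.succ^[i]) hn'
    simp only [e, sum_range_succ, sum_range_zero, iterate_succ_apply, iterate_zero, id_eq,
      h.succ_low₂, h.succ_mid₂, h1, h2, h.succ_high₁]
    rw [hr _ _ h.succ_low₂, hr _ _ h.succ_mid₂, hr _ _ h1, hr _ _ h2, hr _ _ h.succ_high₁,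
      hr _ _ h.succ_mid₁, hr' _ _ h1, hr' _ _ h2]
    simp only [wl₂, wm₁, wm₂, wh₁, wh₂, wg, hh₂, ht]
    simp only [neg_zero, ite_self]
    ring
  rw [h6] at hsum
  obtain ⟨a', ha₁, ha₂⟩ : ∃ a', a' = -(a + t.mid) + l -
      (match t with | .I => k | .II => k | .III => -k | .IV => -k) ∧
      2 * a' = t.low (∑ i ∈ range n, D₁.rot2 (D₁.succ^[i] (D.low₁ t B, t.leftLine))) := by
    refine ⟨_, rfl, ?_⟩
    cases t <;> simp only [SlideType.low, SlideType.mid, SlideType.leftLine,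
      SlideType.rightLine] at hsum ha ⊢ <;> simp at hsum <;> linarith
  have hsl : Slide t D₁ (D₁.slid t B T (D.low₂ t B) (D.high₂ t T) a') :=
    hb₁.slide wl₁ wm₁ wl₂ wm₂ (show n < minimalPeriod D.succ (D.low₁ t B, t.leftLine) by omega) hn' rfl ha₂
  -- This gauge carries the displaced weight `k` of the left strand back below the crossings; the
  -- sign follows the direction of the strand. The choice of `a'` makes the right strand come out
  -- correctly at the same time.
  obtain ⟨c, hc⟩ : ∃ c, c = (match t with | .I => k | .II => k | .III => -k | .IV => k) := ⟨_, rfl⟩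
  have hg : D.slid t B T (D.high₂ t T) (D.low₂ t B) a =
      (D₁.slid t B T (D.low₂ t B) (D.high₂ t T) a').gauge fun v => c * (ind v B + ind v T) := by
    unfold slid VDiagram.gauge
    congr 1
    funext s
    have e := h.ind_gauge c s
    simp only [ite_eq_mul_ind]
    rw [add_sub_assoc _ (c * _), show ∀ x : D.V × Bool, D₁.next x = D.next x from fun _ => rfl]
    refine Eq.trans ?_ (congrArg _ e).symm
    have hw : D₁.weight s = w₁ s := rfl
    rw [show D₁.mid₂ t B T = D.mid₂ t B T from rfl, hw, hc, ha₁]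
    simp only [w₁]
    cases t <;> simp only [SlideType.leftUp, SlideType.rightUp, if_true, Bool.false_eq_true, if_false] <;>
      ring
  rw [hg] at hD' ⊢
  rw [gauge_fn_iff] at hD'
  refine (Reach.of_eq hmk.symm).trans ((Reach.of_basicMove hD₁ hD' (.slide t ⟨_, _, rfl, rfl, hsl⟩)).trans
    (reach_gauge _ hD' _ ?_))
  intro v hv
  classical
  have hBv : v ≠ B := by
    intro e
    rw [e] at hv
    revert hv
    simp only [slid]
    rw [Function.update_of_ne h.ne, Function.update_self]
    cases t <;> decide
  have hTv : v ≠ T := by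
    intro e
    rw [e] at hv
    revert hv
    simp only [slid]
    rw [Function.update_self]
    cases t <;> decide
  simp [ind, hBv, hTv]

end Slide

end VDiagram

open Classical in
theorem VDiagram.slid_eq {D : VDiagram} {t : SlideType} {B C : D.V} {near far : D.V × Bool} {a : ℤ}
    {kind : D.V → SignType} {weight : D.V × Bool → ℤ} (h1 : kind C = -t.bottomSign)
    (h2 : B ≠ C → kind B = t.bottomSign) (h3 : ∀ v, v ≠ B → v ≠ C → kind v = D.kind v)
    (h4 : ∀ s, weight s = D.weight s + a * ind s near + t.mid * ind s (D.mid₂ t B C) +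
      (-(a + t.mid)) * ind s far) :
    D.slid t B C near far a = { D with kind := kind, weight := weight } := by
  have e1 : Function.update (Function.update D.kind B t.bottomSign) C (-t.bottomSign) = kind := by
    funext v
    by_cases hC : v = C
    · rw [hC, Function.update_self, h1]
    · rw [Function.update_of_ne hC]
      by_cases hB : v = B
      · rw [hB, Function.update_self, h2 (hB ▸ hC)]
      · rw [Function.update_of_ne hB, h3 v hB hC]
  have e2 : (fun s => D.weight s + (if s = near then a else 0)
      + (if s = D.mid₂ t B C then t.mid else 0) - (if s = far then a + t.mid else 0)) = weight := by
    funext s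
    rw [h4]
    simp only [ite_eq_mul_ind]
    ring
  unfold slid
  rw [e1, e2]

namespace Tangle

open VDiagram IntegralOGraph

variable {n : ℕ} (T : Tangle n)

/-! ### Pure sliding moves in tangles -/

/-- Add `u` to the weight of an edge. -/
def addWt (x : (Fin n × Bool) ⊕ Fin 3) (u : ℤ) : Tangle n :=
  { T with
    wt := fun p => T.wt p + if x = .inl p then u else 0
    win := fun j => T.win j + if x = .inr j then u else 0 }

/-- The edge below the crossing `B` on a vertical strand. -/
def lowE (B : Fin n) (b up : Bool) : (Fin n × Bool) ⊕ Fin 3 :=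
  if up then T.back (B, b) else .inl (B, b)

/-- The edge between the crossings `B` and `C` on a vertical strand. -/
def midP (B C : Fin n) (b up : Bool) : Fin n × Bool := if up then (B, b) else (C, b)

/-- The edge above the crossing `C` on a vertical strand. -/
def highE (C : Fin n) (b up : Bool) : (Fin n × Bool) ⊕ Fin 3 :=
  if up then .inl (C, b) else T.back (C, b)

/-- The edge at the beginning or the end of the sliding left strand on the side of the path: below the
crossings, or above if `r = true`. -/
def near₁ (t : SlideType) (r : Bool) (B C : Fin n) : (Fin n × Bool) ⊕ Fin 3 :=
  if r then T.highE C t.leftOver t.leftUp else T.lowE B t.leftOver t.leftUp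

/-- The edge at the other side on the left strand. -/
def far₁ (t : SlideType) (r : Bool) (B C : Fin n) : (Fin n × Bool) ⊕ Fin 3 :=
  if r then T.lowE B t.leftOver t.leftUp else T.highE C t.leftOver t.leftUp

/-- The edge of the right strand on the side of the path. -/
def near₂ (t : SlideType) (r : Bool) (B C : Fin n) : (Fin n × Bool) ⊕ Fin 3 :=
  if r then T.highE C (!t.leftOver) t.rightUp else T.lowE B (!t.leftOver) t.rightUp

/-- The edge at the other side on the right strand. -/
def far₂ (t : SlideType) (r : Bool) (B C : Fin n) : (Fin n × Bool) ⊕ Fin 3 :=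
  if r then T.lowE B (!t.leftOver) t.rightUp else T.highE C (!t.leftOver) t.rightUp

/-- The tangle after a pure sliding move, where `a` is the weight added to the right strand next to
the path. -/
def slide (t : SlideType) (r : Bool) (B C : Fin n) (a : ℤ) : Tangle n :=
  { ((T.addWt (T.near₂ t r B C) a).addWt (.inl (midP B C (!t.leftOver) t.rightUp)) t.mid).addWt
      (T.far₂ t r B C) (-(a + t.mid)) with
    sign := Function.update (Function.update T.sign B t.bottomSign) C (-t.bottomSign) }

/-- Both ends of the edge are in the tangle. -/
def inner (x : (Fin n × Bool) ⊕ Fin 3) : Bool := Sum.elim (fun p => (T.next p).isLeft) (fun _ => false) x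

/-- The conditions for a pure sliding move with a path through the edge `g.1`. -/
abbrev CanSlide (t : SlideType) (r : Bool) (B C : Fin n) (g : ((Fin n × Bool) ⊕ Fin 3) × Fin 3)
    (a : ℤ) : Prop :=
  (B ≠ C ∧ T.sign B = 0 ∧ T.sign C = 0 ∧
    T.next (midP B C t.leftOver t.leftUp) =
      .inl (if t.leftUp then (C, t.leftOver) else (B, t.leftOver)) ∧
    T.next (midP B C (!t.leftOver) t.rightUp) =
      .inl (if t.rightUp then (C, !t.leftOver) else (B, !t.leftOver))) ∧
  ((∀ p, T.wt p = 0) ∧ T.inner (T.near₁ t r B C) ∧ T.inner (T.near₂ t r B C) ∧ T.inner g.1 ∧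
    [.inl (midP B C t.leftOver t.leftUp), .inl (midP B C (!t.leftOver) t.rightUp),
      T.near₁ t r B C, T.near₂ t r B C, g.1].Nodup ∧
    (r = true → T.inner (T.far₁ t r B C) = false ∧ T.inner (T.far₂ t r B C) = false)) ∧
  (T.arrive (if r then (T.near₂ t r B C, t.rightLine) else (T.near₁ t r B C, t.leftLine))).map T.step =
    some g ∧
  (T.arrive g).map T.step =
    some (if r then (T.near₁ t r B C, t.leftLine) else (T.near₂ t r B C, t.rightLine)) ∧
  2 * a = t.low (turn2 (if r then t.rightLine else t.leftLine) g.2 +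
    turn2 g.2 (if r then t.leftLine else t.rightLine))

variable {T} (h : T.Valid) (O : Outside)

theorem weight_addWt (x : (Fin n × Bool) ⊕ Fin 3) (u : ℤ) (s : (T.closure h O).V × Bool) :
    ((T.addWt x u).closure h O).weight s =
      (T.closure h O).weight s + u * ind s (T.edge h O x) := by
  have key : ∀ s, T.joinWt O.link (T.addWt x u).wt (T.addWt x u).win O.weight s =
      (T.closure h O).weight (T.port h O s) + u * ind (T.port h O s) (T.edge h O x) := by
    intro s
    rw [weight_port]
    have hind : ∀ s s' : (Fin n × Bool) ⊕ (O.W × Bool),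
        ind (T.port h O s) (T.port h O s') = ind s s' := by
      intro s s'
      by_cases e : s = s' <;> simp [ind, e]
    have hind' : ∀ (s : (Fin n × Bool) ⊕ (O.W × Bool)) (j : Fin 3),
        ind (T.port h O s) (T.edge h O (.inr j)) = ind (T.join h O.link s) (.inl (T.first j)) := by
      intro s j
      by_cases e : T.join h O.link s = .inl (T.first j)
      · have e' : T.port h O s = T.edge h O (.inr j) := by
          apply (T.closure h O).next.injective
          rw [next_port, next_edge_inr, e]
        simp [ind, e, e']
      · have e' : T.port h O s ≠ T.edge h O (.inr j) := by
          intro e'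
          apply e
          apply (T.port h O).injective
          rw [← next_port, e', next_edge_inr]
        simp [ind, e, e']
    have hf : ∀ i j, T.first i = T.first j ↔ i = j := by
      intro i j
      refine ⟨fun e => ?_, fun e => by rw [e]⟩
      have := (h.2.2 _ j).2 e
      rw [(h.2.2 _ i).2 rfl] at this
      exact Sum.inr_injective this
    have hll : ∀ i j, T.last i = T.last j ↔ i = j := by
      intro i j
      refine ⟨fun e => ?_, fun e => by rw [e]⟩
      have := (h.2.1 _ j).2 e
      rw [(h.2.1 _ i).2 rfl] at this
      exact Sum.inr_injective this
    have hy : ∀ y, T.joinWt O.link (T.addWt x u).wt (T.addWt x u).win O.weight (T.out y) =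
        T.joinWt O.link T.wt T.win O.weight (T.out y) +
          u * ind (T.port h O (T.out y)) (T.edge h O x) := by
      intro y
      rw [Code.joinWt_out _ _ _ _ _ h, Code.joinWt_out _ _ _ _ _ h]
      rcases x with p | i
      · have : u * ind (T.port h O (T.out y)) (T.edge h O (.inl p)) =
            Sum.elim (fun _ => 0) (fun j => if (Sum.inl p : _ ⊕ Fin 3) = .inl (T.last j) then u else 0) y := by
          refine (congrArg (u * ·) (hind _ (.inl p))).trans ?_
          rcases y with y | j
          · simp [ind, Code.out]
          · simp [ind, Code.out, eq_comm]
        rw [this]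
        rcases y with y | j <;> rcases O.link _ with y' | j' <;> simp [addWt] <;> ring
      · rw [hind', Code.join_out]
        have : u * ind (T.inn (O.link y)) (.inl (T.first i)) =
            Sum.elim (fun _ => 0) (fun j => if (Sum.inr i : (Fin n × Bool) ⊕ _) = .inr j then u else 0)
              (O.link y) := by
          rcases O.link y with y | j
          · simp [ind, Code.inn]
          · simp [ind, Code.inn, eq_comm, hf]
        rw [this]
        rcases y with y | j <;> rcases O.link _ with y' | j' <;> simp [addWt] <;> ring
    rcases s with p | y
    · rcases hp : T.next p with q | j
      · rw [Code.joinWt_inl _ _ _ _ _ hp, Code.joinWt_inl _ _ _ _ _ hp]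
        rcases x with p' | i
        · rw [show T.edge h O (.inl p') = T.port h O (.inl p') from rfl, hind]
          simp [addWt, ind, eq_comm]
        · rw [hind', Code.join_inl _ _ h hp]
          have : q ≠ T.first i := by
            intro e
            have h1 := (h.1 p q).1 hp
            rw [(h.2.2 _ i).2 e] at h1
            cases h1
          simp [addWt, ind, this]
      · rw [(h.2.1 _ _).1 hp]
        exact hy (.inr j)
    · exact hy (.inl y)
  obtain ⟨s, rfl⟩ := (T.port h O).surjective s
  rw [← key]
  exact (T.addWt x u).weight_port h O s

theorem closure_slide (t : SlideType) (r : Bool) (B C : Fin n) (a : ℤ) :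
    (T.slide t r B C a).closure h O = (T.closure h O).slid t (T.vert h O (.inl B)) (T.vert h O (.inl C))
      (T.edge h O (T.near₂ t r B C)) (T.edge h O (T.far₂ t r B C)) a := by
  have hinl : ∀ j k : Fin n, (T.vert h O (.inl j) = T.vert h O (.inl k)) ↔ j = k := fun j k =>
    ⟨fun e => Sum.inl_injective ((T.vert h O).injective e), fun e => by rw [e]⟩
  have hinr : ∀ (x : O.W) (k : Fin n), T.vert h O (.inr x) ≠ T.vert h O (.inl k) := fun x k e => by
    cases (T.vert h O).injective e
  have hm : T.edge h O (.inl (midP B C (!t.leftOver) t.rightUp)) =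
      (T.closure h O).mid₂ t (T.vert h O (.inl B)) (T.vert h O (.inl C)) := by
    cases t <;> rfl
  refine Eq.symm (Eq.trans (slid_eq (D := T.closure h O) (kind := ((T.slide t r B C a).closure h O).kind)
    (weight := ((T.slide t r B C a).closure h O).weight) ?_ ?_ ?_ ?_) rfl)
  · change Function.update (Function.update T.sign B t.bottomSign) C (-t.bottomSign) C = _
    rw [Function.update_self]
  · intro e
    have e' : B ≠ C := fun h => e (by rw [h])
    change Function.update (Function.update T.sign B t.bottomSign) C (-t.bottomSign) B = _
    rw [Function.update_of_ne e', Function.update_self]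
  · rintro v h1 h2
    obtain ⟨i | x, rfl⟩ := (T.vert h O).surjective v
    · rw [Ne, hinl] at h1 h2
      change Function.update (Function.update T.sign B t.bottomSign) C (-t.bottomSign) i = T.sign i
      rw [Function.update_of_ne h2, Function.update_of_ne h1]
    · rfl
  · intro s
    rw [← hm]
    exact (weight_addWt (T := (T.addWt (T.near₂ t r B C) a).addWt
        (.inl (midP B C (!t.leftOver) t.rightUp)) t.mid) h O (T.far₂ t r B C) (-(a + t.mid)) s).trans
      (congrArg (· + _) ((weight_addWt (T := T.addWt (T.near₂ t r B C) a) h O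
        (.inl (midP B C (!t.leftOver) t.rightUp)) t.mid s).trans
          (congrArg (· + _) (weight_addWt h O (T.near₂ t r B C) a s))))

/-! ### The condition for a sliding move in the closure -/

theorem lowEdge_vert (B : Fin n) (b up : Bool) :
    (T.closure h O).lowEdge (T.vert h O (.inl B)) b up = T.edge h O (T.lowE B b up) := by
  cases up
  · rfl
  · exact T.symm_port_inl h O (B, b)

theorem highEdge_vert (B : Fin n) (b up : Bool) :
    (T.closure h O).highEdge (T.vert h O (.inl B)) b up = T.edge h O (T.highE B b up) := by
  cases up
  · exact T.symm_port_inl h O (B, b)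
  · rfl

theorem midEdge_vert (B C : Fin n) (b up : Bool) :
    (T.closure h O).midEdge (T.vert h O (.inl B)) (T.vert h O (.inl C)) b up =
      T.edge h O (.inl (midP B C b up)) := by
  cases up <;> rfl

/-- Labels of different tangle edges can be identified by the outside only if both edges are open.
This makes the distinctness conditions of `CanSlide` valid in every closure. -/
theorem edge_eq_of_inner {x y : (Fin n × Bool) ⊕ Fin 3} (hx : T.inner x) (hxy : T.edge h O x = T.edge h O y) :
    x = y := by
  rcases x with p | i
  · rcases y with q | j
    · exact congrArg _ (Sum.inl_injective ((T.port h O).injective hxy))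
    · exfalso
      have e : (Sum.inl p : _ ⊕ (O.W × Bool)) = T.out (O.link.symm (.inr j)) := (T.port h O).injective hxy
      rcases hy : O.link.symm (.inr j) with z | J
      · rw [hy] at e; cases e
      · rw [hy] at e
        have e' : p = T.last J := Sum.inl_injective e
        rw [e', inner, Sum.elim_inl, (h.2.1 _ J).2 rfl] at hx
        cases hx
  · cases hx

theorem weight_edge_of_inner {x : (Fin n × Bool) ⊕ Fin 3} (hx : T.inner x) (hw : ∀ p, T.wt p = 0) :
    (T.closure h O).weight (T.edge h O x) = 0 := by
  rcases x with p | i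
  · rcases hp : T.next p with q | j
    · rw [weight_edge_inl _ _ _ hp, hw]
    · rw [inner, Sum.elim_inl, hp] at hx
      cases hx
  · cases hx

theorem succ_line_of_map {g g' : ((Fin n × Bool) ⊕ Fin 3) × Fin 3} (hg : (T.arrive g).map T.step = some g') :
    (T.closure h O).succ (T.line h O g) = T.line h O g' := by
  obtain ⟨a, ha, rfl⟩ := Option.map_eq_some_iff.1 hg
  exact T.succ_line h O ha

/-- All edges on the short path are inner and have weight zero, so its rotation number is given by
the two corners alone. The weights of the far edges depend on the outside; for `r = true` they must
be moved through the virtual crossings, which is the purpose of the hypotheses on shifts. -/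
theorem CanSlide.reach {t : SlideType} {r : Bool} {B C : Fin n} {g : ((Fin n × Bool) ⊕ Fin 3) × Fin 3}
    {a : ℤ} (H : T.CanSlide t r B C g a) (h : T.Valid) (O : Outside)
    (hB : r = true → ∀ w b u, IntegralOGraph.mk ((T.closure h O).withWeight
      ((T.closure h O).shift (T.vert h O (.inl B), b) u w)) =
        IntegralOGraph.mk ((T.closure h O).withWeight w))
    (hC : r = true → ∀ w b u, IntegralOGraph.mk ((T.closure h O).withWeight
      ((T.closure h O).shift (T.vert h O (.inl C), b) u w)) =
        IntegralOGraph.mk ((T.closure h O).withWeight w))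
    (hD : (T.closure h O).FN) (hD' : ((T.slide t r B C a).closure h O).FN) :
    Reach (T.closure h O) ((T.slide t r B C a).closure h O) := by
  obtain ⟨⟨h1, h2, h3, h4, h5⟩, ⟨k1, k2, k3, k4, k5, k6⟩, m1, m2, m3⟩ := H
  have hb : (T.closure h O).Bigon t (T.vert h O (.inl B)) (T.vert h O (.inl C)) := by
    refine ⟨fun e => h1 (Sum.inl_injective ((T.vert h O).injective e)), h2, h3, ?_, ?_⟩
    · rw [Passes, midEdge_vert]
      refine (T.next_port h O (.inl _)).trans ((congrArg _ (Code.join_inl _ _ h h4)).trans ?_)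
      cases t.leftUp <;> rfl
    · rw [Passes, midEdge_vert]
      refine (T.next_port h O (.inl _)).trans ((congrArg _ (Code.join_inl _ _ h h5)).trans ?_)
      cases t.rightUp <;> rfl
  have hi₁ : T.inner (.inl (midP B C t.leftOver t.leftUp)) := by
    rw [inner, Sum.elim_inl, h4]; rfl
  have hi₂ : T.inner (.inl (midP B C (!t.leftOver) t.rightUp)) := by
    rw [inner, Sum.elim_inl, h5]; rfl
  have w0 : ∀ x, T.inner x → (T.closure h O).weight (T.edge h O x) = 0 := fun x hx =>
    weight_edge_of_inner h O hx k1
  have hrot : ∀ x l g', T.inner x → (T.closure h O).succ (T.line h O (x, l)) = T.line h O g' →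
      (T.closure h O).rot2 (T.line h O (x, l)) = turn2 l g'.2 := by
    intro x l g' hx e
    rw [rot2, e, along]
    simp only [line, w0 x hx]
    simp
  have m1' := succ_line_of_map h O m1
  have m2' := succ_line_of_map h O m2
  rw [closure_slide] at hD' ⊢
  have wm₁ := w0 _ hi₁
  have wm₂ := w0 _ hi₂
  rw [← midEdge_vert] at wm₁ wm₂
  cases r
  · have wl₁ := w0 _ k2
    have wl₂ := w0 _ k3
    have e1 := lowEdge_vert h O B t.leftOver t.leftUp
    have e2 := lowEdge_vert h O B (!t.leftOver) t.rightUp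
    have e3 := highEdge_vert h O C (!t.leftOver) t.rightUp
    simp only [near₁, near₂, far₂, Bool.false_eq_true, if_false] at *
    rw [← e1] at wl₁
    rw [← e2] at wl₂
    rw [← e2, ← e3] at hD' ⊢
    simp only [List.nodup_cons, List.mem_cons, not_or, List.not_mem_nil, not_false_eq_true, and_true,
      List.nodup_nil] at k5
    refine hb.reach_slid (g := T.line h O g) wl₁ wm₁ wl₂ wm₂ ?_ ?_ ?_ ?_ ?_ hD hD'
    · rw [low₁, e1]; exact m1'
    · rw [low₂, e2]; exact m2'
    · rw [low₁, e1]
      exact fun e => k5.2.2.1.2 (edge_eq_of_inner h O k4 e).symm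
    · rw [low₁, e1, low₂, e2]
      exact fun e => k5.2.2.1.1 (edge_eq_of_inner h O k3 e).symm
    · rw [low₁, e1]
      have r1 := hrot _ _ _ k2 m1'
      have r2 := hrot g.1 g.2 _ k4 m2'
      rw [m3]
      exact congrArg _ (congrArg₂ _ r1 r2).symm
  · have wl₁ := w0 _ k2
    have wl₂ := w0 _ k3
    obtain ⟨f1, f2⟩ := k6 rfl
    have e1 := highEdge_vert h O C t.leftOver t.leftUp
    have e2 := highEdge_vert h O C (!t.leftOver) t.rightUp
    have e3 := lowEdge_vert h O B (!t.leftOver) t.rightUp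
    have e4 := lowEdge_vert h O B t.leftOver t.leftUp
    have e5 := midEdge_vert h O B C t.leftOver t.leftUp
    have e6 := midEdge_vert h O B C (!t.leftOver) t.rightUp
    simp only [near₁, near₂, far₁, far₂, if_true] at *
    rw [← e1] at wl₁
    rw [← e2] at wl₂
    rw [← e2, ← e3] at hD' ⊢
    have hin : ∀ x ∈ [.inl (midP B C t.leftOver t.leftUp), .inl (midP B C (!t.leftOver) t.rightUp),
        T.highE C t.leftOver t.leftUp, T.highE C (!t.leftOver) t.rightUp, g.1], T.inner x = true := by
      simp only [List.mem_cons, List.not_mem_nil, or_false]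
      rintro x (rfl | rfl | rfl | rfl | rfl) <;> assumption
    have hmap : [(T.closure h O).mid₁ t (T.vert h O (.inl B)) (T.vert h O (.inl C)),
        (T.closure h O).mid₂ t (T.vert h O (.inl B)) (T.vert h O (.inl C)),
        (T.closure h O).high₁ t (T.vert h O (.inl C)), (T.closure h O).high₂ t (T.vert h O (.inl C)),
        (T.line h O g).1] = [.inl (midP B C t.leftOver t.leftUp),
          .inl (midP B C (!t.leftOver) t.rightUp), T.highE C t.leftOver t.leftUp,
          T.highE C (!t.leftOver) t.rightUp, g.1].map (T.edge h O) := by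
      simp only [List.map_cons, List.map_nil, ← e5, ← e6, ← e1, ← e2]
      rfl
    have hout : ∀ y, T.inner y = false → T.edge h O y ∉
        [.inl (midP B C t.leftOver t.leftUp), .inl (midP B C (!t.leftOver) t.rightUp),
          T.highE C t.leftOver t.leftUp, T.highE C (!t.leftOver) t.rightUp, g.1].map (T.edge h O) := by
      intro y hy hm
      obtain ⟨x, hx, e⟩ := List.mem_map.1 hm
      rw [← edge_eq_of_inner h O (hin x hx) e, hin x hx] at hy
      cases hy
    refine hb.reach_slid_rotated (g := T.line h O g) (hB trivial) (hC trivial) wm₁ wm₂ wl₁ wl₂ ?_ ?_ ?_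
      ?_ ?_ ?_ hD hD'
    · rw [high₂, e2]; exact m1'
    · rw [high₁, e1]; exact m2'
    · rw [hmap]
      exact k5.map_on fun x hx y hy e => edge_eq_of_inner h O (hin x hx) e
    · rw [hmap, low₁, e4]
      exact hout _ f1
    · rw [hmap, low₂, e3]
      exact hout _ f2
    · rw [high₂, e2]
      have r1 := hrot _ _ _ k3 m1'
      have r2 := hrot g.1 g.2 _ k4 m2'
      rw [m3]
      exact congrArg _ (congrArg₂ _ r1 r2).symm

end Tangle

namespace Tangle

open VDiagram IntegralOGraph

variable {n : ℕ}

/-! ### Construction of tangles with virtual crossings -/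

/-- Insert a virtual crossing `v` with its strand `b` inserted into the edge `loc b`. -/
def insert (T : Tangle n) (v : Fin (n + 1)) (loc : Bool → (Fin n × Bool) ⊕ Fin 3) : Tangle (n + 1) :=
  let ins : (Fin n × Bool) ⊕ Fin 3 → List (Fin (n + 1) × Bool) := fun x =>
    (if loc true = x then [(v, true)] else []) ++ if loc false = x then [(v, false)] else []
  let strand : Fin 3 → List (Fin (n + 1) × Bool) := fun j =>
    ins (.inr j) ++ (T.first j :: T.rest j).flatMap fun p => (v.succAbove p.1, p.2) :: ins (.inl p)
  { first := fun j => (strand j).headD (v, true)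
    rest := fun j => (strand j).tail
    sign := v.insertNth 0 T.sign
    wt := fun _ => 0
    win := fun _ => 0 }

/-- The crossings before and after the insertion of a crossing `v`. -/
def insertMap (v : Fin (n + 1)) : Fin n ⊕ Unit → Fin (n + 1) := Sum.elim v.succAbove fun _ => v

/-- The open edge at the end of a strand (for `x.1 = true`) or at its beginning. -/
def openEdge (T : Tangle n) (x : Bool × Fin 3) : (Fin n × Bool) ⊕ Fin 3 :=
  if x.1 then .inl (T.last x.2) else .inr x.2

/-- The open edges which are moved, for the strands `b` of the new crossings. -/
def movedEdge (t : SlideType) (x₁ x₂ : Bool × Fin 3) (b : Bool) : Bool × Fin 3 :=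
  if b = t.leftOver then x₁ else x₂

variable (T : Tangle 2) (t : SlideType) (r : Bool) (x₁ x₂ : Bool × Fin 3)

/-- The tangle with one virtual crossing of two open edges. -/
def cross : Tangle 3 := T.insert 2 fun b => T.openEdge (movedEdge t x₁ x₂ b)

/-- Where to insert a second virtual crossing, nearer to the other crossings than the first one if
`near = true`. -/
def secondLoc (near : Bool) (b : Bool) : (Fin 3 × Bool) ⊕ Fin 3 :=
  let x := movedEdge t x₁ x₂ b
  if near = x.1 then
    if near then .inl ((T.last x.2).1.castSucc, (T.last x.2).2) else .inr x.2
  else .inl (2, b)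

/-- The tangle with two virtual crossings of two open edges: `2` below and `3` above. -/
def bigon : Tangle 4 := (T.cross t x₁ x₂).insert 3 (T.secondLoc t x₁ x₂ r)

/-- The line in the middle of the path along which an edge slides. -/
def pathLine : ((Fin 4 × Bool) ⊕ Fin 3) × Fin 3 :=
  (((T.bigon t r x₁ x₂).arrive (if r then ((T.bigon t r x₁ x₂).near₂ t r 2 3, t.rightLine)
    else ((T.bigon t r x₁ x₂).near₁ t r 2 3, t.leftLine))).map (T.bigon t r x₁ x₂).step).getD
      (.inr 0, 0)

/-- The weight added to the right strand next to the path. -/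
def pathWeight : ℤ := t.low (turn2 (if r then t.rightLine else t.leftLine) (T.pathLine t r x₁ x₂).2 +
    turn2 (T.pathLine t r x₁ x₂).2 (if r then t.leftLine else t.rightLine)) / 2

/-- The tangle obtained by sliding two open edges over each other. -/
def slid : Tangle 4 := (T.bigon t r x₁ x₂).slide t r 2 3 (T.pathWeight t r x₁ x₂)

-- All clauses quantify over finite types, so a refinement of explicit tangles can be checked by
-- evaluation.
set_option synthInstance.maxHeartbeats 200000 in
set_option synthInstance.maxSize 2000 in
instance {n n' : ℕ} (T : Tangle n) (T' : Tangle n') (e : Fin n ⊕ Unit → Fin n')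
    (loc : Bool → (Fin n × Bool) ⊕ Fin 3) : Decidable (IsRefined T T' e loc) :=
  decidable_of_iff (Bijective e ∧ loc true ≠ loc false ∧ (∀ i, T'.sign (e (.inl i)) = T.sign i) ∧
    T'.sign (e (.inr ())) = 0 ∧ (∀ p, T.wt p = 0) ∧ (∀ j, T.win j = 0) ∧ (∀ p, T'.wt p = 0) ∧
    (∀ j, T'.win j = 0) ∧
    (∀ p, loc true ≠ .inl p → loc false ≠ .inl p →
      T'.next (e (.inl p.1), p.2) = Sum.map (fun q => (e (.inl q.1), q.2)) id (T.next p)) ∧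
    (∀ p b, loc b = .inl p → T'.next (e (.inl p.1), p.2) = .inl (e (.inr ()), b) ∧
      T'.next (e (.inr ()), b) = Sum.map (fun q => (e (.inl q.1), q.2)) id (T.next p)) ∧
    (∀ j, loc true ≠ .inr j → loc false ≠ .inr j →
      T'.first j = (e (.inl (T.first j).1), (T.first j).2)) ∧
    ∀ j b, loc b = .inr j → T'.first j = (e (.inr ()), b) ∧
      T'.next (e (.inr ()), b) = .inl (e (.inl (T.first j).1), (T.first j).2))
    ⟨fun ⟨h1, h2, h3, h4, h5, h6, h7, h8, h9, h10, h11, h12⟩ =>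
      ⟨h1, h2, h3, h4, h5, h6, h7, h8, h9, h10, h11, h12⟩,
    fun ⟨h1, h2, h3, h4, h5, h6, h7, h8, h9, h10, h11, h12⟩ =>
      ⟨h1, h2, h3, h4, h5, h6, h7, h8, h9, h10, h11, h12⟩⟩

instance {k n : ℕ} (A : Annulus) (S : Tangle k) (T : Tangle n) (e : Fin k ⊕ Unit → Fin n) :
    Decidable (IsGlue A S T e) :=
  decidable_of_iff (Bijective e ∧ (∀ i, T.sign (e (.inl i)) = S.sign i) ∧
    T.sign (e (.inr ())) = A.sign ∧
    (∀ p q, S.next p = .inl q → T.next (e (.inl p.1), p.2) = .inl (e (.inl q.1), q.2) ∧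
      T.wt (e (.inl p.1), p.2) = S.wt p) ∧
    (∀ a, T.next (Sum.elim (fun b => (e (.inr ()), b))
        (fun j => (e (.inl (S.last j).1), (S.last j).2)) a) =
          Sum.map (Sum.elim (fun b => (e (.inr ()), b))
            (fun j => (e (.inl (S.first j).1), (S.first j).2))) id (A.next a) ∧
      T.wt (Sum.elim (fun b => (e (.inr ()), b)) (fun j => (e (.inl (S.last j).1), (S.last j).2)) a) =
        Sum.elim (fun _ => 0) (fun j => S.wt (S.last j)) a + A.wt a +
          Sum.elim (Sum.elim (fun _ => 0) S.win) (fun _ => 0) (A.next a)) ∧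
    ∀ J, T.first J = Sum.elim (fun b => (e (.inr ()), b))
      (fun j => (e (.inl (S.first j).1), (S.first j).2)) (A.first J) ∧
      T.win J = A.win J + Sum.elim (fun _ => 0) S.win (A.first J))
    ⟨fun ⟨h1, h2, h3, h4, h5, h6⟩ => ⟨h1, h2, h3, h4, h5, h6⟩,
    fun ⟨h1, h2, h3, h4, h5, h6⟩ => ⟨h1, h2, h3, h4, h5, h6⟩⟩

theorem reach_gauge {T : Tangle n} (h : T.Valid) (O : Outside) (hT : ∀ i, T.sign i ≠ 0) (f : Fin n → ℤ)
    (hD : (T.closure h O).FN) : Reach (T.closure h O) ((T.gauge f).closure h O) := by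
  rw [closure_gauge]
  refine IntegralOGraph.reach_gauge _ hD _ ?_
  rintro (i | x) hv
  · exact absurd hv (hT i)
  · rfl

theorem gauge_fn {T : Tangle n} (h : T.Valid) (O : Outside) (f : Fin n → ℤ) (hD : (T.closure h O).FN) :
    ((T.gauge f).closure h O).FN := by
  rw [closure_gauge]
  exact (gauge_fn_iff _ _).2 hD

/-- If `T` is the tangle before a move, then these data show how to replace it by the tangle `T'`, by a
pure sliding move followed by the inverse of the move which replaces `R` by `R'`. -/
structure Detour (T : Tangle 2) (T' : Tangle 3) (R : Tangle 2) (R' : Tangle 3) where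
  t : SlideType
  r : Bool
  x₁ : Bool × Fin 3
  x₂ : Bool × Fin 3
  A : Annulus
  f : Fin 4 → ℤ
  e : Fin 3 ⊕ Unit → Fin 4
  f' : Fin 3 → ℤ
  e' : Fin 2 ⊕ Unit → Fin 3
  valid_A : A.Valid
  valid_cross : (T.cross t x₁ x₂).Valid
  valid_bigon : (T.bigon t r x₁ x₂).Valid
  refined_cross : IsRefined T (T.cross t x₁ x₂) (insertMap 2)
    fun b => T.openEdge (movedEdge t x₁ x₂ b)
  refined_top : IsRefined (T.cross t x₁ x₂) (T.bigon t r x₁ x₂) (insertMap 3)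
    (T.secondLoc t x₁ x₂ r)
  refined_bot : IsRefined (T.cross t x₁ x₂) (T.bigon t r x₁ x₂) (insertMap 2)
    (T.secondLoc t x₁ x₂ (!r))
  canSlide : (T.bigon t r x₁ x₂).CanSlide t r 2 3 (T.pathLine t r x₁ x₂) (T.pathWeight t r x₁ x₂)
  similar_slid : T.Similar (T.slid t r x₁ x₂)
  similar : T.Similar T'
  glue_slid : IsGlue A R' ((T.slid t r x₁ x₂).gauge f) e
  glue : IsGlue A R (T'.gauge f') e'

/-- The tangle `T` can be replaced by `T'` by a sequence of moves. -/
def Replaceable {n n' : ℕ} (T : Tangle n) (T' : Tangle n') (h : T.Valid) (h' : T'.Valid) : Prop :=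
  ∀ O, (T.closure h O).FN → Reach (T.closure h O) (T'.closure h' O)

/-- The chain is: insert two virtual crossings into `T`, slide, adjust by H-moves, read the result
as `R'` in the annulus, apply the known replacement backwards, read `R` in the annulus as `T'`, and
undo the gauge on `T'`. Framedness of the diagram with `R` is deduced from that of the diagram with
`T'`, which is similar to `T`. -/
theorem Detour.replaceable {T : Tangle 2} {T' : Tangle 3} {R : Tangle 2} {R' : Tangle 3}
    (d : Detour T T' R R') (hT : T.Valid) (hT' : T'.Valid) (hR : R.Valid) (hR' : R'.Valid)
    (hd : Replaceable R R' hR hR') : Replaceable T T' hT hT' := by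
  intro O hO
  have r1 := d.refined_cross.refines hT d.valid_cross O
  have r2 := d.refined_top.refines d.valid_cross d.valid_bigon O
  have r3 := d.refined_bot.refines d.valid_cross d.valid_bigon O
  have e1 := r1.mk_eq.trans r2.mk_eq
  have hY : ((T.bigon d.t d.r d.x₁ d.x₂).closure d.valid_bigon O).FN := by
    rw [← isFramed_mk_iff, ← e1, isFramed_mk_iff]
    exact hO
  have hX : ((T.slid d.t d.r d.x₁ d.x₂).closure d.valid_bigon O).FN := d.similar_slid.fn hT _ hO
  have hT'O : (T'.closure hT' O).FN := d.similar.fn hT hT' hO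
  have i1 := d.glue_slid.iso d.valid_A hR' d.valid_bigon O
  have i2 := d.glue.iso d.valid_A hR hT' O
  have hR0 : (R.closure hR (d.A.outside d.valid_A O)).FN :=
    i2.fn_iff.2 (gauge_fn hT' O d.f' hT'O)
  refine (Reach.of_eq e1).trans (Reach.trans (d.canSlide.reach d.valid_bigon O ?_ ?_ hY hX) ?_)
  -- Either of the two virtual crossings can be regarded as the one inserted last, so weights may be
  -- shifted through both.
  · exact fun _ w b u => r3.shift_mk_eq w b u
  · exact fun _ w b u => r2.shift_mk_eq w b u
  refine (reach_gauge (T := T.slid d.t d.r d.x₁ d.x₂) d.valid_bigon O d.similar_slid.2.2 d.f hX).trans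
    ((Reach.of_iso i1).symm.trans ?_)
  exact (hd _ hR0).symm.trans ((Reach.of_iso i2).trans
    (reach_gauge hT' O d.similar.2.2 d.f' hT'O).symm)

end Tangle

/-! ### The MP moves: the primary move, and reduction of one move to another. -/

namespace MPType

open VDiagram IntegralOGraph Tangle

theorem valid_before (m : MPType) : m.before.toTangle.Valid := by cases m <;> decide

theorem valid_after (m : MPType) : m.after.toTangle.Valid := by cases m <;> decide +kernel

/-- The move can be replaced by a sequence of basic moves. -/
def Derivable (m : MPType) : Prop :=
  Replaceable m.before.toTangle m.after.toTangle m.valid_before m.valid_after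

theorem similar_D2 : D2.before.toTangle.Similar D2.after.toTangle := by decide +kernel

theorem derivable_D2 : D2.Derivable := by
  intro O hO
  refine .of_basicMove hO (similar_D2.fn _ _ hO) (.primary ⟨_, _, rfl, rfl, O, _, _, _, _,
    OTangle.isClosure _ (valid_before _) ?_ O, OTangle.isClosure _ (valid_after _) ?_ O, ?_, ?_⟩)
  · decide
  · decide +kernel
  · refine (gauge_zero _).symm.trans (congrArg _ (funext fun v => ?_))
    rcases v with i | x <;> rfl
  · refine (gauge_zero _).symm.trans (congrArg _ (funext fun v => ?_))
    rcases v with i | x <;> rfl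

theorem Derivable.of_detour {m m' : MPType} (h : m'.Derivable) (d : Detour m.before.toTangle
    m.after.toTangle m'.before.toTangle m'.after.toTangle) : m.Derivable :=
  d.replaceable m.valid_before m.valid_after m'.valid_before m'.valid_after h

/-- The free choices of weights in the two tangles are H-moves at real crossings, so they can be
undone before and restored after the standard replacement. -/
theorem Derivable.reach {m : MPType} (hm : m.Derivable) {h : Fin 2 → ℤ} {h' : Fin 3 → ℤ}
    (hs : m.before.toTangle.Similar m.after.toTangle) (hs' : ∀ i, m.before.sign i ≠ 0)
    {D D' : VDiagram} (hD : D.FN) (hMP : VDiagram.MP m h h' D D') : Reach D D' := by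
  obtain ⟨O, E, E', φ, φ', hE, hE', rfl, rfl⟩ := hMP
  rw [gauge_fn_iff] at hD
  have i1 := hE.iso m.valid_before
  have i2 := hE'.iso m.valid_after
  have h1 := i1.fn_iff.2 hD
  have h2 : (m.after.toTangle.closure m.valid_after O).FN := hs.fn _ _ h1
  have h3 := i2.fn_iff.1 h2
  refine (IntegralOGraph.reach_gauge E hD _ ?_).symm.trans ((Reach.of_iso i1).symm.trans
    ((hm O h1).trans ((Reach.of_iso i2).trans (IntegralOGraph.reach_gauge E' h3 _ ?_))))
  · intro v hv
    obtain ⟨i | x, rfl⟩ := φ.surjective v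
    · rw [hE.kind_in] at hv
      exact absurd hv (hs' i)
    · rw [Equiv.symm_apply_apply]; rfl
  · intro v hv
    obtain ⟨i | x, rfl⟩ := φ'.surjective v
    · rw [hE'.kind_in] at hv
      exact absurd hv (hs.2.2 i)
    · rw [Equiv.symm_apply_apply]; rfl

end MPType

end

namespace MPType

open Tangle

/-! ### The sixteen moves -/

/-- The ends of `s₁` and `s₂` are slid over each other. Crossings `0`, `1` and the positive new
crossing `2` form the right-hand side of D2, and the negative crossing `3` goes into the annulus.
Removing crossing `2` from the right-hand side of A1 leaves the left-hand side of D2. In the other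
detours `e` and `e'` likewise name the crossings of the known move, their last component being the
crossing in the annulus. -/
theorem derivable_A1 : A1.Derivable := derivable_D2.of_detour
  { t := .I, r := false, x₁ := (true, 1), x₂ := (true, 2)
    A :=
      { first := ![.inr 2, .inr 0, .inr 1]
        rest := ![[], [.inl true], [.inl false]]
        sign := -1
        wt := Sum.elim (fun _ => 0) ![0, 0, 0]
        win := ![0, 0, 0] }
    f := ![0, 0, 0, 0]
    e := Sum.elim ![0, 1, 2] fun _ => 3
    f' := ![0, 0, 0]
    e' := Sum.elim ![0, 1] fun _ => 2
    valid_A := by decide +kernel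
    valid_cross := by decide +kernel
    valid_bigon := by decide +kernel
    refined_cross := by decide +kernel
    refined_top := by decide +kernel
    refined_bot := by decide +kernel
    canSlide := by decide +kernel
    similar_slid := by decide +kernel
    similar := by decide +kernel
    glue_slid := by decide +kernel
    glue := by decide +kernel }

/-- Here the beginnings of `s₁` and `s₂` are slid, so the short path lies above: the upper crossing
`3` is next to the tangle and the lower, negative crossing `2` is split off. -/
theorem derivable_B3 : B3.Derivable := derivable_D2.of_detour
  { t := .II, r := true, x₁ := (false, 2), x₂ := (false, 1)
    A :=
      { first := ![.inr 1, .inl true, .inl false]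
        rest := ![[], [.inr 2], [.inr 0]]
        sign := -1
        wt := Sum.elim (fun _ => 0) ![0, 0, 0]
        win := ![0, 0, 0] }
    f := ![0, 0, 0, 0]
    e := Sum.elim ![3, 0, 1] fun _ => 2
    f' := ![0, 0, 0]
    e' := Sum.elim ![0, 1] fun _ => 2
    valid_A := by decide +kernel
    valid_cross := by decide +kernel
    valid_bigon := by decide +kernel
    refined_cross := by decide +kernel
    refined_top := by decide +kernel
    refined_bot := by decide +kernel
    canSlide := by decide +kernel
    similar_slid := by decide +kernel
    similar := by decide +kernel
    glue_slid := by decide +kernel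
    glue := by decide +kernel }

/-- This is the first cyclic move. One end and one beginning are slid, and type III leaves weights
on the right strand. The H-move in `f` at the split-off crossing and the weights of the annulus are
chosen so that the same annulus fits both sides of D2, which have weight zero. -/
theorem derivable_C3 : C3.Derivable := derivable_D2.of_detour
  { t := .III, r := true, x₁ := (true, 1), x₂ := (false, 2)
    A :=
      { first := ![.inr 0, .inr 2, .inl false]
        rest := ![[], [.inl true], [.inr 1]]
        sign := -1
        wt := Sum.elim (fun b => cond b (-1) 0) ![0, 0, 1]
        win := ![0, 0, 0] }
    f := ![0, 0, 1, 0]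
    e := Sum.elim ![0, 3, 1] fun _ => 2
    f' := ![0, 0, 0]
    e' := Sum.elim ![0, 1] fun _ => 2
    valid_A := by decide +kernel
    valid_cross := by decide +kernel
    valid_bigon := by decide +kernel
    refined_cross := by decide +kernel
    refined_top := by decide +kernel
    refined_bot := by decide +kernel
    canSlide := by decide +kernel
    similar_slid := by decide +kernel
    similar := by decide +kernel
    glue_slid := by decide +kernel
    glue := by decide +kernel }

theorem derivable_C4 : C4.Derivable := derivable_A1.of_detour
  { t := .II, r := true, x₁ := (false, 2), x₂ := (false, 0)
    A :=
      { first := ![.inl true, .inr 0, .inl false]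
        rest := ![[.inr 1], [], [.inr 2]]
        sign := -1
        wt := Sum.elim (fun _ => 0) ![0, 0, 0]
        win := ![0, 0, 0] }
    f := ![0, 0, 0, 0]
    e := Sum.elim ![3, 0, 1] fun _ => 2
    f' := ![0, 0, 0]
    e' := Sum.elim ![0, 1] fun _ => 2
    valid_A := by decide +kernel
    valid_cross := by decide +kernel
    valid_bigon := by decide +kernel
    refined_cross := by decide +kernel
    refined_top := by decide +kernel
    refined_bot := by decide +kernel
    canSlide := by decide +kernel
    similar_slid := by decide +kernel
    similar := by decide +kernel
    glue_slid := by decide +kernel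
    glue := by decide +kernel }

theorem derivable_C1 : C1.Derivable := derivable_B3.of_detour
  { t := .I, r := false, x₁ := (true, 1), x₂ := (true, 0)
    A :=
      { first := ![.inr 2, .inr 1, .inr 0]
        rest := ![[.inl false], [.inl true], []]
        sign := -1
        wt := Sum.elim (fun _ => 0) ![0, 0, 0]
        win := ![0, 0, 0] }
    f := ![0, 0, 0, 0]
    e := Sum.elim ![1, 2, 0] fun _ => 3
    f' := ![0, 0, 0]
    e' := Sum.elim ![0, 1] fun _ => 2
    valid_A := by decide +kernel
    valid_cross := by decide +kernel
    valid_bigon := by decide +kernel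
    refined_cross := by decide +kernel
    refined_top := by decide +kernel
    refined_bot := by decide +kernel
    canSlide := by decide +kernel
    similar_slid := by decide +kernel
    similar := by decide +kernel
    glue_slid := by decide +kernel
    glue := by decide +kernel }

/-- The known move C3 itself carries weights on its three-crossing side, so crossings of the inner
tangle also need H-moves to match them. -/
theorem derivable_A2 : A2.Derivable := derivable_C3.of_detour
  { t := .IV, r := true, x₁ := (false, 1), x₂ := (true, 2)
    A :=
      { first := ![.inr 1, .inl true, .inr 2]
        rest := ![[], [.inr 0], [.inl false]]
        sign := -1
        wt := Sum.elim (fun b => cond b (-1) 0) ![1, 1, 0]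
        win := ![-1, 0, 0] }
    f := ![-1, 0, 0, -1]
    e := Sum.elim ![3, 0, 1] fun _ => 2
    f' := ![-1, 0, 0]
    e' := Sum.elim ![0, 1] fun _ => 2
    valid_A := by decide +kernel
    valid_cross := by decide +kernel
    valid_bigon := by decide +kernel
    refined_cross := by decide +kernel
    refined_top := by decide +kernel
    refined_bot := by decide +kernel
    canSlide := by decide +kernel
    similar_slid := by decide +kernel
    similar := by decide +kernel
    glue_slid := by decide +kernel
    glue := by decide +kernel }

theorem derivable_B4 : B4.Derivable := derivable_C3.of_detour
  { t := .IV, r := true, x₁ := (false, 1), x₂ := (true, 2)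
    A :=
      { first := ![.inr 2, .inl true, .inr 0]
        rest := ![[], [.inr 1], [.inl false]]
        sign := -1
        wt := Sum.elim (fun b => cond b (-1) 0) ![0, 1, 0]
        win := ![0, 0, 0] }
    f := ![0, 0, 0, -1]
    e := Sum.elim ![1, 3, 0] fun _ => 2
    f' := ![0, 0, 0]
    e' := Sum.elim ![0, 1] fun _ => 2
    valid_A := by decide +kernel
    valid_cross := by decide +kernel
    valid_bigon := by decide +kernel
    refined_cross := by decide +kernel
    refined_top := by decide +kernel
    refined_bot := by decide +kernel
    canSlide := by decide +kernel
    similar_slid := by decide +kernel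
    similar := by decide +kernel
    glue_slid := by decide +kernel
    glue := by decide +kernel }

theorem derivable_B2 : B2.Derivable := derivable_C4.of_detour
  { t := .IV, r := true, x₁ := (false, 2), x₂ := (true, 1)
    A :=
      { first := ![.inr 2, .inr 0, .inl true]
        rest := ![[], [.inl false], [.inr 1]]
        sign := -1
        wt := Sum.elim (fun b => cond b 0 1) ![-1, 0, 0]
        win := ![0, 0, 0] }
    f := ![0, 0, 0, 0]
    e := Sum.elim ![3, 1, 0] fun _ => 2
    f' := ![0, 0, 0]
    e' := Sum.elim ![0, 1] fun _ => 2
    valid_A := by decide +kernel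
    valid_cross := by decide +kernel
    valid_bigon := by decide +kernel
    refined_cross := by decide +kernel
    refined_top := by decide +kernel
    refined_bot := by decide +kernel
    canSlide := by decide +kernel
    similar_slid := by decide +kernel
    similar := by decide +kernel
    glue_slid := by decide +kernel
    glue := by decide +kernel }

theorem derivable_D1 : D1.Derivable := derivable_C4.of_detour
  { t := .I, r := false, x₁ := (true, 2), x₂ := (true, 1)
    A :=
      { first := ![.inr 0, .inr 2, .inr 1]
        rest := ![[], [.inl false], [.inl true]]
        sign := -1
        wt := Sum.elim (fun _ => 0) ![0, 0, 0]
        win := ![0, 0, 0] }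
    f := ![0, 0, 0, 0]
    e := Sum.elim ![1, 2, 0] fun _ => 3
    f' := ![0, 0, 0]
    e' := Sum.elim ![0, 1] fun _ => 2
    valid_A := by decide +kernel
    valid_cross := by decide +kernel
    valid_bigon := by decide +kernel
    refined_cross := by decide +kernel
    refined_top := by decide +kernel
    refined_bot := by decide +kernel
    canSlide := by decide +kernel
    similar_slid := by decide +kernel
    similar := by decide +kernel
    glue_slid := by decide +kernel
    glue := by decide +kernel }

/-- On the right-hand side of A4 the crossing split off is crossing `1`. What remains is the
left-hand side of C1, whose negative first crossing is `2` and whose positive second crossing is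
`0`. -/
theorem derivable_A4 : A4.Derivable := derivable_C1.of_detour
  { t := .IV, r := true, x₁ := (false, 2), x₂ := (true, 1)
    A :=
      { first := ![.inr 1, .inr 2, .inl true]
        rest := ![[], [.inl false], [.inr 0]]
        sign := -1
        wt := Sum.elim (fun b => cond b 0 1) ![0, 0, -1]
        win := ![0, 0, 0] }
    f := ![0, 0, 0, 0]
    e := Sum.elim ![0, 3, 1] fun _ => 2
    f' := ![0, 0, 0]
    e' := Sum.elim ![2, 0] fun _ => 1
    valid_A := by decide +kernel
    valid_cross := by decide +kernel
    valid_bigon := by decide +kernel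
    refined_cross := by decide +kernel
    refined_top := by decide +kernel
    refined_bot := by decide +kernel
    canSlide := by decide +kernel
    similar_slid := by decide +kernel
    similar := by decide +kernel
    glue_slid := by decide +kernel
    glue := by decide +kernel }

theorem derivable_D4 : D4.Derivable := derivable_C1.of_detour
  { t := .II, r := true, x₁ := (false, 1), x₂ := (false, 2)
    A :=
      { first := ![.inr 0, .inl false, .inl true]
        rest := ![[], [.inr 2], [.inr 1]]
        sign := -1
        wt := Sum.elim (fun _ => 0) ![0, 0, 0]
        win := ![0, 0, 0] }
    f := ![0, 0, 0, 0]
    e := Sum.elim ![3, 0, 1] fun _ => 2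
    f' := ![0, 0, 0]
    e' := Sum.elim ![2, 0] fun _ => 1
    valid_A := by decide +kernel
    valid_cross := by decide +kernel
    valid_bigon := by decide +kernel
    refined_cross := by decide +kernel
    refined_top := by decide +kernel
    refined_bot := by decide +kernel
    canSlide := by decide +kernel
    similar_slid := by decide +kernel
    similar := by decide +kernel
    glue_slid := by decide +kernel
    glue := by decide +kernel }

/-- Both D3 and the known move B2 are cyclic. To make a single weighted annulus fit, gauges are
needed on the slid tangle and on the tangle after the move. -/
theorem derivable_D3 : D3.Derivable := derivable_B2.of_detour
  { t := .III, r := true, x₁ := (true, 2), x₂ := (false, 0)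
    A :=
      { first := ![.inl false, .inr 0, .inr 2]
        rest := ![[.inr 1], [], [.inl true]]
        sign := -1
        wt := Sum.elim (fun _ => 0) ![0, 0, 1]
        win := ![0, 0, -1] }
    f := ![0, -1, 0, -1]
    e := Sum.elim ![3, 0, 1] fun _ => 2
    f' := ![-1, 0, 0]
    e' := Sum.elim ![2, 0] fun _ => 1
    valid_A := by decide +kernel
    valid_cross := by decide +kernel
    valid_bigon := by decide +kernel
    refined_cross := by decide +kernel
    refined_top := by decide +kernel
    refined_bot := by decide +kernel
    canSlide := by decide +kernel
    similar_slid := by decide +kernel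
    similar := by decide +kernel
    glue_slid := by decide +kernel
    glue := by decide +kernel }

theorem derivable_B1 : B1.Derivable := derivable_D1.of_detour
  { t := .II, r := true, x₁ := (false, 1), x₂ := (false, 2)
    A :=
      { first := ![.inr 1, .inl false, .inl true]
        rest := ![[], [.inr 0], [.inr 2]]
        sign := -1
        wt := Sum.elim (fun _ => 0) ![0, 0, 0]
        win := ![0, 0, 0] }
    f := ![0, 0, 0, 0]
    e := Sum.elim ![3, 0, 1] fun _ => 2
    f' := ![0, 0, 0]
    e' := Sum.elim ![2, 0] fun _ => 1
    valid_A := by decide +kernel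
    valid_cross := by decide +kernel
    valid_bigon := by decide +kernel
    refined_cross := by decide +kernel
    refined_top := by decide +kernel
    refined_bot := by decide +kernel
    canSlide := by decide +kernel
    similar_slid := by decide +kernel
    similar := by decide +kernel
    glue_slid := by decide +kernel
    glue := by decide +kernel }

theorem derivable_A3 : A3.Derivable := derivable_D4.of_detour
  { t := .I, r := false, x₁ := (true, 2), x₂ := (true, 1)
    A :=
      { first := ![.inr 2, .inr 1, .inr 0]
        rest := ![[], [.inl false], [.inl true]]
        sign := -1
        wt := Sum.elim (fun _ => 0) ![0, 0, 0]
        win := ![0, 0, 0] }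
    f := ![0, 0, 0, 0]
    e := Sum.elim ![2, 0, 1] fun _ => 3
    f' := ![0, 0, 0]
    e' := Sum.elim ![0, 1] fun _ => 2
    valid_A := by decide +kernel
    valid_cross := by decide +kernel
    valid_bigon := by decide +kernel
    refined_cross := by decide +kernel
    refined_top := by decide +kernel
    refined_bot := by decide +kernel
    canSlide := by decide +kernel
    similar_slid := by decide +kernel
    similar := by decide +kernel
    glue_slid := by decide +kernel
    glue := by decide +kernel }

/-- The move C2 has no weights, but the slid tangle contains the cyclic side of D3. The weights
created by type IV are exactly those of D3, so no gauge is needed. -/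
theorem derivable_C2 : C2.Derivable := derivable_D3.of_detour
  { t := .IV, r := true, x₁ := (false, 1), x₂ := (true, 2)
    A :=
      { first := ![.inr 0, .inl true, .inr 1]
        rest := ![[], [.inr 2], [.inl false]]
        sign := -1
        wt := Sum.elim (fun _ => 0) ![0, 0, 0]
        win := ![0, 0, 0] }
    f := ![0, 0, 0, 0]
    e := Sum.elim ![3, 0, 1] fun _ => 2
    f' := ![0, 0, 0]
    e' := Sum.elim ![0, 2] fun _ => 1
    valid_A := by decide +kernel
    valid_cross := by decide +kernel
    valid_bigon := by decide +kernel
    refined_cross := by decide +kernel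
    refined_top := by decide +kernel
    refined_bot := by decide +kernel
    canSlide := by decide +kernel
    similar_slid := by decide +kernel
    similar := by decide +kernel
    glue_slid := by decide +kernel
    glue := by decide +kernel }

theorem derivable : ∀ m : MPType, m.Derivable
  | A1 => derivable_A1
  | A2 => derivable_A2
  | A3 => derivable_A3
  | A4 => derivable_A4
  | B1 => derivable_B1
  | B2 => derivable_B2
  | B3 => derivable_B3
  | B4 => derivable_B4
  | C1 => derivable_C1
  | C2 => derivable_C2
  | C3 => derivable_C3
  | C4 => derivable_C4
  | D1 => derivable_D1
  | D2 => derivable_D2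
  | D3 => derivable_D3
  | D4 => derivable_D4

theorem similar (m : MPType) : m.before.toTangle.Similar m.after.toTangle := by
  cases m <;> decide +kernel

theorem sign_before_ne_zero (m : MPType) (i : Fin 2) : m.before.sign i ≠ 0 := by
  cases m <;> revert i <;> decide

end MPType

theorem mainTheorem4 (m : MPType) (Γ Γ' : IntegralOGraph) (hΓ : Γ.IsFramed)
    (hMP : IntegralOGraph.MPMove m Γ Γ') :
    Relation.ReflTransGen IntegralOGraph.Step Γ Γ' := by
  obtain ⟨h, h', D, D', rfl, rfl, hD⟩ := hMP
  exact m.derivable.reach m.similar m.sign_before_ne_zero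
    ((IntegralOGraph.isFramed_mk_iff D).1 hΓ) hD
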